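/- Notation: $\hat f(\xi)=\int_{\mathbb R} f(x)e^{-2\pi i x\xi}\,dx$. For $a,b>0$, the Hardy class $E(a,b)$ is the space of Schwartz functions $f:\mathbb R\to\mathbb C$ with $$\sup_{x\in\mathbb R}|f(x)|e^{a\pi|x|^2}+\sup_{\xi\in\mathbb R}|\hat f(\xi)|e^{b\pi|\xi|^2}<\infty.$$ Let $p>0$. A sequence $\Gamma=(\gamma_j)_{j\ge1}$ of complex numbers on a closed ray from the origin, with $|\gamma_1|<|\gamma_2|<\cdots$ and $|\gamma_j|\to\infty$, is called $p$-smooth with density $D=D(\Gamma,p)>0$ if $\bigl|\#\{j:|\gamma_j|<r\}-Dr^p\bigr|=O(1)$ as $r\to\infty$ and there is $d>0$ with $|\gamma_{j+1}-\gamma_j|\ge d(1+|\gamma_j|)^{1-p}$ for all $j$. For $\Gamma\subset\mathbb R$ put $\Gamma_+=\Gamma\cap[0,\infty)$ and $\Gamma_-=\Gamma\cap(-\infty,0]$. Theorem. Let $a,b>0$ with $ab<1$, and let $\Lambda,M\subset\mathbb R$ be such that $\Lambda_-,\Lambda_+,M_-,M_+$ are $2$-smooth sequences with densities $D_\Lambda=D(\Lambda_-,2)=D(\Lambda_+,2)$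 and $D_M=D(M_-,2)=D(M_+,2)$. (i) If $$D_\Lambda>\sqrt{a\left(\tfrac1b-a\right)}\quad\text{and}\quad D_M>\sqrt{b\left(\tfrac1a-b\right)},$$ then every $f\in E(a,b)$ with $f|_\Lambda=0$ and $\hat f|_M=0$ is identically zero. (ii) Conversely, if $$D_\Lambda<\sqrt{a\left(\tfrac1b-a\right)}\quad\text{and}\quad D_M<\sqrt{b\left(\tfrac1a-b\right)},$$ then there is an infinite-dimensional complex vector space of functions $f\in E(a,b)$ with $f|_\Lambda=0$ and $\hat f|_M=0$. -/

import Mathlib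

open scoped FourierTransform SchwartzMap

noncomputable section

/-- The counting function `n_Γ(r) = |Γ ∩ r𝔻|` of a set of complex numbers. -/
def countingFunction (Γ : Set ℂ) (r : ℝ) : ℕ :=
  (Γ ∩ Metric.ball 0 r).ncard

/-- `Γ` is (the set of points of) a `p`-smooth sequence with density `D`: its points
`γ 0, γ 1, …` lie on one closed ray from the origin, their moduli increase strictly to
infinity, `n_Γ(r) = D r ^ p + O(1)`, and consecutive points satisfy
`|γ (j+1) - γ j| ≥ d (1 + |γ j|) ^ (1 - p)` for some `d > 0`. -/
structure IsSmoothSequence (Γ : Set ℂ) (p D : ℝ) : Prop where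
  exponent_pos : 0 < p
  density_pos : 0 < D
  exists_enum : ∃ γ : ℕ → ℂ, Set.range γ = Γ ∧
    (∃ θ : ℝ, ∀ j, γ j = (‖γ j‖ : ℂ) * Complex.exp (θ * Complex.I)) ∧
    StrictMono (fun j => ‖γ j‖) ∧
    Filter.Tendsto (fun j => ‖γ j‖) Filter.atTop Filter.atTop ∧
    ∃ d : ℝ, 0 < d ∧ ∀ j, d * (1 + ‖γ j‖) ^ (1 - p) ≤ ‖γ (j + 1) - γ j‖
  counting : (fun r : ℝ => (countingFunction Γ r : ℝ) - D * r ^ p)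
    =O[Filter.atTop] (fun _ : ℝ => (1 : ℝ))

/-- The part of a real set in `[0, ∞)`, as a set of complex numbers. -/
def positiveHalf (Λ : Set ℝ) : Set ℂ := Complex.ofReal '' (Λ ∩ Set.Ici 0)

/-- The part of a real set in `(-∞, 0]`, as a set of complex numbers. -/
def negativeHalf (Λ : Set ℝ) : Set ℂ := Complex.ofReal '' (Λ ∩ Set.Iic 0)

/-- The Hardy class `E(a, b)`: Schwartz functions `f` with
`sup |f(x)| exp(a π x²) < ∞` and `sup |𝓕 f(ξ)| exp(b π ξ²) < ∞`, where
`𝓕 f(ξ) = ∫ f(x) exp(-2 π i x ξ) dx`. -/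
def hardyClass (a b : ℝ) : Set 𝓢(ℝ, ℂ) :=
  {f | BddAbove (Set.range fun x : ℝ => ‖f x‖ * Real.exp (a * Real.pi * |x| ^ 2)) ∧
    BddAbove (Set.range fun ξ : ℝ =>
      ‖𝓕 (f : ℝ → ℂ) ξ‖ * Real.exp (b * Real.pi * |ξ| ^ 2))}

end

/-! The two halves rest on one tool. For a half-line sequence of density `D`, regular in the
variable `t²`, the canonical product with these zeros, a mirror family on the negative axis and
zeros `±i√((n+1)/D)` behaves like `sin(πDz²)/(πDz²)`: up to factors `exp(O(|z|))` its modulus is at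
most `exp(πD|Im z²|)` (`norm_canonicalProduct_le`). In the sector `Re z ≥ 0`, `Re z² ≥ 0` it is at
least that large away from its zeros (`le_norm_canonicalProduct`). Both follow by comparing the
product factor by factor with the exact sine product.

Uniqueness. Decay of the Fourier transform at rate `b` makes `f` entire with `|F(z)| ≤ C exp(π
y²/b)`, and Phragmén–Lindelöf between the real axis and the ray `y = tx` gives `|F| ≤ C exp(-aπ Re
z² + cπ|Im z²|)` with `2c = (1/b - a)t + a/t`. For a suitable `t` the value `c` falls below `D` as
soon as `D² > a(1/b - a)`. Dividing by the canonical product then leaves a function that decays on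
nearby rays faster than rate `a`; a second Phragmén–Lindelöf argument carries this to the real axis,
where the product grows subgaussianly. So zeros that are too dense improve the decay rate
(`exists_norm_le_of_zeros`). Let `A`, `B` be the suprema of the rates of a nonzero `f` and of its
transform. Hardy's principle gives `AB ≤ 1`, and since no improvement is possible, `D_Λ² ≤ A(1/B -
A)` and `D_M² ≤ B(1/A - B)`. The product of the right sides is `(1 - AB)²`, which is at most `(1 -
ab)²`, whereas the hypotheses say `D_Λ² D_M² > (1 - ab)²`.

Existence. Below the critical density a Lagrange series with kernels `exp(-a₁πz²) G(z)/(z - x_i)`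
interpolates bounded data, suitably weighted, by functions in a Hardy class
(`exists_interpolation`). Apply this on the space side (operator `T`) and on the frequency side
(operator `S`), and seek `f = Tα + 𝓕⁻¹ S(Φα)`, where `Φα` cancels the values of `𝓕(Tα)` at the
frequency nodes. The values of `f` at the space nodes are then weighted values of `α + ΨΦα`. After
finitely many frequency nodes are discarded `ΨΦ` has norm below 1, so all bounded data on the space
nodes are attained (`exists_mem_hardyClass`). The gap between the density and its threshold leaves
room for infinitely many extra nodes, whose free values give infinite dimension; the finitely many
discarded conditions cost only finite codimension. -/

/-! ### Sequences that are regular in the variable `t²`. -/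

/-- Positive sequences whose squares are separated and stay within bounded distance of the
arithmetic progression with density `D`. -/
structure IsSquareRegular (D : ℝ) (t : ℕ → ℝ) : Prop where
  density_pos : 0 < D
  pos : ∀ n, 0 < t n
  close : ∃ C, ∀ n : ℕ, |t n ^ 2 - (n + 1) / D| ≤ C
  gap : ∃ d > 0, ∀ n, d ≤ t (n + 1) ^ 2 - t n ^ 2

namespace IsSquareRegular

variable {D : ℝ} {s t : ℕ → ℝ}

theorem exists_separated (ht : IsSquareRegular D t) :
    ∃ d > 0, ∀ m n : ℕ, d * |(n : ℝ) - m| ≤ |t n ^ 2 - t m ^ 2| := by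
  obtain ⟨d, hd, h⟩ := ht.gap
  have key : ∀ m k : ℕ, d * k ≤ t (m + k) ^ 2 - t m ^ 2 := by
    intro m k
    induction k with
    | zero => simp
    | succ k ih =>
      have := h (m + k)
      push_cast
      rw [← add_assoc]
      linarith
  refine ⟨d, hd, fun m n => ?_⟩
  rcases le_total m n with hmn | hmn
  · obtain ⟨k, rfl⟩ := Nat.exists_eq_add_of_le hmn
    have := key m k
    rw [abs_of_nonneg (by push_cast; linarith [Nat.cast_nonneg (α := ℝ) k])]
    push_cast
    calc _ = d * k := by ring
      _ ≤ _ := this.trans (le_abs_self _)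
  · obtain ⟨k, rfl⟩ := Nat.exists_eq_add_of_le hmn
    have := key n k
    rw [abs_of_nonpos (by push_cast; linarith [Nat.cast_nonneg (α := ℝ) k]), abs_sub_comm]
    push_cast
    calc _ = d * k := by ring
      _ ≤ _ := this.trans (le_abs_self _)

theorem exists_lower (ht : IsSquareRegular D t) :
    ∃ c > 0, ∀ n : ℕ, c * (n + 1) ≤ t n ^ 2 := by
  obtain ⟨d, hd, h⟩ := ht.gap
  have h0 : 0 < t 0 ^ 2 := pow_pos (ht.pos 0) 2
  refine ⟨min d (t 0 ^ 2), lt_min hd h0, fun n => ?_⟩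
  induction n with
  | zero => simp
  | succ n ih =>
    have := h n
    have h2 := min_le_left d (t 0 ^ 2)
    push_cast
    linarith

theorem exists_upper (ht : IsSquareRegular D t) :
    ∃ C > 0, ∀ n : ℕ, t n ^ 2 ≤ C * (n + 1) := by
  obtain ⟨C, hC⟩ := ht.close
  have hD := ht.density_pos
  have hC0 : 0 ≤ C := (abs_nonneg _).trans (hC 0)
  refine ⟨C + 1 / D, by positivity, fun n => ?_⟩
  have := (abs_le.1 (hC n)).2
  have h2 : C ≤ C * (n + 1) := by nlinarith [Nat.cast_nonneg (α := ℝ) n]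
  have h3 : ((n : ℝ) + 1) / D = 1 / D * (n + 1) := by ring
  linarith

/-- Both squares follow the same progression, so `t n ^ 2 - s n ^ 2` is bounded, while `t n + s n`
is at least of order `√(n + 1)`. -/
theorem exists_sub (hs : IsSquareRegular D s) (ht : IsSquareRegular D t) :
    ∃ C > 0, ∀ n : ℕ, |t n - s n| * √((n : ℝ) + 1) ≤ C := by
  obtain ⟨C, hC⟩ := hs.close
  obtain ⟨C', hC'⟩ := ht.close
  obtain ⟨c, hc, hcs⟩ := hs.exists_lower
  have hC0 : 0 ≤ C := (abs_nonneg _).trans (hC 0)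
  have hC0' : 0 ≤ C' := (abs_nonneg _).trans (hC' 0)
  refine ⟨(C + C' + 1) / √c, by positivity, fun n => ?_⟩
  have hsn := hs.pos n
  have htn := ht.pos n
  have h1 : √c * √((n : ℝ) + 1) ≤ s n := by
    rw [← Real.sqrt_mul hc.le]
    exact Real.sqrt_le_iff.2 ⟨hsn.le, hcs n⟩
  have h2 : |t n - s n| * (t n + s n) ≤ C + C' := by
    have : |t n - s n| * (t n + s n) = |t n ^ 2 - s n ^ 2| := by
      rw [← abs_of_pos (add_pos htn hsn), ← abs_mul]; ring_nf
    rw [this]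
    calc |t n ^ 2 - s n ^ 2| ≤ |t n ^ 2 - (n + 1) / D| + |(n + 1) / D - s n ^ 2| := abs_sub_le _ _ _
      _ ≤ C' + C := add_le_add (hC' n) (by rw [abs_sub_comm]; exact hC n)
      _ = _ := add_comm _ _
  rw [le_div_iff₀ (Real.sqrt_pos.2 hc)]
  have : |t n - s n| * s n ≤ |t n - s n| * (t n + s n) := by gcongr; linarith
  have : |t n - s n| * (√c * √((n : ℝ) + 1)) ≤ |t n - s n| * s n := by gcongr
  nlinarith

theorem exists_nearest (ht : IsSquareRegular D t) (z : ℂ) :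
    ∃ k, ∀ n, ‖(t k : ℂ) ^ 2 - z ^ 2‖ ≤ ‖(t n : ℂ) ^ 2 - z ^ 2‖ := by
  obtain ⟨c, hc, h⟩ := ht.exists_lower
  have : Filter.Tendsto (fun n => ‖(t n : ℂ) ^ 2 - z ^ 2‖) Filter.cofinite Filter.atTop := by
    rw [Nat.cofinite_eq_atTop]
    have h1 : Filter.Tendsto (fun n : ℕ => c * ((n : ℝ) + 1) - ‖z ^ 2‖) Filter.atTop Filter.atTop := by
      refine Filter.tendsto_atTop_add_const_right _ _ (Filter.Tendsto.const_mul_atTop hc ?_)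
      exact Filter.tendsto_atTop_add_const_right _ _ tendsto_natCast_atTop_atTop
    refine Filter.tendsto_atTop_mono (fun n => ?_) h1
    have h2 := norm_sub_norm_le ((t n : ℂ) ^ 2) (z ^ 2)
    have h3 : ‖(t n : ℂ) ^ 2‖ = t n ^ 2 := by
      rw [norm_pow, Complex.norm_real, Real.norm_eq_abs, sq_abs]
    have := h n
    linarith
  exact this.exists_forall_le

/-- The distance from `z²` to the nearest square is at most the one to `t n ^ 2`, so the latter is
at least half the separation. -/
theorem mul_abs_sub_le_of_nearest {d : ℝ}
    (hd : ∀ m n : ℕ, d * |(n : ℝ) - m| ≤ |t n ^ 2 - t m ^ 2|) {z : ℂ} {k : ℕ}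
    (hk : ∀ n, ‖(t k : ℂ) ^ 2 - z ^ 2‖ ≤ ‖(t n : ℂ) ^ 2 - z ^ 2‖) (n : ℕ) :
    d / 2 * |(n : ℝ) - k| ≤ ‖(t n : ℂ) ^ 2 - z ^ 2‖ := by
  have h1 := hd k n
  have h2 : |t n ^ 2 - t k ^ 2| = ‖((t n : ℂ) ^ 2 - z ^ 2) - ((t k : ℂ) ^ 2 - z ^ 2)‖ := by
    rw [sub_sub_sub_cancel_right, ← Real.norm_eq_abs, ← Complex.norm_real]; push_cast; rfl
  have h3 := norm_sub_le ((t n : ℂ) ^ 2 - z ^ 2) ((t k : ℂ) ^ 2 - z ^ 2)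
  have h4 := hk n
  linarith

theorem sq_le_of_nearest {z : ℂ} {k : ℕ}
    (hk : ∀ n, ‖(t k : ℂ) ^ 2 - z ^ 2‖ ≤ ‖(t n : ℂ) ^ 2 - z ^ 2‖) :
    t k ^ 2 ≤ 2 * ‖z‖ ^ 2 + t 0 ^ 2 := by
  have h3 : ∀ n, ‖(t n : ℂ) ^ 2‖ = t n ^ 2 := fun n => by
    rw [norm_pow, Complex.norm_real, Real.norm_eq_abs, sq_abs]
  have h1 := norm_sub_norm_le ((t k : ℂ) ^ 2) (z ^ 2)
  have h2 := norm_sub_le ((t 0 : ℂ) ^ 2) (z ^ 2)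
  have h4 := hk 0
  rw [h3, norm_pow] at h1 h2
  linarith

end IsSquareRegular

/-! ### Comparison of products over two regular sequences of equal density. -/

theorem prod_norm_le_exp_sum {ι : Type*} (A : Finset ι) (f g : ι → ℂ) (e : ι → ℝ)
    (h : ∀ n ∈ A, ‖f n - g n‖ ≤ e n * ‖g n‖) :
    ∏ n ∈ A, ‖f n‖ ≤ Real.exp (∑ n ∈ A, e n) * ∏ n ∈ A, ‖g n‖ := by
  rw [Real.exp_sum, ← Finset.prod_mul_distrib]
  refine Finset.prod_le_prod (fun _ _ => norm_nonneg _) fun n hn => ?_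
  have h1 : ‖f n‖ ≤ ‖f n - g n‖ + ‖g n‖ := by simpa using norm_add_le (f n - g n) (g n)
  have h2 := h n hn
  have h3 : (e n + 1) * ‖g n‖ ≤ Real.exp (e n) * ‖g n‖ := by
    gcongr; exact Real.add_one_le_exp _
  linarith

theorem summable_inv_sqrt_abs_pow_three :
    Summable fun j : ℤ => 1 / √|(j : ℝ)| ^ 3 := by
  have h : ∀ x : ℝ, 1 / √|x| ^ 3 = |x| ^ (-(3 / 2 : ℝ)) := by
    intro x
    rw [Real.rpow_neg (abs_nonneg _), Real.sqrt_eq_rpow, ← Real.rpow_natCast,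
      ← Real.rpow_mul (abs_nonneg _), one_div]
    norm_num
  simp_rw [h]
  exact Real.summable_abs_int_rpow (by norm_num)

/-- The shifted indices are distinct integers, so the bound is uniform in `k`. A term `n = k` counts
as `0` because `1 / 0 = 0`, and `k = -1` gives the sum of `(n + 1) ^ (-3/2)`. -/
theorem sum_inv_sqrt_sub_le (A : Finset ℕ) (k : ℤ) :
    ∑ n ∈ A, 1 / √|((n : ℝ) - k)| ^ 3 ≤ ∑' j : ℤ, 1 / √|(j : ℝ)| ^ 3 := by
  have h := summable_inv_sqrt_abs_pow_three
  have := h.sum_le_tsum (A.image fun n : ℕ => (n : ℤ) - k) fun j _ => by positivity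
  rw [Finset.sum_image (by intro a _ b _ hab; simpa using hab)] at this
  simpa using this

theorem summable_inv_sqrt_nat_pow_three :
    Summable fun n : ℕ => 1 / √((n : ℝ) + 1) ^ 3 := by
  have h := summable_inv_sqrt_abs_pow_three.comp_injective
    (show Function.Injective (fun n : ℕ => (n : ℤ) + 1) from fun a b hab => by simpa using hab)
  refine h.congr fun n => ?_
  have : (0 : ℝ) ≤ n + 1 := by positivity
  simp [abs_of_nonneg this]

theorem inv_mul_add_inv_mul_le {a b : ℝ} (ha : 0 < a) (hb : 0 < b) :
    1 / (a * b ^ 2) + 1 / (a ^ 2 * b) ≤ 2 * (1 / a ^ 3 + 1 / b ^ 3) := by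
  have hx : 0 < a⁻¹ := inv_pos.2 ha
  have hy : 0 < b⁻¹ := inv_pos.2 hb
  have h1 : 1 / (a * b ^ 2) + 1 / (a ^ 2 * b) = a⁻¹ * b⁻¹ ^ 2 + a⁻¹ ^ 2 * b⁻¹ := by
    simp only [one_div, mul_inv, inv_pow]
  have h2 : 2 * (1 / a ^ 3 + 1 / b ^ 3) = 2 * (a⁻¹ ^ 3 + b⁻¹ ^ 3) := by
    simp only [one_div, inv_pow]
  rw [h1, h2]
  nlinarith [mul_nonneg (add_pos hx hy).le (sq_nonneg (a⁻¹ - b⁻¹)), pow_pos hx 3, pow_pos hy 3]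

/-- With `a = √(n + 1)` and `b = √|s n ^ 2 - z ^ 2|`, the relative error of replacing `s n` by `t n`
in one factor is `O(|z| (1/(a b²) + 1/(a² b)))`, hence `O(|z| (1/a³ + 1/b³))`. Away from the nearest
index `k`, `b²` dominates a multiple of `|n - k|`. Both series converge with sums independent of
`z`, so the total error is `exp(O(|z|))`. Only the factor `k`, where `b` may vanish, must be left
out. -/
theorem prod_one_sub_div_le {D : ℝ} {s t : ℕ → ℝ} (hs : IsSquareRegular D s)
    (ht : IsSquareRegular D t) :
    ∃ K > 0, ∀ (z : ℂ) (k : ℕ),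
      (∀ n, ‖(s k : ℂ) ^ 2 - z ^ 2‖ ≤ ‖(s n : ℂ) ^ 2 - z ^ 2‖) → ∀ A : Finset ℕ, k ∉ A →
      ∏ n ∈ A, ‖1 - z / t n‖ ≤ Real.exp (K * ‖z‖) * ∏ n ∈ A, ‖1 - z / s n‖ := by
  obtain ⟨C₁, hC₁, hsub⟩ := hs.exists_sub ht
  obtain ⟨C₂, hC₂, hup⟩ := hs.exists_upper
  obtain ⟨c, hc, hlow⟩ := ht.exists_lower
  obtain ⟨d, hd, hsep⟩ := hs.exists_separated
  set W := ∑' j : ℤ, 1 / √|(j : ℝ)| ^ 3 with hW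
  have hW0 : 0 ≤ W := tsum_nonneg fun j => by positivity
  set q : ℝ := 1 / √(d / 2) ^ 3 with hq
  have hq0 : 0 < q := by positivity
  set K₀ : ℝ := C₁ / √c * (2 * √C₂ + 1) with hK₀
  have hK₀0 : 0 < K₀ := by positivity
  refine ⟨K₀ * 2 * (W + q * W) + 1, by positivity, fun z k hk A hkA => ?_⟩
  set e : ℕ → ℝ := fun n => K₀ * 2 * ‖z‖ * (1 / √|((n : ℝ) - (-1 : ℤ))| ^ 3 +
    q * (1 / √|((n : ℝ) - (k : ℤ))| ^ 3)) with he
  refine (prod_norm_le_exp_sum A (fun n => 1 - z / t n) (fun n => 1 - z / s n) e ?_).trans ?_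
  · intro n hn
    have hnk : n ≠ k := fun h => hkA (h ▸ hn)
    have hsn := hs.pos n
    have htn := ht.pos n
    set m := ‖(s n : ℂ) ^ 2 - z ^ 2‖ with hm
    have hm1 := IsSquareRegular.mul_abs_sub_le_of_nearest hsep hk n
    have habs : 0 < |(n : ℝ) - k| := abs_pos.2 (sub_ne_zero.2 (by exact_mod_cast hnk))
    have hm0 : 0 < m := lt_of_lt_of_le (by positivity) hm1
    set a := √((n : ℝ) + 1) with ha
    have ha0 : 0 < a := by positivity
    have ha2 : a ^ 2 = n + 1 := Real.sq_sqrt (by positivity)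
    set b := √m with hb
    have hb0 : 0 < b := Real.sqrt_pos.2 hm0
    have hb2 : b ^ 2 = m := Real.sq_sqrt hm0.le
    have hfac : (s n : ℂ) ^ 2 - z ^ 2 = (s n - z) * (s n + z) := by ring
    have hmf : m = ‖(s n : ℂ) - z‖ * ‖(s n : ℂ) + z‖ := by rw [hm, hfac, norm_mul]
    have hp0 : 0 < ‖(s n : ℂ) + z‖ := by
      rcases (norm_nonneg ((s n : ℂ) + z)).eq_or_lt with h | h
      · rw [← h, mul_zero] at hmf; exact absurd hmf hm0.ne'
      · exact h
    have hsn' : (s n : ℂ) ≠ 0 := by exact_mod_cast hsn.ne'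
    have htn' : (t n : ℂ) ≠ 0 := by exact_mod_cast htn.ne'
    have hdiff : ‖(1 - z / t n) - (1 - z / s n)‖ = ‖z‖ * |t n - s n| / (s n * t n) := by
      have : (1 - z / t n) - (1 - z / s n) = z * ((t n - s n : ℝ) : ℂ) / ((s n * t n : ℝ) : ℂ) := by
        push_cast; field_simp; ring
      rw [this, norm_div, norm_mul, Complex.norm_real, Complex.norm_real, Real.norm_eq_abs,
        Real.norm_eq_abs, abs_of_pos (mul_pos hsn htn)]
    have hg : ‖1 - z / s n‖ = m / (s n * ‖(s n : ℂ) + z‖) := by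
      have : 1 - z / s n = (s n - z) / s n := by field_simp
      rw [this, norm_div, Complex.norm_real, Real.norm_eq_abs, abs_of_pos hsn, hmf]
      field_simp
    have ht1 : √c * a ≤ t n := by
      rw [ha, ← Real.sqrt_mul hc.le]
      exact Real.sqrt_le_iff.2 ⟨htn.le, hlow n⟩
    have hs1 : s n ≤ √C₂ * a := by
      rw [ha, ← Real.sqrt_mul hC₂.le]
      exact Real.le_sqrt_of_sq_le (hup n)
    have hz1 : ‖z‖ ≤ √C₂ * a + b := by
      refine abs_le_of_sq_le_sq' ?_ (by positivity) |>.2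
      have h1 : ‖z‖ ^ 2 ≤ s n ^ 2 + m := by
        have := norm_sub_norm_le (z ^ 2) ((s n : ℂ) ^ 2)
        rw [norm_sub_rev, norm_pow, norm_pow, Complex.norm_real, Real.norm_eq_abs, sq_abs] at this
        linarith
      have h2 : s n ^ 2 ≤ (√C₂ * a) ^ 2 := by gcongr
      nlinarith [mul_pos (mul_pos (Real.sqrt_pos.2 hC₂) ha0) hb0]
    have hpz : ‖(s n : ℂ) + z‖ ≤ √C₂ * a + ‖z‖ := by
      have := norm_add_le (s n : ℂ) z
      rw [Complex.norm_real, Real.norm_eq_abs, abs_of_pos hsn] at this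
      linarith
    have hts : |t n - s n| ≤ C₁ / a := by rw [le_div_iff₀ ha0]; exact hsub n
    -- the relative error
    have h1 : ‖z‖ * |t n - s n| / (s n * t n) ≤
        (‖z‖ * (C₁ / a) * (2 * √C₂ * a + b) / (√c * a * m)) * ‖1 - z / s n‖ := by
      rw [hg, div_mul_div_comm, div_le_div_iff₀ (by positivity) (by positivity)]
      have hA : ‖z‖ * |t n - s n| * ‖(s n : ℂ) + z‖ * (√c * a) ≤
          ‖z‖ * (C₁ / a) * (2 * √C₂ * a + b) * t n := by
        gcongr
        linarith
      nlinarith [mul_le_mul_of_nonneg_left hA (mul_pos hm0 hsn).le]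
    have h2 : ‖z‖ * (C₁ / a) * (2 * √C₂ * a + b) / (√c * a * m) ≤
        K₀ * ‖z‖ * (1 / (a * b ^ 2) + 1 / (a ^ 2 * b)) := by
      have e1 : ‖z‖ * (C₁ / a) * (2 * √C₂ * a + b) / (√c * a * m) =
          C₁ / √c * ‖z‖ * (2 * √C₂ * (1 / (a * b ^ 2)) + 1 * (1 / (a ^ 2 * b))) := by
        rw [← hb2]; field_simp
      rw [e1, hK₀]
      have e2 : C₁ / √c * (2 * √C₂ + 1) * ‖z‖ * (1 / (a * b ^ 2) + 1 / (a ^ 2 * b)) =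
          C₁ / √c * ‖z‖ * ((2 * √C₂ + 1) * (1 / (a * b ^ 2)) + (2 * √C₂ + 1) * (1 / (a ^ 2 * b))) := by
        ring
      rw [e2]
      gcongr <;> linarith [Real.sqrt_nonneg C₂]
    have h3 : K₀ * ‖z‖ * (1 / (a * b ^ 2) + 1 / (a ^ 2 * b)) ≤ e n := by
      have hb3 : 1 / b ^ 3 ≤ q * (1 / √|((n : ℝ) - (k : ℤ))| ^ 3) := by
        have hb1 : √(d / 2) * √|(n : ℝ) - (k : ℤ)| ≤ b := by
          rw [hb, ← Real.sqrt_mul (by positivity)]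
          exact Real.sqrt_le_sqrt (by simpa using hm1)
        have habs' : 0 < |(n : ℝ) - (k : ℤ)| := by simpa using habs
        rw [hq, one_div_mul_one_div, ← mul_pow]
        gcongr
      have ha3 : 1 / a ^ 3 = 1 / √|((n : ℝ) - (-1 : ℤ))| ^ 3 := by
        rw [ha]; push_cast; rw [sub_neg_eq_add, abs_of_nonneg (by positivity)]
      rw [he]
      simp only
      rw [← ha3]
      calc _ ≤ K₀ * ‖z‖ * (2 * (1 / a ^ 3 + 1 / b ^ 3)) := by
            gcongr; exact inv_mul_add_inv_mul_le ha0 hb0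
        _ ≤ K₀ * ‖z‖ * (2 * (1 / a ^ 3 + q * (1 / √|((n : ℝ) - (k : ℤ))| ^ 3))) := by gcongr
        _ = _ := by ring
    rw [hdiff]
    refine h1.trans ?_
    gcongr
    exact h2.trans h3
  · gcongr
    have h1 := sum_inv_sqrt_sub_le A (-1)
    have h2 := sum_inv_sqrt_sub_le A k
    rw [he, ← Finset.mul_sum, Finset.sum_add_distrib, ← Finset.mul_sum]
    have h3 : K₀ * 2 * ‖z‖ * (∑ n ∈ A, 1 / √|((n : ℝ) - (-1 : ℤ))| ^ 3 +
        q * ∑ n ∈ A, 1 / √|((n : ℝ) - (k : ℤ))| ^ 3) ≤ K₀ * 2 * ‖z‖ * (W + q * W) := by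
      gcongr
    refine h3.trans ?_
    nlinarith [norm_nonneg z]

/-- In the right half-plane `|1 + z / s n| ≥ 1`, so absolute errors are already relative ones and no
factor has to be excluded. -/
theorem prod_one_add_div_le {D : ℝ} {s t : ℕ → ℝ} (hs : IsSquareRegular D s)
    (ht : IsSquareRegular D t) :
    ∃ K > 0, ∀ z : ℂ, 0 ≤ z.re → ∀ A : Finset ℕ,
      ∏ n ∈ A, ‖1 + z / t n‖ ≤ Real.exp (K * ‖z‖) * ∏ n ∈ A, ‖1 + z / s n‖ := by
  obtain ⟨C₁, hC₁, hsub⟩ := hs.exists_sub ht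
  obtain ⟨c, hc, hlow⟩ := ht.exists_lower
  obtain ⟨c', hc', hlow'⟩ := hs.exists_lower
  set W := ∑' j : ℤ, 1 / √|(j : ℝ)| ^ 3 with hW
  have hW0 : 0 ≤ W := tsum_nonneg fun j => by positivity
  set K₀ : ℝ := C₁ / (√c * √c') with hK₀
  have hK₀0 : 0 < K₀ := by positivity
  refine ⟨K₀ * W + 1, by positivity, fun z hz A => ?_⟩
  set e : ℕ → ℝ := fun n => K₀ * ‖z‖ * (1 / √|((n : ℝ) - (-1 : ℤ))| ^ 3) with he
  refine (prod_norm_le_exp_sum A (fun n => 1 + z / t n) (fun n => 1 + z / s n) e ?_).trans ?_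
  · intro n hn
    have hsn := hs.pos n
    have htn := ht.pos n
    set a := √((n : ℝ) + 1) with ha
    have ha0 : 0 < a := by positivity
    have hsn' : (s n : ℂ) ≠ 0 := by exact_mod_cast hsn.ne'
    have htn' : (t n : ℂ) ≠ 0 := by exact_mod_cast htn.ne'
    have hdiff : ‖(1 + z / t n) - (1 + z / s n)‖ = ‖z‖ * |t n - s n| / (s n * t n) := by
      have : (1 + z / t n) - (1 + z / s n) = -(z * ((t n - s n : ℝ) : ℂ) / ((s n * t n : ℝ) : ℂ)) := by
        push_cast; field_simp; ring
      rw [this, norm_neg, norm_div, norm_mul, Complex.norm_real, Complex.norm_real,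
        Real.norm_eq_abs, Real.norm_eq_abs, abs_of_pos (mul_pos hsn htn)]
    have hg : 1 ≤ ‖1 + z / s n‖ := by
      refine le_trans ?_ (Complex.re_le_norm _)
      rw [Complex.add_re, Complex.one_re, Complex.div_ofReal_re]
      have := div_nonneg hz hsn.le
      linarith
    have ht1 : √c * a ≤ t n := by
      rw [ha, ← Real.sqrt_mul hc.le]
      exact Real.sqrt_le_iff.2 ⟨htn.le, hlow n⟩
    have hs1 : √c' * a ≤ s n := by
      rw [ha, ← Real.sqrt_mul hc'.le]
      exact Real.sqrt_le_iff.2 ⟨hsn.le, hlow' n⟩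
    have hts : |t n - s n| ≤ C₁ / a := by rw [le_div_iff₀ ha0]; exact hsub n
    have ha3 : 1 / √|((n : ℝ) - (-1 : ℤ))| ^ 3 = 1 / a ^ 3 := by
      rw [ha]; push_cast; rw [sub_neg_eq_add, abs_of_nonneg (by positivity)]
    rw [hdiff, he]
    simp only
    rw [ha3]
    calc ‖z‖ * |t n - s n| / (s n * t n) ≤ ‖z‖ * (C₁ / a) / ((√c' * a) * (√c * a)) := by gcongr
      _ = K₀ * ‖z‖ * (1 / a ^ 3) * 1 := by rw [hK₀]; field_simp
      _ ≤ _ := by gcongr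
  · gcongr
    have h1 := sum_inv_sqrt_sub_le A (-1)
    rw [he, ← Finset.mul_sum]
    have h3 : K₀ * ‖z‖ * (∑ n ∈ A, 1 / √|((n : ℝ) - (-1 : ℤ))| ^ 3) ≤ K₀ * ‖z‖ * W := by
      gcongr
    refine h3.trans ?_
    nlinarith [norm_nonneg z]

/-! ### Bounds for the sine, also with its nearest zero removed. -/

theorem Complex.norm_cos_le_exp_abs_im (z : ℂ) : ‖Complex.cos z‖ ≤ Real.exp |z.im| := by
  rw [Complex.cos, norm_div, Complex.norm_two, div_le_iff₀ (by norm_num)]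
  refine (norm_add_le _ _).trans ?_
  rw [Complex.norm_exp, Complex.norm_exp]
  have h1 : (z * Complex.I).re ≤ |z.im| := by simpa using neg_le_abs z.im
  have h2 : (-z * Complex.I).re ≤ |z.im| := by simpa using le_abs_self z.im
  have h3 := Real.exp_le_exp.2 h1
  have h4 := Real.exp_le_exp.2 h2
  linarith

/-- Mean value inequality on the convex strip `|Im w| ≤ |Im z|`, where the derivative is controlled
by `exp |Im z|`. -/
theorem Complex.norm_sin_le_norm_mul_exp_abs_im (z : ℂ) :
    ‖Complex.sin z‖ ≤ ‖z‖ * Real.exp |z.im| := by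
  have hconv : Convex ℝ {w : ℂ | |w.im| ≤ |z.im|} := by
    have : {w : ℂ | |w.im| ≤ |z.im|} = Complex.imCLM ⁻¹' (Set.Icc (-|z.im|) |z.im|) := by
      ext w; simp [abs_le]
    rw [this]
    exact (convex_Icc _ _).linear_preimage Complex.imCLM.toLinearMap
  have := hconv.norm_image_sub_le_of_norm_deriv_le (𝕜 := ℂ) (f := Complex.sin)
    (C := Real.exp |z.im|) (x := 0) (y := z) (fun w _ => Complex.differentiableAt_sin)
    (fun w hw => by
      rw [Complex.deriv_sin]
      exact (Complex.norm_cos_le_exp_abs_im w).trans (Real.exp_le_exp.2 hw)) (by simp) (by simp)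
  simpa [mul_comm] using this

theorem Complex.normSq_sin (z : ℂ) :
    ‖Complex.sin z‖ ^ 2 = Real.sin z.re ^ 2 + Real.sinh z.im ^ 2 := by
  rw [Complex.sq_norm, Complex.sin_eq, Complex.normSq_apply]
  have h1 : (Complex.sin z.re * Complex.cosh z.im + Complex.cos z.re * Complex.sinh z.im * Complex.I) =
      ((Real.sin z.re * Real.cosh z.im : ℝ) : ℂ) + ((Real.cos z.re * Real.sinh z.im : ℝ) : ℂ) * Complex.I := by
    push_cast; ring
  have hre : ∀ p q : ℝ, ((p : ℂ) + q * Complex.I).re = p := fun p q => by simp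
  have him : ∀ p q : ℝ, ((p : ℂ) + q * Complex.I).im = q := fun p q => by simp
  rw [h1, hre, him]
  have h2 := Real.cosh_sq z.im
  have h3 := Real.sin_sq_add_cos_sq z.re
  have h4 : Real.cos z.re ^ 2 = 1 - Real.sin z.re ^ 2 := by linarith
  calc _ = Real.sin z.re ^ 2 * Real.cosh z.im ^ 2 + Real.cos z.re ^ 2 * Real.sinh z.im ^ 2 := by ring
    _ = _ := by rw [h2, h4]; ring

/-- Since `|sin z|² = sin² x + sinh² y`, the bounds `|sin x| ≥ (2/π)|x|` and `sinh |y| ≥ |y|` settle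
`|y| ≤ 1`; for `|y| ≥ 1`, `sinh |y|` alone is comparable to `exp |y|`. -/
theorem Complex.norm_mul_exp_le_norm_sin {z : ℂ} (hz : |z.re| ≤ Real.pi / 2) :
    ‖z‖ * Real.exp |z.im| ≤ 6 * (‖Complex.sin z‖ * (1 + ‖z‖)) := by
  have hsq := Complex.normSq_sin z
  have hsin : (2 / Real.pi * |z.re|) ^ 2 ≤ Real.sin z.re ^ 2 := by
    have := Real.mul_abs_le_abs_sin hz
    rw [← sq_abs (Real.sin z.re)]
    gcongr
  have hsinh : |Real.sinh z.im| = Real.sinh |z.im| := Real.abs_sinh _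
  have hpi : (1 : ℝ) / 2 ≤ 2 / Real.pi := by
    rw [div_le_div_iff₀ (by norm_num) Real.pi_pos]; linarith [Real.pi_le_four]
  rcases le_total |z.im| 1 with h | h
  · have h1 : ‖z‖ / 2 ≤ ‖Complex.sin z‖ := by
      refine abs_le_of_sq_le_sq' ?_ (norm_nonneg _) |>.2
      rw [hsq]
      have h3 : z.im ^ 2 ≤ Real.sinh z.im ^ 2 := by
        rw [← sq_abs, ← sq_abs (Real.sinh _), hsinh]
        gcongr
        exact Real.self_le_sinh_iff.2 (abs_nonneg _)
      have h4 : ‖z‖ ^ 2 = z.re ^ 2 + z.im ^ 2 := by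
        rw [Complex.sq_norm, Complex.normSq_apply]; ring
      have h5 : (1 / 2 * |z.re|) ^ 2 ≤ (2 / Real.pi * |z.re|) ^ 2 := by gcongr
      have h6 : (1 / 2 * |z.re|) ^ 2 = 1 / 4 * z.re ^ 2 := by rw [mul_pow, sq_abs]; norm_num
      nlinarith [sq_nonneg z.im]
    have h2 : Real.exp |z.im| ≤ 3 := (Real.exp_le_exp.2 h).trans (by linarith [Real.exp_one_lt_d9])
    nlinarith [norm_nonneg z, norm_nonneg (Complex.sin z), mul_nonneg (norm_nonneg z) (norm_nonneg (Complex.sin z)), mul_le_mul_of_nonneg_left h2 (norm_nonneg z)]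
  · have h1 : Real.exp |z.im| / 6 ≤ ‖Complex.sin z‖ := by
      have h2 : Real.sinh |z.im| ≤ ‖Complex.sin z‖ := by
        rw [← hsinh]
        refine abs_le_of_sq_le_sq' ?_ (norm_nonneg _) |>.2
        rw [hsq, sq_abs]; nlinarith [sq_nonneg (Real.sin z.re)]
      refine le_trans ?_ h2
      rw [Real.sinh_eq]
      have h3 : Real.exp (-|z.im|) ≤ 1 := Real.exp_le_one_iff.2 (by linarith)
      have h4 : 1 + |z.im| ≤ Real.exp |z.im| := by linarith [Real.add_one_le_exp |z.im|]
      linarith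
    nlinarith [norm_nonneg z, norm_nonneg (Complex.sin z), Real.exp_pos |z.im|, mul_nonneg (norm_nonneg z) (norm_nonneg (Complex.sin z)), mul_le_mul_of_nonneg_left h1 (norm_nonneg z)]

theorem Complex.norm_sin_sub_nat_mul_pi (z : ℂ) (j : ℕ) :
    ‖Complex.sin (z - j * Real.pi)‖ = ‖Complex.sin z‖ := by
  rw [Complex.sin_antiperiodic.sub_nat_mul_eq, norm_mul]
  simp

/-- Upper bound for `sin` with the nearest positive zero removed. -/
theorem Complex.norm_sin_le_of_nearest {W : ℂ} {j : ℕ}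
    (hj : ‖W - ((j : ℂ) + 1) * Real.pi‖ ≤ ‖W - Real.pi‖) :
    ‖Complex.sin W‖ ≤ 9 * ‖W‖ * ‖1 - W / (((j : ℂ) + 1) * Real.pi)‖ * Real.exp |W.im| := by
  have hpi := Real.pi_pos
  have hjp : (0 : ℝ) < ((j : ℝ) + 1) * Real.pi := by positivity
  have hjn : ‖((j : ℂ) + 1) * Real.pi‖ = ((j : ℝ) + 1) * Real.pi := by
    rw [show ((j : ℂ) + 1) * Real.pi = ((((j : ℝ) + 1) * Real.pi : ℝ) : ℂ) by push_cast; ring,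
      Complex.norm_real, Real.norm_eq_abs, abs_of_pos hjp]
  have hne : ((j : ℂ) + 1) * Real.pi ≠ 0 := norm_pos_iff.1 (by rw [hjn]; exact hjp)
  have hq : ‖1 - W / (((j : ℂ) + 1) * Real.pi)‖ * (((j : ℝ) + 1) * Real.pi) =
      ‖W - ((j : ℂ) + 1) * Real.pi‖ := by
    rw [← hjn, ← norm_mul, norm_sub_rev W]; congr 1; field_simp
  rcases le_total 1 ‖W‖ with h | h
  -- For `|W| ≥ 1`, periodicity moves the removed zero to the origin; it is itself of size `O(|W|)`.
  · have h1 := Complex.norm_sin_le_norm_mul_exp_abs_im (W - ((j + 1 : ℕ) : ℂ) * Real.pi)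
    rw [Complex.norm_sin_sub_nat_mul_pi] at h1
    have him : (W - ((j + 1 : ℕ) : ℂ) * Real.pi).im = W.im := by
      rw [show ((j + 1 : ℕ) : ℂ) * Real.pi = ((((j : ℝ) + 1) * Real.pi : ℝ) : ℂ) by push_cast; ring,
        Complex.sub_im, Complex.ofReal_im, sub_zero]
    rw [him, Nat.cast_succ, ← hq] at h1
    refine h1.trans ?_
    have h2 : ((j : ℝ) + 1) * Real.pi ≤ 9 * ‖W‖ := by
      have e1 := norm_sub_norm_le (((j : ℂ) + 1) * Real.pi) W
      rw [hjn, norm_sub_rev] at e1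
      have e2 := norm_sub_le W (Real.pi : ℂ)
      rw [Complex.norm_real, Real.norm_eq_abs, abs_of_pos hpi] at e2
      linarith [Real.pi_le_four]
    calc _ ≤ ‖1 - W / (((j : ℂ) + 1) * Real.pi)‖ * (9 * ‖W‖) * Real.exp |W.im| := by gcongr
      _ = _ := by ring
  · have h1 := Complex.norm_sin_le_norm_mul_exp_abs_im W
    have h2 : 1 / 9 ≤ ‖1 - W / (((j : ℂ) + 1) * Real.pi)‖ := by
      have e1 := norm_sub_norm_le 1 (W / (((j : ℂ) + 1) * Real.pi))
      rw [norm_div, hjn, norm_one] at e1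
      have e2 : ‖W‖ / (((j : ℝ) + 1) * Real.pi) ≤ 1 / 3 := by
        gcongr
        nlinarith [Real.pi_gt_three, Nat.cast_nonneg (α := ℝ) j]
      linarith
    refine h1.trans ?_
    have : ‖W‖ * 1 ≤ ‖W‖ * (9 * ‖1 - W / (((j : ℂ) + 1) * Real.pi)‖) := by gcongr; linarith
    calc ‖W‖ * Real.exp |W.im| ≤ (‖W‖ * (9 * ‖1 - W / (((j : ℂ) + 1) * Real.pi)‖)) * Real.exp |W.im| := by
          gcongr; linarith
      _ = _ := by ring

/-- Lower bound for `sin` with the nearest positive zero removed. -/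
theorem Complex.le_norm_sin_of_nearest {W : ℂ} (hW : 0 ≤ W.re) {j : ℕ}
    (hj : ∀ i : ℕ, ‖W - ((j : ℂ) + 1) * Real.pi‖ ≤ ‖W - ((i : ℂ) + 1) * Real.pi‖) :
    ‖W‖ * ‖1 - W / (((j : ℂ) + 1) * Real.pi)‖ * Real.exp |W.im| ≤
      6 * (‖Complex.sin W‖ * (1 + ‖W‖) ^ 2) := by
  have hpi := Real.pi_pos
  have hjp : (0 : ℝ) < ((j : ℝ) + 1) * Real.pi := by positivity
  have hjn : ‖((j : ℂ) + 1) * Real.pi‖ = ((j : ℝ) + 1) * Real.pi := by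
    rw [show ((j : ℂ) + 1) * Real.pi = ((((j : ℝ) + 1) * Real.pi : ℝ) : ℂ) by push_cast; ring,
      Complex.norm_real, Real.norm_eq_abs, abs_of_pos hjp]
  have hj1 : 1 ≤ ((j : ℝ) + 1) * Real.pi := by
    nlinarith [Real.pi_gt_three, Nat.cast_nonneg (α := ℝ) j]
  have hne : ((j : ℂ) + 1) * Real.pi ≠ 0 := norm_pos_iff.1 (by rw [hjn]; exact hjp)
  have hq : ‖1 - W / (((j : ℂ) + 1) * Real.pi)‖ * (((j : ℝ) + 1) * Real.pi) =
      ‖W - ((j : ℂ) + 1) * Real.pi‖ := by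
    rw [← hjn, ← norm_mul, norm_sub_rev W]; congr 1; field_simp
  have hs0 := norm_nonneg (Complex.sin W)
  have hW0 := norm_nonneg W
  rcases le_total W.re (Real.pi / 2) with h | h
  · have h1 := Complex.norm_mul_exp_le_norm_sin (z := W) (by rw [abs_of_nonneg hW]; exact h)
    have h2 : ‖1 - W / (((j : ℂ) + 1) * Real.pi)‖ ≤ 1 + ‖W‖ := by
      refine (norm_sub_le _ _).trans ?_
      rw [norm_one, norm_div, hjn]
      gcongr
      exact div_le_self hW0 hj1
    calc _ = (‖W‖ * Real.exp |W.im|) * ‖1 - W / (((j : ℂ) + 1) * Real.pi)‖ := by ring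
      _ ≤ (6 * (‖Complex.sin W‖ * (1 + ‖W‖))) * (1 + ‖W‖) := by gcongr
      _ = _ := by ring
  · have hre : ∀ i : ℕ, (W - ((i : ℂ) + 1) * Real.pi).re = W.re - (i + 1) * Real.pi := fun i => by
      rw [show ((i : ℂ) + 1) * Real.pi = ((((i : ℝ) + 1) * Real.pi : ℝ) : ℂ) by push_cast; ring,
        Complex.sub_re, Complex.ofReal_re]
    have him : ∀ i : ℕ, (W - ((i : ℂ) + 1) * Real.pi).im = W.im := fun i => by
      rw [show ((i : ℂ) + 1) * Real.pi = ((((i : ℝ) + 1) * Real.pi : ℝ) : ℂ) by push_cast; ring,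
        Complex.sub_im, Complex.ofReal_im, sub_zero]
    have hcmp : ∀ i : ℕ, |W.re - (j + 1) * Real.pi| ≤ |W.re - (i + 1) * Real.pi| := fun i => by
      have e := pow_le_pow_left₀ (norm_nonneg _) (hj i) 2
      rw [Complex.sq_norm, Complex.sq_norm, Complex.normSq_apply, Complex.normSq_apply, hre, hre,
        him, him] at e
      exact sq_le_sq.1 (by nlinarith)
    have hnear : |W.re - (j + 1) * Real.pi| ≤ Real.pi / 2 := by
      set x := W.re / Real.pi - 1 / 2 with hx
      have hx0 : 0 ≤ x := by
        rw [hx, sub_nonneg, div_le_div_iff₀ (by norm_num) hpi]; linarith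
      refine (hcmp ⌊x⌋₊).trans ?_
      have e1 := Nat.floor_le hx0
      have e2 := Nat.lt_floor_add_one x
      have e3 : W.re = (x + 1 / 2) * Real.pi := by rw [hx]; field_simp; ring
      rw [e3, ← sub_mul, abs_mul, abs_of_pos hpi]
      have : |x + 1 / 2 - (⌊x⌋₊ + 1)| ≤ 1 / 2 := abs_le.2 ⟨by linarith, by linarith⟩
      nlinarith
    have hV : ‖W - ((j : ℂ) + 1) * Real.pi‖ ≤ ‖W‖ := by
      refine abs_le_of_sq_le_sq' ?_ hW0 |>.2
      rw [Complex.sq_norm, Complex.sq_norm, Complex.normSq_apply, Complex.normSq_apply, hre, him]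
      have : (W.re - (j + 1) * Real.pi) ^ 2 ≤ W.re ^ 2 := by
        rw [sq_le_sq, abs_of_nonneg hW]; linarith
      nlinarith
    have h1 := Complex.norm_mul_exp_le_norm_sin (z := W - ((j + 1 : ℕ) : ℂ) * Real.pi)
      (by rw [Nat.cast_succ, hre]; exact hnear)
    rw [Complex.norm_sin_sub_nat_mul_pi, Nat.cast_succ, him, ← hq] at h1
    have h2 : ‖1 - W / (((j : ℂ) + 1) * Real.pi)‖ * 1 * Real.exp |W.im| ≤
        6 * (‖Complex.sin W‖ * (1 + ‖W‖)) := by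
      refine le_trans (by gcongr) (h1.trans ?_)
      rw [hq]
      gcongr
    calc _ = ‖W‖ * (‖1 - W / (((j : ℂ) + 1) * Real.pi)‖ * 1 * Real.exp |W.im|) := by ring
      _ ≤ (1 + ‖W‖) * (6 * (‖Complex.sin W‖ * (1 + ‖W‖))) := by gcongr; linarith
      _ = _ := by ring

/-! ### The canonical product and its convergence. -/

/-- The product with zeros `t n`, `-t' n` and `± i √((n + 1) / D)`. -/
noncomputable def canonicalFactor (D : ℝ) (t t' : ℕ → ℝ) (n : ℕ) (z : ℂ) : ℂ :=
  (1 - z / t n) * (1 + z / t' n) * (1 + D * z ^ 2 / (n + 1))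

/-- All four half-axes carry zeros of the same density, so grouping the `n`-th zeros makes the
product converge without exponential factors. -/
noncomputable def canonicalProduct (D : ℝ) (t t' : ℕ → ℝ) (z : ℂ) : ℂ :=
  ∏' n : ℕ, canonicalFactor D t t' n z

theorem canonicalProduct_neg (D : ℝ) (t t' : ℕ → ℝ) (z : ℂ) :
    canonicalProduct D t t' (-z) = canonicalProduct D t' t z := by
  unfold canonicalProduct canonicalFactor
  congr 1
  funext n
  ring

namespace IsSquareRegular

variable {D : ℝ} {t t' : ℕ → ℝ}

/-- With `x = 1 / t n`, `y = 1 / t' n`, `u = D / (n + 1)`, the coefficients of `z, z², z³, z⁴` are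
`y - x`, `u - xy`, `u(y - x)`, `-uxy`. The first two are small by cancellation, and each is `O((n +
1) ^ (-3/2))`. -/
theorem norm_canonicalFactor_sub_one_le (ht : IsSquareRegular D t) (ht' : IsSquareRegular D t') :
    ∃ C > 0, ∀ (n : ℕ) (z : ℂ),
      ‖canonicalFactor D t t' n z - 1‖ ≤ C * (1 + ‖z‖) ^ 4 * (1 / √((n : ℝ) + 1) ^ 3) := by
  obtain ⟨C₁, hC₁, hsub⟩ := ht.exists_sub ht'
  obtain ⟨c, hc, hlow⟩ := ht.exists_lower
  obtain ⟨c', hc', hlow'⟩ := ht'.exists_lower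
  obtain ⟨C₂, hC₂⟩ := ht.close
  have hD := ht.density_pos
  have hC₂0 : 0 ≤ C₂ := (abs_nonneg _).trans (hC₂ 0)
  set A := C₁ / (√c * √c') with hA
  set B := C₂ * D / c + A / √c with hB
  set E := D * (A + 1 / (√c * √c')) with hE
  refine ⟨A + B + E, by positivity, fun n z => ?_⟩
  set a := √((n : ℝ) + 1) with ha
  have ha0 : 0 < a := by positivity
  have ha1 : 1 ≤ a := Real.one_le_sqrt.2 (by linarith [Nat.cast_nonneg (α := ℝ) n])
  have ha2 : a ^ 2 = n + 1 := Real.sq_sqrt (by positivity)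
  have htn := ht.pos n
  have htn' := ht'.pos n
  have h1 : √c * a ≤ t n := by
    rw [ha, ← Real.sqrt_mul hc.le]
    exact Real.sqrt_le_iff.2 ⟨htn.le, hlow n⟩
  have h1' : √c' * a ≤ t' n := by
    rw [ha, ← Real.sqrt_mul hc'.le]
    exact Real.sqrt_le_iff.2 ⟨htn'.le, hlow' n⟩
  set x := 1 / t n with hx
  set y := 1 / t' n with hy
  set u := D / (n + 1 : ℝ) with hu
  have hx0 : 0 < x := by positivity
  have hy0 : 0 < y := by positivity
  have hu0 : 0 < u := by positivity
  have hu1 : u = D / a ^ 2 := by rw [ha2]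
  have hx1 : x ≤ 1 / (√c * a) := by rw [hx]; gcongr
  have hy1 : y ≤ 1 / (√c' * a) := by rw [hy]; gcongr
  have hxy : |y - x| ≤ A / a ^ 3 := by
    have : y - x = (t n - t' n) * x * y := by rw [hx, hy]; field_simp
    rw [this, abs_mul, abs_mul, abs_of_pos hx0, abs_of_pos hy0, abs_sub_comm]
    calc |t' n - t n| * x * y ≤ (C₁ / a) * (1 / (√c * a)) * (1 / (√c' * a)) := by
          gcongr; rw [le_div_iff₀ ha0]; exact hsub n
      _ = A / a ^ 3 := by rw [hA]; field_simp
  have hpow : ∀ r : ℝ, 0 ≤ r → r / a ^ 4 ≤ r / a ^ 3 := fun r hr => by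
    gcongr 1
    exact pow_le_pow_right₀ ha1 (by norm_num)
  have huxy : |u - x * y| ≤ B / a ^ 3 := by
    have e1 : |u - x ^ 2| ≤ (C₂ * D / c) / a ^ 3 := by
      have : u - x ^ 2 = (t n ^ 2 - (n + 1) / D) * u * x ^ 2 := by
        rw [hx, hu]; field_simp
      rw [this, abs_mul, abs_mul, abs_of_pos hu0, abs_of_pos (pow_pos hx0 2)]
      calc |t n ^ 2 - (n + 1) / D| * u * x ^ 2 ≤ C₂ * (D / a ^ 2) * (1 / (√c * a)) ^ 2 := by
            rw [hu1]; gcongr; exact hC₂ n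
        _ = (C₂ * D / c) / a ^ 4 := by
            rw [div_pow, mul_pow, Real.sq_sqrt hc.le]; field_simp
        _ ≤ _ := hpow _ (by positivity)
    have e2 : |x * (x - y)| ≤ (A / √c) / a ^ 3 := by
      rw [abs_mul, abs_of_pos hx0, abs_sub_comm]
      calc x * |y - x| ≤ 1 / (√c * a) * (A / a ^ 3) := by gcongr
        _ = (A / √c) / a ^ 4 := by field_simp
        _ ≤ _ := hpow _ (by positivity)
    calc |u - x * y| = |(u - x ^ 2) + x * (x - y)| := by ring_nf
      _ ≤ _ := (abs_add_le _ _).trans (by rw [hB, add_div]; exact add_le_add e1 e2)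
  have hu2 : u * (|y - x| + x * y) ≤ E / a ^ 3 := by
    have hxy' : x * y ≤ 1 / (√c * √c') / a ^ 2 := by
      calc x * y ≤ 1 / (√c * a) * (1 / (√c' * a)) := by gcongr
        _ = _ := by field_simp
    have e3 : |y - x| ≤ A / a ^ 2 := hxy.trans (by gcongr; norm_num)
    calc _ ≤ D / a ^ 2 * (A / a ^ 2 + 1 / (√c * √c') / a ^ 2) := by rw [hu1]; gcongr
      _ = E / a ^ 4 := by rw [hE]; field_simp
      _ ≤ _ := hpow _ (by positivity)
  have hid : canonicalFactor D t t' n z - 1 = z * ((y - x : ℝ) : ℂ) + z ^ 2 * ((u - x * y : ℝ) : ℂ) +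
      z ^ 3 * ((u * (y - x) : ℝ) : ℂ) - z ^ 4 * ((u * (x * y) : ℝ) : ℂ) := by
    rw [canonicalFactor, hx, hy, hu]; push_cast; ring
  have hr := norm_nonneg z
  set r := ‖z‖ with hrdef
  have hr1 : r ≤ (1 + r) ^ 4 := by nlinarith [pow_nonneg hr 2, pow_nonneg hr 3, pow_nonneg hr 4]
  have hr2 : r ^ 2 ≤ (1 + r) ^ 4 := by nlinarith [pow_nonneg hr 2, pow_nonneg hr 3, pow_nonneg hr 4]
  have hr3 : r ^ 3 ≤ (1 + r) ^ 4 := by nlinarith [pow_nonneg hr 2, pow_nonneg hr 3, pow_nonneg hr 4]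
  have hr4 : r ^ 4 ≤ (1 + r) ^ 4 := by gcongr; linarith
  have hn : ∀ (w : ℂ) (v : ℝ), ‖w * (v : ℂ)‖ = ‖w‖ * |v| := fun w v => by
    rw [norm_mul, Complex.norm_real, Real.norm_eq_abs]
  calc ‖canonicalFactor D t t' n z - 1‖ ≤ r * |y - x| + r ^ 2 * |u - x * y| +
        r ^ 3 * (u * |y - x|) + r ^ 4 * (u * (x * y)) := by
        rw [hid]
        refine (norm_sub_le _ _).trans (add_le_add ((norm_add_le _ _).trans
          (add_le_add ((norm_add_le _ _).trans (add_le_add ?_ ?_)) ?_)) ?_)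
        · rw [hn]
        · rw [hn, norm_pow]
        · rw [hn, norm_pow, abs_mul, abs_of_pos hu0]
        · rw [hn, norm_pow, abs_of_pos (by positivity)]
    _ ≤ (1 + r) ^ 4 * (A / a ^ 3) + (1 + r) ^ 4 * (B / a ^ 3) +
        (1 + r) ^ 4 * (u * |y - x|) + (1 + r) ^ 4 * (u * (x * y)) := by gcongr
    _ = (1 + r) ^ 4 * (A / a ^ 3 + B / a ^ 3 + u * (|y - x| + x * y)) := by ring
    _ ≤ (1 + r) ^ 4 * (A / a ^ 3 + B / a ^ 3 + E / a ^ 3) := by gcongr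
    _ = _ := by ring

theorem hasProdLocallyUniformlyOn_canonicalProduct (ht : IsSquareRegular D t)
    (ht' : IsSquareRegular D t') :
    HasProdLocallyUniformlyOn (canonicalFactor D t t') (canonicalProduct D t t') Set.univ := by
  obtain ⟨C, hC, h⟩ := ht.norm_canonicalFactor_sub_one_le ht'
  apply hasProdLocallyUniformlyOn_of_forall_compact isOpen_univ
  intro K _ hcK
  obtain ⟨R, hR⟩ := hcK.isBounded.exists_norm_le
  have hs : Summable fun n : ℕ => C * (1 + |R|) ^ 4 * (1 / √((n : ℝ) + 1) ^ 3) :=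
    summable_inv_sqrt_nat_pow_three.mul_left _
  have := hs.hasProdUniformlyOn_nat_one_add (f := fun n z => canonicalFactor D t t' n z - 1) hcK
    (.of_forall fun n z hz => (h n z).trans (by
      gcongr; exact (hR z hz).trans (le_abs_self R))) (fun n => by
        unfold canonicalFactor; fun_prop)
  have h2 : (fun (n : ℕ) (z : ℂ) => 1 + (canonicalFactor D t t' n z - 1)) = canonicalFactor D t t' := by
    funext n z; ring
  rw [h2] at this
  simp only [add_sub_cancel] at this
  exact this

theorem differentiable_canonicalProduct (ht : IsSquareRegular D t)
    (ht' : IsSquareRegular D t') : Differentiable ℂ (canonicalProduct D t t') := by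
  rw [← differentiableOn_univ]
  refine (ht.hasProdLocallyUniformlyOn_canonicalProduct ht').differentiableOn
    (.of_forall fun s => ?_) isOpen_univ
  simpa [Finset.prod_fn] using DifferentiableOn.finsetProd (fun _ _ => by
    unfold canonicalFactor; fun_prop)

theorem tendsto_canonicalProduct (ht : IsSquareRegular D t)
    (ht' : IsSquareRegular D t') (z : ℂ) :
    Filter.Tendsto (fun N => ∏ n ∈ Finset.range N, canonicalFactor D t t' n z) Filter.atTop
      (nhds (canonicalProduct D t t' z)) :=
  ((ht.hasProdLocallyUniformlyOn_canonicalProduct ht').hasProd (Set.mem_univ z)).tendsto_prod_nat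

theorem canonicalProduct_eq_zero (ht : IsSquareRegular D t)
    (ht' : IsSquareRegular D t') (k : ℕ) : canonicalProduct D t t' (t k) = 0 := by
  have h := ht.tendsto_canonicalProduct ht' (t k)
  refine tendsto_nhds_unique h (tendsto_const_nhds.congr' ?_)
  filter_upwards [Filter.eventually_gt_atTop k] with N hN
  refine (Finset.prod_eq_zero (Finset.mem_range.2 hN) ?_).symm
  have : (t k : ℂ) ≠ 0 := by exact_mod_cast (ht.pos k).ne'
  simp [canonicalFactor, this]

/-- The square root of the arithmetic progression with density `D`. -/
theorem sqrt_progression (hD : 0 < D) : IsSquareRegular D fun n => √((n + 1) / D) where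
  density_pos := hD
  pos n := by positivity
  close := ⟨0, fun n => by rw [Real.sq_sqrt (by positivity)]; simp⟩
  gap := ⟨1 / D, by positivity, fun n => by
    rw [Real.sq_sqrt (by positivity), Real.sq_sqrt (by positivity)]; push_cast
    apply le_of_eq; ring⟩

/-- Here the four zeros combine to `1 - (Dz²)² / (n + 1)²`, the factor of Euler's sine product. -/
theorem canonicalProduct_sqrt_progression (hD : 0 < D) {z : ℂ} (hz : z ≠ 0) :
    canonicalProduct D (fun n => √((n + 1) / D)) (fun n => √((n + 1) / D)) z =
      Complex.sin (Real.pi * (D * z ^ 2)) / (Real.pi * (D * z ^ 2)) := by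
  have h0 := sqrt_progression hD
  refine tendsto_nhds_unique (h0.tendsto_canonicalProduct h0 z) ?_
  have hD' : (D : ℂ) ≠ 0 := by exact_mod_cast hD.ne'
  refine (tendsto_euler_sin_prod' (x := D * z ^ 2) (by positivity)).congr fun N => ?_
  refine Finset.prod_congr rfl fun n _ => ?_
  have h1 : ((√((n + 1) / D) : ℝ) : ℂ) ^ 2 = (n + 1) / D := by
    rw [← Complex.ofReal_pow, Real.sq_sqrt (by positivity)]; push_cast; rfl
  have h3 : ((√((n + 1) / D) : ℝ) : ℂ) ≠ 0 := by
    have := h0.pos n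
    exact_mod_cast this.ne'
  have h4 : (n : ℂ) + 1 ≠ 0 := Nat.cast_add_one_ne_zero n
  rw [canonicalFactor, sineTerm]
  have h5 : (1 - z / ((√((n + 1) / D) : ℝ) : ℂ)) * (1 + z / ((√((n + 1) / D) : ℝ) : ℂ)) =
      1 - D * z ^ 2 / (n + 1) := by
    have : (1 - z / ((√((n + 1) / D) : ℝ) : ℂ)) * (1 + z / ((√((n + 1) / D) : ℝ) : ℂ)) =
      1 - z ^ 2 / ((√((n + 1) / D) : ℝ) : ℂ) ^ 2 := by field_simp; ring
    rw [this, h1]; field_simp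
  rw [h5]; field_simp; ring

end IsSquareRegular

/-! ### Two-sided growth bounds for the canonical product. -/

namespace IsSquareRegular

variable {D : ℝ} {s s' t t' : ℕ → ℝ}

/-- The factorwise comparison passes to the limit once a finite set `T` containing the nearest index
has been moved to the other side; the imaginary zeros cancel. It is used with the sine product once
as the majorant and once as the minorant. -/
theorem norm_canonicalProduct_mul_prod_le (hs : IsSquareRegular D s) (hs' : IsSquareRegular D s')
    (ht : IsSquareRegular D t) (ht' : IsSquareRegular D t') :
    ∃ K > 0, ∀ z : ℂ, 0 ≤ z.re → ∀ k : ℕ,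
      (∀ n, ‖(s k : ℂ) ^ 2 - z ^ 2‖ ≤ ‖(s n : ℂ) ^ 2 - z ^ 2‖) → ∀ T : Finset ℕ, k ∈ T →
      ‖canonicalProduct D t t' z‖ * ∏ n ∈ T, ‖1 - z / s n‖ ≤
        Real.exp (K * ‖z‖) * (∏ n ∈ T, ‖1 - z / t n‖) * ‖canonicalProduct D s s' z‖ := by
  obtain ⟨K₁, hK₁, h₁⟩ := prod_one_sub_div_le hs ht
  obtain ⟨K₂, hK₂, h₂⟩ := prod_one_add_div_le hs' ht'
  refine ⟨K₁ + K₂, by positivity, fun z hz k hk T hkT => ?_⟩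
  have l1 := ((ht.tendsto_canonicalProduct ht' z).norm).mul_const (∏ n ∈ T, ‖1 - z / s n‖)
  have l2 := ((hs.tendsto_canonicalProduct hs' z).norm).const_mul
    (Real.exp ((K₁ + K₂) * ‖z‖) * (∏ n ∈ T, ‖1 - z / t n‖))
  refine le_of_tendsto_of_tendsto l1 l2 ?_
  obtain ⟨N₀, hN₀⟩ := T.exists_nat_subset_range
  filter_upwards [Filter.eventually_ge_atTop N₀] with N hN
  have hT : T ⊆ Finset.range N := hN₀.trans (Finset.range_subset_range.2 hN)
  simp only [canonicalFactor, Finset.prod_mul_distrib, norm_mul, norm_prod]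
  rw [← Finset.prod_sdiff hT (f := fun n => ‖1 - z / t n‖),
    ← Finset.prod_sdiff hT (f := fun n => ‖1 - z / s n‖)]
  have e1 := h₁ z k hk (Finset.range N \ T) (by simp [hkT])
  have e2 := h₂ z hz (Finset.range N)
  rw [add_mul, Real.exp_add]
  have p1 : 0 ≤ ∏ n ∈ T, ‖1 - z / (t n : ℂ)‖ := Finset.prod_nonneg fun _ _ => norm_nonneg _
  have p2 : 0 ≤ ∏ n ∈ T, ‖1 - z / (s n : ℂ)‖ := Finset.prod_nonneg fun _ _ => norm_nonneg _
  have p3 : 0 ≤ ∏ n ∈ Finset.range N, ‖1 + z / (t' n : ℂ)‖ :=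
    Finset.prod_nonneg fun _ _ => norm_nonneg _
  have p4 : 0 ≤ ∏ n ∈ Finset.range N, ‖1 + (D : ℂ) * z ^ 2 / (n + 1)‖ :=
    Finset.prod_nonneg fun _ _ => norm_nonneg _
  have p5 : 0 ≤ ∏ n ∈ Finset.range N \ T, ‖1 - z / (s n : ℂ)‖ :=
    Finset.prod_nonneg fun _ _ => norm_nonneg _
  set a1 := ∏ n ∈ Finset.range N \ T, ‖1 - z / (t n : ℂ)‖
  set a2 := ∏ n ∈ T, ‖1 - z / (t n : ℂ)‖
  set a3 := ∏ n ∈ Finset.range N, ‖1 + z / (t' n : ℂ)‖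
  set a4 := ∏ n ∈ Finset.range N, ‖1 + (D : ℂ) * z ^ 2 / (n + 1)‖
  set b1 := ∏ n ∈ Finset.range N \ T, ‖1 - z / (s n : ℂ)‖
  set b2 := ∏ n ∈ T, ‖1 - z / (s n : ℂ)‖
  set b3 := ∏ n ∈ Finset.range N, ‖1 + z / (s' n : ℂ)‖
  calc a1 * a2 * a3 * a4 * b2 = (a1 * a3) * (a2 * a4 * b2) := by ring
    _ ≤ ((Real.exp (K₁ * ‖z‖) * b1) * (Real.exp (K₂ * ‖z‖) * b3)) * (a2 * a4 * b2) := by gcongr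
    _ = _ := by ring

theorem exists_le_apply (ht : IsSquareRegular D t) : ∃ c > 0, ∀ n, c ≤ t n := by
  obtain ⟨c, hc, h⟩ := ht.exists_lower
  refine ⟨√c, Real.sqrt_pos.2 hc, fun n => Real.sqrt_le_iff.2 ⟨(ht.pos n).le, ?_⟩⟩
  have := h n
  nlinarith [Nat.cast_nonneg (α := ℝ) n]

theorem norm_one_sub_div_le_exp {c x : ℝ} (hc : 0 < c) (hx : c ≤ x) (z : ℂ) :
    ‖1 - z / x‖ ≤ Real.exp (1 / c * ‖z‖) := by
  have hx0 := hc.trans_le hx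
  refine (norm_sub_le _ _).trans ?_
  rw [norm_one, norm_div, Complex.norm_real, Real.norm_eq_abs, abs_of_pos hx0]
  have : ‖z‖ / x ≤ 1 / c * ‖z‖ := by
    rw [one_div, inv_mul_eq_div]; gcongr
  linarith [Real.add_one_le_exp (1 / c * ‖z‖)]

theorem sqrt_progression_sq (hD : 0 < D) (n : ℕ) :
    ((√((n + 1) / D) : ℝ) : ℂ) ^ 2 = (n + 1) / D := by
  rw [← Complex.ofReal_pow, Real.sq_sqrt (by positivity)]; push_cast; rfl

theorem norm_sub_nat_mul_pi (hD : 0 < D) (z : ℂ) (n : ℕ) :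
    ‖(Real.pi * (D * z ^ 2) : ℂ) - ((n : ℂ) + 1) * Real.pi‖ =
      Real.pi * D * ‖((√((n + 1) / D) : ℝ) : ℂ) ^ 2 - z ^ 2‖ := by
  have hD' : (D : ℂ) ≠ 0 := by exact_mod_cast hD.ne'
  rw [sqrt_progression_sq hD, norm_sub_rev, show ((n : ℂ) + 1) * Real.pi - Real.pi * (D * z ^ 2) =
    ((Real.pi * D : ℝ) : ℂ) * ((n + 1) / D - z ^ 2) by push_cast; field_simp, norm_mul,
    Complex.norm_real, Real.norm_eq_abs, abs_of_pos (by positivity)]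

theorem one_sub_div_nat_mul_pi (hD : 0 < D) (z : ℂ) (n : ℕ) :
    1 - (Real.pi * (D * z ^ 2) : ℂ) / (((n : ℂ) + 1) * Real.pi) =
      (1 - z / ((√((n + 1) / D) : ℝ) : ℂ)) * (1 + z / ((√((n + 1) / D) : ℝ) : ℂ)) := by
  have hD' : (D : ℂ) ≠ 0 := by exact_mod_cast hD.ne'
  have h3 : ((√((n + 1) / D) : ℝ) : ℂ) ≠ 0 := by
    exact_mod_cast ((sqrt_progression hD).pos n).ne'
  have h4 : (n : ℂ) + 1 ≠ 0 := Nat.cast_add_one_ne_zero n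
  have h5 : (Real.pi : ℂ) ≠ 0 := by exact_mod_cast Real.pi_ne_zero
  have : (1 - z / ((√((n + 1) / D) : ℝ) : ℂ)) * (1 + z / ((√((n + 1) / D) : ℝ) : ℂ)) =
      1 - z ^ 2 / ((√((n + 1) / D) : ℝ) : ℂ) ^ 2 := by field_simp; ring
  rw [this, sqrt_progression_sq hD]
  field_simp

theorem im_pi_mul (z : ℂ) : |(Real.pi * (D * z ^ 2) : ℂ).im| = Real.pi * |D| * |(z ^ 2).im| := by
  rw [← mul_assoc, ← Complex.ofReal_mul, Complex.im_ofReal_mul, abs_mul, abs_mul,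
    abs_of_pos Real.pi_pos]

theorem norm_canonicalProduct_le (ht : IsSquareRegular D t) (ht' : IsSquareRegular D t') :
    ∃ C > 0, ∃ K > 0, ∀ z : ℂ,
      ‖canonicalProduct D t t' z‖ ≤ C * Real.exp (Real.pi * D * |(z ^ 2).im| + K * ‖z‖) := by
  have hD := ht.density_pos
  set s : ℕ → ℝ := fun n => √((n + 1) / D) with hsdef
  have hs : IsSquareRegular D s := sqrt_progression hD
  obtain ⟨c, hc, hcs⟩ := hs.exists_le_apply
  have half : ∀ {t t' : ℕ → ℝ}, IsSquareRegular D t → IsSquareRegular D t' →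
      ∃ K > 0, ∀ z : ℂ, 0 ≤ z.re → z ≠ 0 → (∀ n, z ≠ s n) →
      ‖canonicalProduct D t t' z‖ ≤ 9 * Real.exp (Real.pi * D * |(z ^ 2).im| + K * ‖z‖) := by
    intro t t' ht ht'
    obtain ⟨c', hc', hct⟩ := ht.exists_le_apply
    obtain ⟨K, hK, h⟩ := norm_canonicalProduct_mul_prod_le hs hs ht ht'
    refine ⟨K + 1 / c' + 1 / c, by positivity, fun z hz hz0 hzs => ?_⟩
    obtain ⟨k, hk⟩ := hs.exists_nearest z
    have h1 := h z hz k hk {k} (by simp)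
    rw [Finset.prod_singleton, Finset.prod_singleton, canonicalProduct_sqrt_progression hD hz0,
      norm_div] at h1
    set W : ℂ := Real.pi * (D * z ^ 2) with hW
    have hW0 : 0 < ‖W‖ := by
      have hD' : (D : ℂ) ≠ 0 := by exact_mod_cast hD.ne'
      have h5 : (Real.pi : ℂ) ≠ 0 := by exact_mod_cast Real.pi_ne_zero
      exact norm_pos_iff.2 (mul_ne_zero h5 (mul_ne_zero hD' (pow_ne_zero 2 hz0)))
    have h2 : ‖Complex.sin W‖ ≤ _ := Complex.norm_sin_le_of_nearest (j := k) (by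
      have := norm_sub_nat_mul_pi hD z 0
      simp only [Nat.cast_zero, zero_add, one_mul] at this
      rw [norm_sub_nat_mul_pi hD, this]
      have hk0 := hk 0
      simp only [hsdef, Nat.cast_zero, zero_add] at hk0
      gcongr)
    have hdiv : 1 - W / (((k : ℂ) + 1) * Real.pi) = (1 - z / (s k : ℂ)) * (1 + z / (s k : ℂ)) :=
      one_sub_div_nat_mul_pi hD z k
    have him : |W.im| = Real.pi * |D| * |(z ^ 2).im| := im_pi_mul z
    rw [hdiv, him, norm_mul (1 - z / (s k : ℂ)), abs_of_pos hD] at h2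
    have h3 : 0 < ‖1 - z / (s k : ℂ)‖ := by
      rw [norm_pos_iff, sub_ne_zero]
      intro h
      have h3 : (s k : ℂ) ≠ 0 := by exact_mod_cast (hs.pos k).ne'
      exact hzs k (by field_simp at h; exact h.symm)
    have h4 := norm_one_sub_div_le_exp hc' (hct k) z
    have h5 : ‖1 + z / (s k : ℂ)‖ ≤ Real.exp (1 / c * ‖z‖) := by
      have := norm_one_sub_div_le_exp hc (hcs k) (-z)
      rwa [neg_div, sub_neg_eq_add, norm_neg] at this
    have h6 : ‖Complex.sin W‖ / ‖W‖ ≤ 9 * (‖1 - z / (s k : ℂ)‖ * Real.exp (1 / c * ‖z‖)) *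
        Real.exp (Real.pi * D * |(z ^ 2).im|) := by
      rw [div_le_iff₀ hW0]
      refine h2.trans ?_
      calc _ = 9 * (‖1 - z / (s k : ℂ)‖ * ‖1 + z / (s k : ℂ)‖) *
          Real.exp (Real.pi * D * |(z ^ 2).im|) * ‖W‖ := by ring
        _ ≤ _ := by gcongr
    refine le_of_mul_le_mul_right (h1.trans ?_) h3
    calc _ ≤ Real.exp (K * ‖z‖) * Real.exp (1 / c' * ‖z‖) *
          (9 * (‖1 - z / (s k : ℂ)‖ * Real.exp (1 / c * ‖z‖)) *
          Real.exp (Real.pi * D * |(z ^ 2).im|)) := by gcongr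
      _ = _ := by
        rw [show Real.pi * D * |(z ^ 2).im| + (K + 1 / c' + 1 / c) * ‖z‖ =
          Real.pi * D * |(z ^ 2).im| + (K * ‖z‖ + 1 / c' * ‖z‖ + 1 / c * ‖z‖) by ring, Real.exp_add,
          Real.exp_add, Real.exp_add]; ring
  obtain ⟨K₁, hK₁, h₁⟩ := half ht ht'
  obtain ⟨K₂, hK₂, h₂⟩ := half ht' ht
  refine ⟨9, by norm_num, K₁ + K₂, by positivity, ?_⟩
  -- At the zeros of the sine product the division above is not available; these points form a
  -- countable set, so continuity fills them in.
  have hE : (Set.range (fun n => (s n : ℂ)) ∪ Set.range (fun n => -(s n : ℂ)) ∪ {0}).Countable :=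
    ((Set.countable_range _).union (Set.countable_range _)).union (Set.countable_singleton _)
  have hclosed : IsClosed {z : ℂ | ‖canonicalProduct D t t' z‖ ≤
      9 * Real.exp (Real.pi * D * |(z ^ 2).im| + (K₁ + K₂) * ‖z‖)} := by
    have := (ht.differentiable_canonicalProduct ht').continuous
    exact isClosed_le (by fun_prop) (by fun_prop)
  intro z
  have hz : z ∈ closure (Set.range (fun n => (s n : ℂ)) ∪ Set.range (fun n => -(s n : ℂ)) ∪ {0})ᶜ :=
    hE.dense_compl ℝ z
  refine closure_minimal (fun w hw => ?_) hclosed hz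
  simp only [Set.mem_compl_iff, Set.mem_union, Set.mem_range, Set.mem_singleton_iff, not_or,
    not_exists] at hw
  obtain ⟨⟨hw1, hw2⟩, hw0⟩ := hw
  rcases le_total 0 w.re with h | h
  · refine (h₁ w h hw0 fun n hn => hw1 n hn.symm).trans ?_
    gcongr
    linarith
  -- The reflection `z ↦ -z` swaps the two sequences, so the left half-plane reduces to the right
  -- one.
  · have := h₂ (-w) (by simpa using h) (neg_ne_zero.2 hw0) fun n hn => hw2 n (by rw [← hn, neg_neg])
    rw [canonicalProduct_neg, neg_sq, norm_neg] at this
    refine this.trans ?_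
    gcongr
    linarith

/-- From `x² - z² = x (x + z) (1 - z/x)`: a distance between squares bounds the linear factor from
below, at polynomial cost. -/
theorem le_norm_one_sub_div {x B : ℝ} (hx : 0 < x) (hB : 1 ≤ B) {z : ℂ} (hxB : x ≤ B * (1 + ‖z‖)) :
    ‖(x : ℂ) ^ 2 - z ^ 2‖ ≤ 2 * B ^ 2 * (1 + ‖z‖) ^ 2 * ‖1 - z / x‖ := by
  have hx' : (x : ℂ) ≠ 0 := by exact_mod_cast hx.ne'
  have h1 : (x : ℂ) ^ 2 - z ^ 2 = x * (x + z) * (1 - z / x) := by field_simp; ring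
  rw [h1, norm_mul, norm_mul, Complex.norm_real, Real.norm_eq_abs, abs_of_pos hx]
  refine mul_le_mul_of_nonneg_right ?_ (norm_nonneg _)
  have h2 : ‖(x : ℂ) + z‖ ≤ 2 * (B * (1 + ‖z‖)) := by
    refine (norm_add_le _ _).trans ?_
    rw [Complex.norm_real, Real.norm_eq_abs, abs_of_pos hx]
    nlinarith [norm_nonneg z]
  calc x * ‖(x : ℂ) + z‖ ≤ (B * (1 + ‖z‖)) * (2 * (B * (1 + ‖z‖))) := by gcongr
    _ = _ := by ring

-- The comparison with the sine product is run backwards. The condition on `(z ^ 2).re` puts `W =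
-- πDz²` in the right half-plane, where the sine with its nearest positive zero removed is bounded
-- below. The parameter `δ` carries the distance to the zeros of the product, so that the same bound
-- serves far from the nodes, near them, and for derivatives at them.
set_option maxHeartbeats 1000000 in
theorem le_norm_canonicalProduct (ht : IsSquareRegular D t) (ht' : IsSquareRegular D t') :
    ∃ c > 0, ∃ K > 0, ∀ z : ℂ, 0 ≤ z.re → 0 ≤ (z ^ 2).re → ∀ δ : ℝ,
      (∀ n, δ ≤ ‖(t n : ℂ) ^ 2 - z ^ 2‖) →
      c * δ * Real.exp (Real.pi * D * |(z ^ 2).im| - K * ‖z‖) ≤ ‖canonicalProduct D t t' z‖ := by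
  have hD := ht.density_pos
  set s : ℕ → ℝ := fun n => √((n + 1) / D) with hsdef
  have hs : IsSquareRegular D s := sqrt_progression hD
  obtain ⟨c, hc, hcs⟩ := hs.exists_le_apply
  obtain ⟨C, hC, hup⟩ := ht.exists_upper
  obtain ⟨d, hd, hsep⟩ := ht.exists_separated
  obtain ⟨K, hK, h⟩ := norm_canonicalProduct_mul_prod_le ht ht' hs hs
  have ht0 := ht.pos 0
  have hs0 := hs.pos 0
  obtain ⟨B, hB1, hBk, hBj⟩ : ∃ B : ℝ, 1 ≤ B ∧ 2 + t 0 ≤ B ∧ √(C * D) * (2 + s 0) ≤ B :=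
    ⟨2 + t 0 + √(C * D) * (2 + s 0), by nlinarith [Real.sqrt_nonneg (C * D)],
      by nlinarith [Real.sqrt_nonneg (C * D)], by linarith⟩
  set G : ℝ := min 1 (d / 2 / (2 * B ^ 2)) / (2 * B ^ 2 * (6 * (1 + Real.pi * D) ^ 2)) with hG
  have hpi := Real.pi_pos
  have hG0 : 0 < G := by
    have : 0 < min 1 (d / 2 / (2 * B ^ 2)) := lt_min one_pos (by positivity)
    positivity
  have main : ∀ z : ℂ, 0 ≤ z.re → 0 ≤ (z ^ 2).re → z ≠ 0 → (∀ n, z ≠ s n) → ∀ δ : ℝ, 0 ≤ δ →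
      (∀ n, δ ≤ ‖(t n : ℂ) ^ 2 - z ^ 2‖) →
      G * δ * Real.exp (Real.pi * D * |(z ^ 2).im| - (K + 1 / c + 8) * ‖z‖) ≤
        ‖canonicalProduct D t t' z‖ := by
    intro z hz hz2 hz0 hzs δ hδ0 hδ
    obtain ⟨k, hk⟩ := ht.exists_nearest z
    obtain ⟨j, hj⟩ := hs.exists_nearest z
    have hP := canonicalProduct_sqrt_progression hD hz0
    set W : ℂ := Real.pi * (D * z ^ 2) with hW
    have hWn : ‖W‖ = Real.pi * D * ‖z‖ ^ 2 := by
      rw [hW, ← mul_assoc, ← Complex.ofReal_mul, norm_mul, Complex.norm_real, Real.norm_eq_abs,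
        abs_of_pos (by positivity), norm_pow]
    have hzn : 0 < ‖z‖ := norm_pos_iff.2 hz0
    have hW0 : 0 < ‖W‖ := by rw [hWn]; positivity
    have hWre : 0 ≤ W.re := by
      rw [hW, ← mul_assoc, ← Complex.ofReal_mul, Complex.re_ofReal_mul]; positivity
    have h2 := Complex.le_norm_sin_of_nearest hWre (j := j) (fun i => by
      rw [norm_sub_nat_mul_pi hD, norm_sub_nat_mul_pi hD]
      have := hj i
      gcongr)
    have hdiv : 1 - W / (((j : ℂ) + 1) * Real.pi) = (1 - z / (s j : ℂ)) * (1 + z / (s j : ℂ)) :=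
      one_sub_div_nat_mul_pi hD z j
    have him : |W.im| = Real.pi * |D| * |(z ^ 2).im| := im_pi_mul z
    rw [hdiv, him, norm_mul (1 - z / (s j : ℂ)), abs_of_pos hD] at h2
    set X := Real.exp (Real.pi * D * |(z ^ 2).im|) with hX
    have hX0 : 0 < X := Real.exp_pos _
    have hone : 1 ≤ ‖1 + z / (s j : ℂ)‖ := by
      refine le_trans ?_ (Complex.re_le_norm _)
      rw [Complex.add_re, Complex.one_re, Complex.div_ofReal_re]
      have := div_nonneg hz (hs.pos j).le
      linarith
    have hPs : ‖1 - z / (s j : ℂ)‖ * X ≤ 6 * ((1 + ‖W‖) ^ 2 *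
        ‖canonicalProduct D s s z‖) := by
      have hP' : ‖canonicalProduct D s s z‖ = ‖Complex.sin W‖ / ‖W‖ := by rw [hP, norm_div]
      rw [hP']
      have : ‖1 - z / (s j : ℂ)‖ * 1 * X ≤ ‖1 - z / (s j : ℂ)‖ * ‖1 + z / (s j : ℂ)‖ * X := by gcongr
      refine le_of_mul_le_mul_left ?_ hW0
      calc _ ≤ ‖W‖ * (‖1 - z / (s j : ℂ)‖ * ‖1 + z / (s j : ℂ)‖ * X) := by
            gcongr ‖W‖ * ?_; linarith
        _ = ‖W‖ * (‖1 - z / (s j : ℂ)‖ * ‖1 + z / (s j : ℂ)‖) * X := by ring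
        _ ≤ _ := h2
        _ = _ := by field_simp
    have hWexp : (1 + ‖W‖) ^ 2 ≤ (1 + Real.pi * D) ^ 2 * Real.exp (4 * ‖z‖) := by
      have e1 : 1 + ‖W‖ ≤ (1 + Real.pi * D) * (1 + ‖z‖) ^ 2 := by
        rw [hWn]
        have : 0 < Real.pi * D := by positivity
        nlinarith [mul_pos this hzn]
      have e2 : 1 + ‖z‖ ≤ Real.exp ‖z‖ := by linarith [Real.add_one_le_exp ‖z‖]
      calc (1 + ‖W‖) ^ 2 ≤ ((1 + Real.pi * D) * (Real.exp ‖z‖) ^ 2) ^ 2 := by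
            refine pow_le_pow_left₀ (by positivity) (e1.trans ?_) 2
            gcongr
        _ = _ := by rw [mul_pow, ← pow_mul, ← Real.exp_nat_mul]; norm_num
    have hzexp : (1 + ‖z‖) ^ 2 ≤ Real.exp (2 * ‖z‖) := by
      have e2 : 1 + ‖z‖ ≤ Real.exp ‖z‖ := by linarith [Real.add_one_le_exp ‖z‖]
      calc _ ≤ (Real.exp ‖z‖) ^ 2 := by gcongr
        _ = _ := by rw [← Real.exp_nat_mul]; norm_num
    have htk : t k ≤ B * (1 + ‖z‖) := by
      have := sq_le_of_nearest hk
      have h3 : t k ≤ 2 * ‖z‖ + t 0 := abs_le_of_sq_le_sq' (by nlinarith) (by positivity) |>.2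
      nlinarith [norm_nonneg z]
    have htj : t j ≤ B * (1 + ‖z‖) := by
      have e1 := sq_le_of_nearest hj
      have e2 : s j ^ 2 = (j + 1) / D := Real.sq_sqrt (by positivity)
      have e3 := hup j
      have e4 : s j ≤ 2 * ‖z‖ + s 0 := abs_le_of_sq_le_sq' (by nlinarith) (by positivity) |>.2
      have e5 : t j ≤ √(C * D) * s j := by
        refine abs_le_of_sq_le_sq' ?_ (mul_nonneg (Real.sqrt_nonneg _) (hs.pos j).le) |>.2
        rw [mul_pow, Real.sq_sqrt (by positivity), e2]
        calc _ ≤ _ := e3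
          _ = _ := by field_simp
      have e6 : √(C * D) * s j ≤ √(C * D) * ((2 + s 0) * (1 + ‖z‖)) := by
        gcongr
        nlinarith [norm_nonneg z]
      nlinarith [norm_nonneg z]
    have hlk : δ ≤ 2 * B ^ 2 * Real.exp (2 * ‖z‖) * ‖1 - z / (t k : ℂ)‖ :=
      ((hδ k).trans (le_norm_one_sub_div (ht.pos k) hB1 htk)).trans (by gcongr)
    have hsne : ∀ n, 0 < ‖1 - z / (s n : ℂ)‖ := fun n => by
      rw [norm_pos_iff, sub_ne_zero]
      intro h
      have h3 : (s n : ℂ) ≠ 0 := by exact_mod_cast (hs.pos n).ne'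
      exact hzs n (by field_simp at h; exact h.symm)
    set P := ‖canonicalProduct D t t' z‖ with hPdef
    have hP0 : 0 ≤ P := norm_nonneg _
    set S := ‖canonicalProduct D s s z‖ with hSdef
    have hS0 : 0 ≤ S := norm_nonneg _
    -- the common conclusion of the two cases
    have key : min 1 (d / 2 / (2 * B ^ 2)) * Real.exp (-(2 * ‖z‖)) * ‖1 - z / (t k : ℂ)‖ * X ≤
        6 * ((1 + ‖W‖) ^ 2 * (Real.exp (K * ‖z‖) * Real.exp (1 / c * ‖z‖) * P)) := by
      have hexp1 : Real.exp (-(2 * ‖z‖)) ≤ 1 := Real.exp_le_one_iff.2 (by linarith)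
      have hexp2 : 1 ≤ Real.exp (1 / c * ‖z‖) := Real.one_le_exp (by positivity)
      -- The indices nearest for `t` and for the sine progression may differ. Then both factors are
      -- removed, and `t j ^ 2`, not being nearest, keeps distance at least `d / 2` from `z²`.
      by_cases hjk : j = k
      · subst hjk
        have h1 := h z hz j hk {j} (by simp)
        rw [Finset.prod_singleton, Finset.prod_singleton] at h1
        refine le_of_mul_le_mul_right ?_ (hsne j)
        calc _ ≤ 1 * 1 * ‖1 - z / (t j : ℂ)‖ * X * ‖1 - z / (s j : ℂ)‖ := by
              gcongr; exact min_le_left _ _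
          _ = ‖1 - z / (t j : ℂ)‖ * (‖1 - z / (s j : ℂ)‖ * X) := by ring
          _ ≤ ‖1 - z / (t j : ℂ)‖ * (6 * ((1 + ‖W‖) ^ 2 * S)) := by gcongr
          _ = 6 * (1 + ‖W‖) ^ 2 * (S * ‖1 - z / (t j : ℂ)‖) := by ring
          _ ≤ 6 * (1 + ‖W‖) ^ 2 * (Real.exp (K * ‖z‖) * ‖1 - z / (s j : ℂ)‖ * P) := by gcongr
          _ = 6 * (1 + ‖W‖) ^ 2 * (Real.exp (K * ‖z‖) * ‖1 - z / (s j : ℂ)‖ * (1 * P)) := by ring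
          _ ≤ 6 * (1 + ‖W‖) ^ 2 * (Real.exp (K * ‖z‖) * ‖1 - z / (s j : ℂ)‖ *
              (Real.exp (1 / c * ‖z‖) * P)) := by gcongr
          _ = _ := by ring
      · have h1 := h z hz k hk {k, j} (by simp)
        rw [Finset.prod_pair (Ne.symm hjk), Finset.prod_pair (Ne.symm hjk)] at h1
        have hm : d / 2 ≤ ‖(t j : ℂ) ^ 2 - z ^ 2‖ := by
          have e1 := mul_abs_sub_le_of_nearest hsep hk j
          have e2 : (1 : ℝ) ≤ |(j : ℝ) - k| := by
            have : (1 : ℤ) ≤ |(j : ℤ) - k| := Int.one_le_abs (sub_ne_zero.2 (by exact_mod_cast hjk))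
            exact_mod_cast this
          nlinarith
        have hlj : d / 2 ≤ 2 * B ^ 2 * Real.exp (2 * ‖z‖) * ‖1 - z / (t j : ℂ)‖ :=
          (hm.trans (le_norm_one_sub_div (ht.pos j) hB1 htj)).trans (by gcongr)
        have hlj' : d / 2 / (2 * B ^ 2) * Real.exp (-(2 * ‖z‖)) ≤ ‖1 - z / (t j : ℂ)‖ := by
          rw [Real.exp_neg, ← div_eq_mul_inv, div_div, div_le_iff₀ (by positivity)]
          linarith
        have hsk := norm_one_sub_div_le_exp hc (hcs k) z
        refine le_of_mul_le_mul_right ?_ (hsne j)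
        calc _ ≤ d / 2 / (2 * B ^ 2) * Real.exp (-(2 * ‖z‖)) * ‖1 - z / (t k : ℂ)‖ * X *
              ‖1 - z / (s j : ℂ)‖ := by
              gcongr; exact min_le_right _ _
          _ ≤ ‖1 - z / (t j : ℂ)‖ * ‖1 - z / (t k : ℂ)‖ * X * ‖1 - z / (s j : ℂ)‖ := by gcongr
          _ = ‖1 - z / (t j : ℂ)‖ * ‖1 - z / (t k : ℂ)‖ * (‖1 - z / (s j : ℂ)‖ * X) := by ring
          _ ≤ ‖1 - z / (t j : ℂ)‖ * ‖1 - z / (t k : ℂ)‖ * (6 * ((1 + ‖W‖) ^ 2 * S)) := by gcongr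
          _ = 6 * (1 + ‖W‖) ^ 2 * (S * (‖1 - z / (t k : ℂ)‖ * ‖1 - z / (t j : ℂ)‖)) := by ring
          _ ≤ 6 * (1 + ‖W‖) ^ 2 * (Real.exp (K * ‖z‖) *
              (‖1 - z / (s k : ℂ)‖ * ‖1 - z / (s j : ℂ)‖) * P) := by gcongr
          _ ≤ 6 * (1 + ‖W‖) ^ 2 * (Real.exp (K * ‖z‖) *
              (Real.exp (1 / c * ‖z‖) * ‖1 - z / (s j : ℂ)‖) * P) := by gcongr
          _ = _ := by ring
    set m := min 1 (d / 2 / (2 * B ^ 2)) with hm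
    have hm0 : 0 < m := lt_min one_pos (by positivity)
    have hfin : m * δ * X ≤ (2 * B ^ 2 * (6 * (1 + Real.pi * D) ^ 2)) *
        Real.exp ((K + 1 / c + 8) * ‖z‖) * P := by
      calc m * δ * X ≤ m * (2 * B ^ 2 * Real.exp (2 * ‖z‖) * ‖1 - z / (t k : ℂ)‖) * X := by gcongr
        _ = 2 * B ^ 2 * Real.exp (2 * ‖z‖) * Real.exp (2 * ‖z‖) *
            (m * Real.exp (-(2 * ‖z‖)) * ‖1 - z / (t k : ℂ)‖ * X) := by
            have : Real.exp (2 * ‖z‖) * Real.exp (-(2 * ‖z‖)) = 1 := by rw [← Real.exp_add]; simp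
            linear_combination (-(2 * B ^ 2 * Real.exp (2 * ‖z‖) * m * ‖1 - z / (t k : ℂ)‖ * X)) * this
        _ ≤ 2 * B ^ 2 * Real.exp (2 * ‖z‖) * Real.exp (2 * ‖z‖) *
            (6 * (((1 + Real.pi * D) ^ 2 * Real.exp (4 * ‖z‖)) *
            (Real.exp (K * ‖z‖) * Real.exp (1 / c * ‖z‖) * P))) := by
            refine mul_le_mul_of_nonneg_left (key.trans ?_) (by positivity)
            gcongr
        _ = _ := by
            rw [show (K + 1 / c + 8) * ‖z‖ = 2 * ‖z‖ + 2 * ‖z‖ + 4 * ‖z‖ + K * ‖z‖ + 1 / c * ‖z‖ by ring,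
              Real.exp_add, Real.exp_add, Real.exp_add, Real.exp_add]; ring
    rw [Real.exp_sub, hG, ← hX]
    rw [show m / (2 * B ^ 2 * (6 * (1 + Real.pi * D) ^ 2)) * δ *
      (X / Real.exp ((K + 1 / c + 8) * ‖z‖)) = (m * δ * X) / ((2 * B ^ 2 * (6 * (1 + Real.pi * D) ^ 2)) *
      Real.exp ((K + 1 / c + 8) * ‖z‖)) by field_simp]
    rw [div_le_iff₀ (by positivity)]
    linarith
  refine ⟨G, hG0, K + 1 / c + 8, by positivity, ?_⟩
  have main' : ∀ z : ℂ, 0 ≤ z.re → 0 ≤ (z ^ 2).re → z ≠ 0 → (∀ n, z ≠ s n) → ∀ δ : ℝ,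
      (∀ n, δ ≤ ‖(t n : ℂ) ^ 2 - z ^ 2‖) →
      G * δ * Real.exp (Real.pi * D * |(z ^ 2).im| - (K + 1 / c + 8) * ‖z‖) ≤
        ‖canonicalProduct D t t' z‖ := by
    intro z h1 h2 h3 h4 δ h5
    rcases le_total 0 δ with h6 | h6
    · exact main z h1 h2 h3 h4 δ h6 h5
    · refine le_trans ?_ (norm_nonneg _)
      exact mul_nonpos_of_nonpos_of_nonneg (mul_nonpos_of_nonneg_of_nonpos hG0.le h6) (Real.exp_nonneg _)
  intro z hz hz2 δ hδ
  by_cases hE : z ≠ 0 ∧ ∀ n, z ≠ s n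
  · exact main' z hz hz2 hE.1 hE.2 δ hδ
  -- exceptional real points are limits of regular real points
  obtain ⟨x, hx0, rfl⟩ : ∃ x : ℝ, 0 ≤ x ∧ z = x := by
    rw [not_and_or, not_not] at hE
    rcases hE with rfl | hE
    · exact ⟨0, le_rfl, by simp⟩
    · push Not at hE
      obtain ⟨n, rfl⟩ := hE
      exact ⟨s n, (hs.pos n).le, rfl⟩
  -- Moving from `x` to `y > x` costs at most `y² - x²` in the distance to the squares, a loss that
  -- vanishes in the limit.
  have hclosed : IsClosed {y : ℝ | G * (δ - (y ^ 2 - x ^ 2)) *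
      Real.exp (Real.pi * D * |((y : ℂ) ^ 2).im| - (K + 1 / c + 8) * ‖(y : ℂ)‖) ≤
        ‖canonicalProduct D t t' y‖} := by
    have := (ht.differentiable_canonicalProduct ht').continuous
    exact isClosed_le (by fun_prop) (by fun_prop)
  have hcount : (Set.range s ∪ {0}).Countable := (Set.countable_range _).union (Set.countable_singleton _)
  have hmem : x ∈ closure (Set.Ioi x ∩ (Set.range s ∪ {0})ᶜ) := by
    have h1 := (hcount.dense_compl ℝ).open_subset_closure_inter (isOpen_Ioi (a := x))
    have h2 : x ∈ closure (Set.Ioi x) := by rw [closure_Ioi]; exact Set.self_mem_Ici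
    exact closure_minimal h1 isClosed_closure h2
  have := closure_minimal (fun y hy => ?_) hclosed hmem
  · simpa using this
  · obtain ⟨hy1, hy2⟩ := hy
    simp only [Set.mem_compl_iff, Set.mem_union, Set.mem_range, Set.mem_singleton_iff, not_or,
      not_exists] at hy2
    have hy1 : x < y := hy1
    refine main' y (by rw [Complex.ofReal_re]; linarith)
      (by rw [← Complex.ofReal_pow, Complex.ofReal_re]; positivity) (by exact_mod_cast hy2.2)
      (fun n hn => hy2.1 n (by exact_mod_cast hn.symm)) _ fun n => ?_
    have e1 := hδ n
    have e2 : ‖(t n : ℂ) ^ 2 - (x : ℂ) ^ 2‖ ≤ ‖(t n : ℂ) ^ 2 - (y : ℂ) ^ 2‖ + ‖(y : ℂ) ^ 2 - (x : ℂ) ^ 2‖ :=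
      norm_sub_le_norm_sub_add_norm_sub _ _ _
    have e3 : ‖(y : ℂ) ^ 2 - (x : ℂ) ^ 2‖ = y ^ 2 - x ^ 2 := by
      rw [← Complex.ofReal_pow, ← Complex.ofReal_pow, ← Complex.ofReal_sub, Complex.norm_real,
        Real.norm_eq_abs, abs_of_nonneg (by nlinarith)]
    linarith

end IsSquareRegular

/-! ### Phragmén–Lindelöf in sectors. -/

/-- **Phragmén–Lindelöf principle** for functions of order two in the sector
`{z | m₁ * re z ≤ im z ≤ m₂ * re z}`. -/
theorem PhragmenLindelof.sector_of_order_two {h : ℂ → ℂ} {m₁ m₂ p q C C₀ B₀ : ℝ} (hm : m₁ < m₂)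
    (hangle : Real.arctan m₂ - Real.arctan m₁ < Real.pi / 2)
    (hd : ∀ z : ℂ, 0 < z.re → m₁ * z.re ≤ z.im → z.im ≤ m₂ * z.re → DifferentiableAt ℂ h z)
    (hg : ∀ z : ℂ, 0 < z.re → m₁ * z.re ≤ z.im → z.im ≤ m₂ * z.re →
      ‖h z‖ ≤ C₀ * Real.exp (B₀ * ‖z‖ ^ 2))
    (h₁ : ∀ z : ℂ, 0 < z.re → z.im = m₁ * z.re →
      ‖h z‖ ≤ C * Real.exp (p * (z ^ 2).re + q * (z ^ 2).im))
    (h₂ : ∀ z : ℂ, 0 < z.re → z.im = m₂ * z.re →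
      ‖h z‖ ≤ C * Real.exp (p * (z ^ 2).re + q * (z ^ 2).im))
    {z : ℂ} (hz : 0 < z.re) (hz₁ : m₁ * z.re ≤ z.im) (hz₂ : z.im ≤ m₂ * z.re) :
    ‖h z‖ ≤ C * Real.exp (p * (z ^ 2).re + q * (z ^ 2).im) := by
  set α := Real.arctan m₁ with hα
  set β := Real.arctan m₂ with hβ
  have hαβ : α < β := Real.arctan_strictMono hm
  have hα1 := Real.neg_pi_div_two_lt_arctan m₁
  have hβ1 := Real.arctan_lt_pi_div_two m₂
  have hre : ∀ ζ : ℂ, α ≤ ζ.im → ζ.im ≤ β → 0 < (Complex.exp ζ).re := fun ζ h1 h2 => by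
    rw [Complex.exp_re]
    exact mul_pos (Real.exp_pos _) (Real.cos_pos_of_mem_Ioo ⟨by linarith, by linarith⟩)
  have him : ∀ ζ : ℂ, α ≤ ζ.im → ζ.im ≤ β → (Complex.exp ζ).im = Real.tan ζ.im * (Complex.exp ζ).re :=
    fun ζ h1 h2 => by
      have := (Real.cos_pos_of_mem_Ioo (x := ζ.im) ⟨by linarith, by linarith⟩).ne'
      rw [Complex.exp_re, Complex.exp_im, Real.tan_eq_sin_div_cos]
      field_simp
  have htan1 : ∀ ζ : ℂ, α ≤ ζ.im → ζ.im ≤ β → m₁ * (Complex.exp ζ).re ≤ (Complex.exp ζ).im :=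
    fun ζ h1 h2 => by
      rw [him ζ h1 h2]
      refine mul_le_mul_of_nonneg_right ?_ (hre ζ h1 h2).le
      rw [← Real.tan_arctan m₁]
      exact Real.strictMonoOn_tan.monotoneOn ⟨hα1, by linarith⟩ ⟨by linarith, by linarith⟩ h1
  have htan2 : ∀ ζ : ℂ, α ≤ ζ.im → ζ.im ≤ β → (Complex.exp ζ).im ≤ m₂ * (Complex.exp ζ).re :=
    fun ζ h1 h2 => by
      rw [him ζ h1 h2]
      refine mul_le_mul_of_nonneg_right ?_ (hre ζ h1 h2).le
      rw [← Real.tan_arctan m₂]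
      exact Real.strictMonoOn_tan.monotoneOn ⟨by linarith, by linarith⟩ ⟨by linarith, hβ1⟩ h2
  -- The logarithm turns the sector into a strip, and the modulus of the factor `exp(-(p - iq)z²)`
  -- cancels the majorant, so only a constant bound remains to be propagated.
  set H : ℂ → ℂ := fun ζ => h (Complex.exp ζ) * Complex.exp (-((p : ℂ) - q * Complex.I) * Complex.exp ζ ^ 2)
    with hH
  have hnorm : ∀ w : ℂ, ‖Complex.exp (-((p : ℂ) - q * Complex.I) * w ^ 2)‖ =
      Real.exp (-(p * (w ^ 2).re + q * (w ^ 2).im)) := fun w => by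
    rw [Complex.norm_exp]
    congr 1
    simp only [Complex.mul_re, Complex.neg_re, Complex.sub_re, Complex.ofReal_re, Complex.ofReal_im,
      Complex.I_re, Complex.I_im, Complex.neg_im, Complex.sub_im, Complex.mul_im]
    ring
  have hHle : ∀ ζ : ℂ, ‖h (Complex.exp ζ)‖ ≤
      C * Real.exp (p * (Complex.exp ζ ^ 2).re + q * (Complex.exp ζ ^ 2).im) ↔ ‖H ζ‖ ≤ C := fun ζ => by
    rw [hH, norm_mul, hnorm, Real.exp_neg, ← div_eq_mul_inv, div_le_iff₀ (Real.exp_pos _)]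
  have hstrip : ∀ ζ : ℂ, α ≤ ζ.im → ζ.im ≤ β → ‖H ζ‖ ≤ C := by
    intro ζ h1 h2
    refine PhragmenLindelof.horizontal_strip (a := α) (b := β) (f := H) ?_ ?_ ?_ ?_ h1 h2
    · refine DifferentiableOn.diffContOnCl fun w hw => ?_
      have hsub : closure (Complex.im ⁻¹' Set.Ioo α β) ⊆ Complex.im ⁻¹' Set.Icc α β :=
        closure_minimal (Set.preimage_mono Set.Ioo_subset_Icc_self)
          (isClosed_Icc.preimage Complex.continuous_im)
      obtain ⟨hw1, hw2⟩ := hsub hw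
      have := hd _ (hre w hw1 hw2) (htan1 w hw1 hw2) (htan2 w hw1 hw2)
      refine DifferentiableAt.differentiableWithinAt ?_
      refine DifferentiableAt.mul (this.comp w Complex.differentiableAt_exp) (by fun_prop)
    -- Order two becomes growth `exp(B exp(2|Re ζ|))`, admissible since the strip is narrower than
    -- `π/2`.
    · refine ⟨2, ?_, |B₀| + |p| + |q|, ?_⟩
      · rw [lt_div_iff₀ (by linarith)]; linarith
      · refine Asymptotics.IsBigO.of_bound |C₀| ?_
        refine Filter.eventually_inf_principal.2 (Filter.Eventually.of_forall fun w hw => ?_)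
        obtain ⟨hw1, hw2⟩ := hw
        have e1 := hg _ (hre w hw1.le hw2.le) (htan1 w hw1.le hw2.le) (htan2 w hw1.le hw2.le)
        have e2 : ‖Complex.exp w‖ ^ 2 ≤ Real.exp (2 * |w.re|) := by
          rw [Complex.norm_exp, ← Real.exp_nat_mul]
          refine Real.exp_le_exp.2 ?_
          push_cast
          linarith [le_abs_self w.re]
        have e3 := Complex.abs_re_le_norm (Complex.exp w ^ 2)
        have e4 := Complex.abs_im_le_norm (Complex.exp w ^ 2)
        rw [norm_pow] at e3 e4
        rw [hH, norm_mul, hnorm, Real.norm_eq_abs, Real.abs_exp]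
        have e5 : -(p * (Complex.exp w ^ 2).re + q * (Complex.exp w ^ 2).im) ≤
            (|p| + |q|) * ‖Complex.exp w‖ ^ 2 := by
          refine (neg_le_abs _).trans ((abs_add_le _ _).trans ?_)
          rw [abs_mul, abs_mul, add_mul]
          gcongr
        have e6 : B₀ * ‖Complex.exp w‖ ^ 2 ≤ |B₀| * ‖Complex.exp w‖ ^ 2 := by
          gcongr; exact le_abs_self _
        calc _ ≤ (|C₀| * Real.exp (|B₀| * ‖Complex.exp w‖ ^ 2)) *
              Real.exp ((|p| + |q|) * ‖Complex.exp w‖ ^ 2) := by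
              gcongr
              refine e1.trans ?_
              gcongr
              exact le_abs_self _
          _ = |C₀| * Real.exp ((|B₀| + |p| + |q|) * ‖Complex.exp w‖ ^ 2) := by
              rw [mul_assoc, ← Real.exp_add]; congr 2; ring
          _ ≤ _ := by gcongr
    · intro w hw
      refine (hHle w).1 (h₁ _ (hre w hw.ge (hw ▸ hαβ.le)) ?_)
      rw [him w hw.ge (hw ▸ hαβ.le), hw, hα, Real.tan_arctan]
    · intro w hw
      refine (hHle w).1 (h₂ _ (hre w (hw ▸ hαβ.le) hw.le) ?_)
      rw [him w (hw ▸ hαβ.le) hw.le, hw, hβ, Real.tan_arctan]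
  have hz0 : z ≠ 0 := by rintro rfl; simp at hz
  have hlog : (Complex.log z).im = Real.arctan (z.im / z.re) := by
    rw [Complex.log_im, ← Complex.tan_arg, Real.arctan_tan] <;>
    have := abs_lt.1 (Complex.abs_arg_lt_pi_div_two_iff.2 (Or.inl hz)) <;> linarith
  have := (hHle (Complex.log z)).2 (hstrip _ (by
    rw [hlog]; exact Real.arctan_strictMono.monotone (by rwa [le_div_iff₀ hz])) (by
    rw [hlog]; exact Real.arctan_strictMono.monotone (by rwa [div_le_iff₀ hz])))
  rwa [Complex.exp_log hz0] at this

/-! ### Gaussian decay and entire extensions. -/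

/-- Integrals of Gaussian-decaying functions against exponentials are entire. -/
theorem exists_entire_of_gaussian_decay {g : ℝ → ℂ} (hgc : Continuous g) {b C : ℝ} (hb : 0 < b)
    (hg : ∀ ξ, ‖g ξ‖ ≤ C * Real.exp (-(b * Real.pi) * ξ ^ 2)) :
    ∃ F : ℂ → ℂ, Differentiable ℂ F ∧
      (∀ z, F z = ∫ ξ : ℝ, Complex.exp (2 * Real.pi * ξ * z * Complex.I) * g ξ) ∧
      ∃ C', ∀ z, ‖F z‖ ≤ C' * Real.exp (Real.pi / b * z.im ^ 2) := by
  have hpi := Real.pi_pos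
  have hC : 0 ≤ C := by
    have := (norm_nonneg _).trans (hg 0)
    simpa using this
  refine ⟨fun z => ∫ ξ : ℝ, Complex.exp (2 * Real.pi * ξ * z * Complex.I) * g ξ, ?_, fun _ => rfl, ?_⟩
  · have hnorm : ∀ (ξ : ℝ) (z : ℂ), ‖Complex.exp (2 * Real.pi * ξ * z * Complex.I)‖ ≤
        Real.exp (2 * Real.pi * ‖z‖ * |ξ|) := fun ξ z => by
      rw [Complex.norm_exp]
      refine Real.exp_le_exp.2 ((Complex.re_le_norm _).trans (le_of_eq ?_))
      simp only [norm_mul, Complex.norm_real, Complex.norm_I, Real.norm_eq_abs, Complex.norm_two,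
        abs_of_pos hpi]
      ring
    have hkey : ∀ k : ℝ, ∀ ξ : ℝ, Real.exp (k * |ξ|) * Real.exp (-(b * Real.pi) * ξ ^ 2) ≤
        Real.exp (k ^ 2 / (2 * (b * Real.pi))) * Real.exp (-(b * Real.pi / 2) * ξ ^ 2) := fun k ξ => by
      rw [← Real.exp_add, ← Real.exp_add]
      refine Real.exp_le_exp.2 ?_
      have hbp : 0 < b * Real.pi := by positivity
      have : k ^ 2 / (2 * (b * Real.pi)) + -(b * Real.pi / 2) * ξ ^ 2 -
          (k * |ξ| + -(b * Real.pi) * ξ ^ 2) = (k - b * Real.pi * |ξ|) ^ 2 / (2 * (b * Real.pi)) := by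
        rw [← sq_abs ξ]; field_simp; ring
      have h2 : 0 ≤ (k - b * Real.pi * |ξ|) ^ 2 / (2 * (b * Real.pi)) := by positivity
      linarith
    intro z₀
    refine (hasDerivAt_integral_of_dominated_loc_of_deriv_le (Metric.ball_mem_nhds z₀ one_pos)
      (F := fun z ξ => Complex.exp (2 * Real.pi * ξ * z * Complex.I) * g ξ)
      (F' := fun z ξ => Complex.exp (2 * Real.pi * ξ * z * Complex.I) *
        (2 * Real.pi * ξ * Complex.I) * g ξ) (μ := MeasureTheory.volume)
      (bound := fun ξ => 2 * Real.pi * C * (Real.exp ((2 * Real.pi * (‖z₀‖ + 1) + 1) ^ 2 /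
        (2 * (b * Real.pi))) * Real.exp (-(b * Real.pi / 2) * ξ ^ 2)))
      ?_ ?_ ?_ ?_ ?_ ?_).2.differentiableAt
    · exact Filter.Eventually.of_forall fun z => (by fun_prop : Continuous _).aestronglyMeasurable
    · refine ((integrable_exp_neg_mul_sq (b := b * Real.pi / 2) (by positivity)).const_mul
        (C * Real.exp ((2 * Real.pi * ‖z₀‖) ^ 2 / (2 * (b * Real.pi))))).mono'
        (by fun_prop : Continuous _).aestronglyMeasurable (Filter.Eventually.of_forall fun ξ => ?_)
      rw [norm_mul]
      calc _ ≤ Real.exp (2 * Real.pi * ‖z₀‖ * |ξ|) * (C * Real.exp (-(b * Real.pi) * ξ ^ 2)) := by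
            gcongr
            · exact hnorm _ _
            · exact hg ξ
        _ = C * (Real.exp (2 * Real.pi * ‖z₀‖ * |ξ|) * Real.exp (-(b * Real.pi) * ξ ^ 2)) := by ring
        _ ≤ _ := mul_le_mul_of_nonneg_left (hkey _ _) hC
        _ = _ := by ring
    · exact (by fun_prop : Continuous _).aestronglyMeasurable
    · refine Filter.Eventually.of_forall fun ξ z hz => ?_
      have hz1 : ‖z‖ ≤ ‖z₀‖ + 1 := by
        have h1 := norm_le_norm_add_norm_sub' z z₀
        rw [Metric.mem_ball, dist_eq_norm] at hz
        linarith
      rw [norm_mul, norm_mul]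
      have e1 : ‖(2 * Real.pi * ξ * Complex.I : ℂ)‖ = 2 * Real.pi * |ξ| := by
        simp only [norm_mul, Complex.norm_real, Complex.norm_I, Real.norm_eq_abs, Complex.norm_two,
          abs_of_pos hpi, mul_one]
      have e2 : |ξ| ≤ Real.exp |ξ| := by linarith [Real.add_one_le_exp |ξ|]
      calc _ ≤ Real.exp (2 * Real.pi * (‖z₀‖ + 1) * |ξ|) * (2 * Real.pi * Real.exp |ξ|) *
            (C * Real.exp (-(b * Real.pi) * ξ ^ 2)) := by
            rw [e1]
            gcongr
            · refine (hnorm _ _).trans ?_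
              gcongr
            · exact hg ξ
        _ = 2 * Real.pi * C * (Real.exp ((2 * Real.pi * (‖z₀‖ + 1) + 1) * |ξ|) *
            Real.exp (-(b * Real.pi) * ξ ^ 2)) := by
            rw [add_mul _ 1, one_mul, Real.exp_add]; ring
        _ ≤ _ := mul_le_mul_of_nonneg_left (hkey _ _) (by positivity)
    · exact ((integrable_exp_neg_mul_sq (b := b * Real.pi / 2) (by positivity)).const_mul _).const_mul _
    · refine Filter.Eventually.of_forall fun ξ z _ => ?_
      have h1 : HasDerivAt (fun z : ℂ => 2 * Real.pi * ξ * z * Complex.I)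
          (2 * Real.pi * ξ * Complex.I) z := by
        have := ((hasDerivAt_id z).const_mul (2 * Real.pi * ξ : ℂ)).mul_const Complex.I
        simpa using this
      exact (h1.cexp).mul_const _
  · refine ⟨C * ∫ ξ : ℝ, Real.exp (-(b * Real.pi) * ξ ^ 2), fun z => ?_⟩
    have hint : MeasureTheory.Integrable fun ξ : ℝ => Real.exp (-(b * Real.pi) * ξ ^ 2) :=
      integrable_exp_neg_mul_sq (by positivity)
    -- Completing the square in `ξ` isolates `exp(π y²/b)`; translation invariance then makes the
    -- remaining Gaussian integral independent of `z`.
    have hle : ∀ ξ : ℝ, ‖Complex.exp (2 * Real.pi * ξ * z * Complex.I) * g ξ‖ ≤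
        C * Real.exp (Real.pi / b * z.im ^ 2) * Real.exp (-(b * Real.pi) * (ξ + z.im / b) ^ 2) := by
      intro ξ
      rw [norm_mul, Complex.norm_exp]
      have e1 : (2 * Real.pi * ξ * z * Complex.I : ℂ).re = -(2 * Real.pi * ξ * z.im) := by
        rw [Complex.mul_I_re, show (2 * Real.pi * ξ * z : ℂ) = ((2 * Real.pi * ξ : ℝ) : ℂ) * z by
          push_cast; ring, Complex.im_ofReal_mul]
      rw [e1]
      calc _ ≤ Real.exp (-(2 * Real.pi * ξ * z.im)) * (C * Real.exp (-(b * Real.pi) * ξ ^ 2)) := by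
            gcongr; exact hg ξ
        _ = C * Real.exp (-(2 * Real.pi * ξ * z.im) + -(b * Real.pi) * ξ ^ 2) := by
            rw [Real.exp_add]; ring
        _ = C * Real.exp (Real.pi / b * z.im ^ 2 + -(b * Real.pi) * (ξ + z.im / b) ^ 2) := by
            congr 2; field_simp; ring
        _ = _ := by rw [Real.exp_add]; ring
    refine (MeasureTheory.norm_integral_le_of_norm_le
      ((hint.comp_add_right (z.im / b)).const_mul _) (Filter.Eventually.of_forall hle)).trans ?_
    rw [MeasureTheory.integral_const_mul,
      MeasureTheory.integral_add_right_eq_self (fun ξ : ℝ => Real.exp (-(b * Real.pi) * ξ ^ 2))]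
    apply le_of_eq; ring

/-- `f` is bounded by a multiple of `exp (-a π x²)`. -/
def HasGaussianDecay (f : ℝ → ℂ) (a : ℝ) : Prop :=
  ∃ C, ∀ x, ‖f x‖ ≤ C * Real.exp (-(a * Real.pi) * x ^ 2)

theorem HasGaussianDecay.mono {f : ℝ → ℂ} {a a' : ℝ} (h : HasGaussianDecay f a) (ha : a' ≤ a) :
    HasGaussianDecay f a' := by
  obtain ⟨C, hC⟩ := h
  refine ⟨C, fun x => (hC x).trans ?_⟩
  have hC0 : 0 ≤ C := by
    have := (norm_nonneg _).trans (hC 0)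
    simpa using this
  have := Real.pi_pos
  gcongr

theorem mem_hardyClass_iff {a b : ℝ} {f : 𝓢(ℝ, ℂ)} :
    f ∈ hardyClass a b ↔ HasGaussianDecay f a ∧ HasGaussianDecay (𝓕 (f : ℝ → ℂ)) b := by
  have key : ∀ (g : ℝ → ℂ) (c : ℝ), BddAbove (Set.range fun x : ℝ => ‖g x‖ *
      Real.exp (c * Real.pi * |x| ^ 2)) ↔ HasGaussianDecay g c := by
    intro g c
    simp only [BddAbove, Set.Nonempty, mem_upperBounds, Set.forall_mem_range, HasGaussianDecay]
    refine exists_congr fun C => forall_congr' fun x => ?_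
    rw [sq_abs, neg_mul, Real.exp_neg, ← div_eq_mul_inv, le_div_iff₀ (Real.exp_pos _)]
  exact and_congr (key _ _) (key _ _)

theorem SchwartzMap.exists_entire_extension (f : 𝓢(ℝ, ℂ)) {b : ℝ} (hb : 0 < b)
    (hf : HasGaussianDecay (𝓕 (f : ℝ → ℂ)) b) :
    ∃ F : ℂ → ℂ, Differentiable ℂ F ∧ (∀ x : ℝ, F x = f x) ∧
      ∃ C, ∀ z, ‖F z‖ ≤ C * Real.exp (Real.pi / b * z.im ^ 2) := by
  obtain ⟨C, hC⟩ := hf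
  rw [← SchwartzMap.fourier_coe] at hC
  obtain ⟨F, hF, hFi, hFb⟩ := exists_entire_of_gaussian_decay (𝓕 f).continuous hb hC
  refine ⟨F, hF, fun x => ?_, hFb⟩
  have h1 : 𝓕⁻ (𝓕 f) = f := FourierTransform.fourierInv_fourier_eq f
  rw [hFi]
  conv_rhs => rw [← h1, SchwartzMap.fourierInv_coe, Real.fourierInv_eq']
  refine MeasureTheory.integral_congr_ae (Filter.Eventually.of_forall fun ξ => ?_)
  simp only [smul_eq_mul]
  congr 2
  rw [show (inner ℝ ξ x : ℝ) = ξ * x by simp [mul_comm]]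
  push_cast
  ring

/-! ### Growth in sectors and Hardy's principle. -/

section Indicator

variable {F : ℂ → ℂ} {a b C : ℝ}

/-- The coefficient of `|Im z²|` is the one for which the majorant equals `exp(π y²/b)` on the rays
`y = ±tx`, while on the real axis it is the given decay. Phragmén–Lindelöf applies to the upper and
lower half sectors separately, since each has opening `arctan t < π/2`. -/
theorem norm_le_in_sector (hF : Differentiable ℂ F) (hb : 0 < b)
    (hup : ∀ z, ‖F z‖ ≤ C * Real.exp (Real.pi / b * z.im ^ 2))
    (hre : ∀ x : ℝ, 0 < x → ‖F x‖ ≤ C * Real.exp (-(a * Real.pi) * x ^ 2)) {t : ℝ} (ht : 0 < t)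
    {z : ℂ} (hz : 0 < z.re) (hzt : |z.im| ≤ t * z.re) :
    ‖F z‖ ≤ C * Real.exp (-(a * Real.pi) * (z ^ 2).re +
      (((1 / b - a) * t + a / t) / 2 * Real.pi) * |(z ^ 2).im|) := by
  have hC : 0 ≤ C := by
    have := (norm_nonneg _).trans (hup 0)
    simpa using this
  have hpi := Real.pi_pos
  set q := ((1 / b - a) * t + a / t) / 2 * Real.pi with hq
  have hre2 : ∀ z : ℂ, (z ^ 2).re = z.re ^ 2 - z.im ^ 2 := fun z => by
    rw [sq, Complex.mul_re]; ring
  have him2 : ∀ z : ℂ, (z ^ 2).im = 2 * z.re * z.im := fun z => by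
    rw [sq, Complex.mul_im]; ring
  have hgrowth : ∀ z : ℂ, ‖F z‖ ≤ C * Real.exp (Real.pi / b * ‖z‖ ^ 2) := fun z => by
    refine (hup z).trans ?_
    rw [← sq_abs z.im]
    gcongr
    exact Complex.abs_im_le_norm z
  have hreal : ∀ z : ℂ, 0 < z.re → z.im = 0 → ‖F z‖ ≤ C * Real.exp (-(a * Real.pi) * (z ^ 2).re) :=
    fun z h1 h2 => by
      have : z = (z.re : ℂ) := Complex.ext (by simp) (by simp [h2])
      have h3 := hre z.re h1
      rw [← this] at h3
      rwa [hre2, h2, zero_pow two_ne_zero, sub_zero]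
  have hedge : ∀ x : ℝ, Real.pi / b * (t * x) ^ 2 =
      -(a * Real.pi) * (x ^ 2 - (t * x) ^ 2) + q * (2 * x * (t * x)) := fun x => by
    rw [hq]; field_simp; ring
  have harc : Real.arctan t < Real.pi / 2 := Real.arctan_lt_pi_div_two t
  rcases le_total 0 z.im with h | h
  · rw [abs_of_nonneg h] at hzt
    rw [abs_of_nonneg (a := (z ^ 2).im) (by rw [him2]; positivity)]
    refine PhragmenLindelof.sector_of_order_two (m₁ := 0) (m₂ := t) ht (by simpa using harc)
      (fun z _ _ _ => hF z) (fun z _ _ _ => hgrowth z) ?_ ?_ hz (by simpa using h) hzt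
    · intro w hw1 hw2
      rw [zero_mul] at hw2
      have := hreal w hw1 hw2
      rwa [him2, hw2, mul_zero, mul_zero, add_zero]
    · intro w hw1 hw2
      refine (hup w).trans (le_of_eq ?_)
      rw [hre2, him2, hw2, hedge]
  · rw [abs_of_nonpos h] at hzt
    rw [abs_of_nonpos (a := (z ^ 2).im) (by rw [him2]; nlinarith), mul_neg, ← neg_mul q]
    refine PhragmenLindelof.sector_of_order_two (m₁ := -t) (m₂ := 0) (by linarith)
      (by simpa [Real.arctan_neg] using harc)
      (fun z _ _ _ => hF z) (fun z _ _ _ => hgrowth z) ?_ ?_ hz (by linarith) (by simpa using h)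
    · intro w hw1 hw2
      refine (hup w).trans (le_of_eq ?_)
      rw [hre2, him2, hw2]
      have := hedge w.re
      congr 2
      linarith
    · intro w hw1 hw2
      rw [zero_mul] at hw2
      have := hreal w hw1 hw2
      rwa [him2, hw2, mul_zero, mul_zero, add_zero]

/-- **Hardy's uncertainty principle** for entire functions. -/
theorem eq_zero_of_one_lt_mul (hF : Differentiable ℂ F) (hb : 0 < b) (hab : 1 < a * b)
    (hup : ∀ z, ‖F z‖ ≤ C * Real.exp (Real.pi / b * z.im ^ 2))
    (hre : ∀ x : ℝ, 0 < x → ‖F x‖ ≤ C * Real.exp (-(a * Real.pi) * x ^ 2)) : F = 0 := by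
  have hpi := Real.pi_pos
  have hzero : ∀ z : ℂ, 0 < z.re → 0 < z.im → F z = 0 := by
    intro z hz1 hz2
    have him2 : 0 < |(z ^ 2).im| := by
      rw [abs_pos, sq, Complex.mul_im]; positivity
    -- When `ab > 1` the coefficient `1/b - a` is negative, so widening the sector sends the bound
    -- at a fixed `z` to zero.
    have hlim : Filter.Tendsto (fun t : ℝ => C * Real.exp (-(a * Real.pi) * (z ^ 2).re +
        (((1 / b - a) * t + a / t) / 2 * Real.pi) * |(z ^ 2).im|)) Filter.atTop (nhds (C * 0)) := by
      refine (Real.tendsto_exp_atBot.comp (Filter.tendsto_atBot_add_const_left _ _ ?_)).const_mul C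
      refine Filter.Tendsto.atBot_mul_const him2 (Filter.Tendsto.atBot_mul_const hpi
        (Filter.Tendsto.atBot_div_const two_pos ?_))
      refine Filter.Tendsto.atBot_add (C := 0) ?_ ?_
      · refine Filter.Tendsto.const_mul_atTop_of_neg ?_ Filter.tendsto_id
        rw [sub_neg, div_lt_iff₀ hb]; exact hab
      · exact tendsto_const_nhds.div_atTop Filter.tendsto_id
    rw [mul_zero] at hlim
    have h0 := ge_of_tendsto hlim (b := ‖F z‖) (by
      filter_upwards [Filter.eventually_gt_atTop (z.im / z.re)] with t ht
      have ht0 : 0 < t := (div_pos hz2 hz1).trans ht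
      rw [div_lt_iff₀ hz1] at ht
      exact norm_le_in_sector hF hb hup hre ht0 hz1 (by rw [abs_of_pos hz2]; exact ht.le))
    exact norm_le_zero_iff.1 h0
  have hana : AnalyticOnNhd ℂ F Set.univ := fun z _ => hF.analyticAt z
  refine hana.eq_of_eventuallyEq (fun _ _ => analyticAt_const) (z₀ := 1 + Complex.I) ?_
  have h1 : ∀ᶠ z : ℂ in nhds (1 + Complex.I), 0 < z.re :=
    Complex.continuous_re.continuousAt.eventually (lt_mem_nhds (by simp))
  have h2 : ∀ᶠ z : ℂ in nhds (1 + Complex.I), 0 < z.im :=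
    Complex.continuous_im.continuousAt.eventually (lt_mem_nhds (by simp))
  filter_upwards [h1, h2] with z hz1 hz2
  exact hzero z hz1 hz2

end Indicator

/-! ### Dividing out the zeros improves the decay. -/

/-- A lower bound for a derivative at a zero, from lower bounds along the real line. -/
theorem le_norm_deriv_of_eventually {f : ℂ → ℂ} {x : ℝ} {m : ℝ → ℝ} (hf : DifferentiableAt ℂ f x)
    (hfx : f x = 0) (hm : ContinuousAt m x)
    (h : ∀ᶠ y : ℝ in nhdsWithin x {x}ᶜ, m y * |y - x| ≤ ‖f y‖) : m x ≤ ‖deriv f x‖ := by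
  have h1 : Filter.Tendsto (fun y : ℝ => ‖slope f (x : ℂ) (y : ℂ)‖) (nhdsWithin x {x}ᶜ)
      (nhds ‖deriv f x‖) := by
    refine (hf.hasDerivAt.tendsto_slope.comp ?_).norm
    refine tendsto_nhdsWithin_iff.2 ⟨?_, ?_⟩
    · exact (Complex.continuous_ofReal.tendsto x).mono_left nhdsWithin_le_nhds
    · filter_upwards [self_mem_nhdsWithin] with y hy
      simpa using hy
  refine le_of_tendsto_of_tendsto (hm.tendsto.mono_left nhdsWithin_le_nhds) h1 ?_
  filter_upwards [h, self_mem_nhdsWithin] with y hy hyx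
  have h0 : 0 < |y - x| := abs_pos.2 (sub_ne_zero.2 hyx)
  rw [slope_def_field, hfx, sub_zero, norm_div, ← Complex.ofReal_sub, Complex.norm_real,
    Real.norm_eq_abs, le_div_iff₀ h0]
  exact hy

/-- A pointwise quotient with l'Hôpital values at the zeros of the denominator. -/
noncomputable def simpleQuotient (F P : ℂ → ℂ) (z : ℂ) : ℂ :=
  open scoped Classical in if P z = 0 then deriv F z / deriv P z else F z / P z

/-- At a simple zero of `P` the quotient agrees locally with the ratio of the two `dslope`s, whose
denominator does not vanish there. -/
theorem differentiableAt_simpleQuotient {F P : ℂ → ℂ} (hF : Differentiable ℂ F)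
    (hP : Differentiable ℂ P) {z : ℂ} (h : P z = 0 → F z = 0 ∧ deriv P z ≠ 0) :
    DifferentiableAt ℂ (simpleQuotient F P) z := by
  by_cases hz : P z = 0
  · obtain ⟨hFz, hdP⟩ := h hz
    have hds : ∀ {G : ℂ → ℂ}, Differentiable ℂ G → DifferentiableAt ℂ (dslope G z) z := fun hG =>
      ((Complex.differentiableOn_dslope Filter.univ_mem).2 hG.differentiableOn).differentiableAt
        Filter.univ_mem
    have hne : dslope P z z ≠ 0 := by rwa [dslope_same]
    refine ((hds hF).div (hds hP) hne).congr_of_eventuallyEq ?_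
    filter_upwards [(hds hP).continuousAt.eventually_ne hne] with w hw
    by_cases hwz : w = z
    · subst hwz; simp [simpleQuotient, hz, dslope_same]
    · rw [dslope_of_ne _ hwz, slope_def_field, hz, sub_zero] at hw
      have hPw : P w ≠ 0 := fun h0 => hw (by rw [h0, zero_div])
      have hwz' : w - z ≠ 0 := sub_ne_zero.2 hwz
      rw [Pi.div_apply, dslope_of_ne _ hwz, dslope_of_ne _ hwz, slope_def_field, slope_def_field,
        hz, hFz, sub_zero, sub_zero, simpleQuotient, if_neg hPw]
      field_simp
  · refine ((hF z).div (hP z) hz).congr_of_eventuallyEq ?_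
    filter_upwards [(hP z).continuousAt.eventually_ne hz] with w hw
    rw [simpleQuotient, if_neg hw, Pi.div_apply]

namespace IsSquareRegular

variable {D : ℝ} {t t' : ℕ → ℝ}

theorem eventually_sq_nearest (ht : IsSquareRegular D t) (k : ℕ) :
    ∀ᶠ y : ℝ in nhds (t k), ∀ n, |t k ^ 2 - y ^ 2| ≤ |t n ^ 2 - y ^ 2| := by
  obtain ⟨d, hd, hsep⟩ := ht.exists_separated
  have h1 : ∀ᶠ y : ℝ in nhds (t k), |t k ^ 2 - y ^ 2| < d / 2 := by
    have hc : ContinuousAt (fun y : ℝ => |t k ^ 2 - y ^ 2|) (t k) := by fun_prop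
    exact hc.eventually (gt_mem_nhds (by simpa using hd))
  filter_upwards [h1] with y hy n
  by_cases hnk : n = k
  · rw [hnk]
  · have e1 : (1 : ℝ) ≤ |(n : ℝ) - k| := by
      have : (1 : ℤ) ≤ |(n : ℤ) - k| := Int.one_le_abs (sub_ne_zero.2 (by exact_mod_cast hnk))
      exact_mod_cast this
    have e2 := hsep k n
    have e3 := abs_sub_le (t n ^ 2) (y ^ 2) (t k ^ 2)
    rw [abs_sub_comm (y ^ 2)] at e3
    nlinarith

/-- Near `t k` the nearest square is `t k ^ 2`, so `δ` may be taken to be `|t k ^ 2 - y ^ 2|`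
itself, which vanishes linearly. Letting `y → t k` bounds the derivative from below. -/
theorem eventually_le_norm_canonicalProduct (ht : IsSquareRegular D t) (ht' : IsSquareRegular D t') :
    ∃ c > 0, ∃ K > 0, ∀ k, ∀ᶠ y : ℝ in nhds (t k),
      c * Real.exp (-K * y) * |y - t k| ≤ ‖canonicalProduct D t t' y‖ := by
  obtain ⟨c, hc, K, hK, h⟩ := ht.le_norm_canonicalProduct ht'
  obtain ⟨c₀, hc₀, h₀⟩ := ht.exists_le_apply
  refine ⟨c * c₀, by positivity, K, hK, fun k => ?_⟩
  filter_upwards [ht.eventually_sq_nearest k, lt_mem_nhds (ht.pos k)] with y hy hy0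
  have h1 := h y (by rw [Complex.ofReal_re]; exact hy0.le)
    (by rw [← Complex.ofReal_pow, Complex.ofReal_re]; positivity) |t k ^ 2 - y ^ 2| (fun n => by
      rw [← Complex.ofReal_pow, ← Complex.ofReal_pow, ← Complex.ofReal_sub, Complex.norm_real]
      exact hy n)
  rw [← Complex.ofReal_pow, Complex.ofReal_im, Complex.norm_real, Real.norm_eq_abs, abs_zero,
    mul_zero, zero_sub, abs_of_pos hy0] at h1
  refine le_trans ?_ h1
  have h2 : c₀ * |y - t k| ≤ |t k ^ 2 - y ^ 2| := by
    rw [show t k ^ 2 - y ^ 2 = (t k + y) * (t k - y) by ring, abs_mul, abs_sub_comm y]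
    gcongr
    exact (h₀ k).trans (by rw [abs_of_pos (by linarith [ht.pos k])]; linarith)
  calc _ = c * (c₀ * |y - t k|) * Real.exp (-K * y) := by ring
    _ ≤ _ := by rw [neg_mul]; gcongr

theorem le_norm_deriv_canonicalProduct (ht : IsSquareRegular D t) (ht' : IsSquareRegular D t') :
    ∃ c > 0, ∃ K > 0, ∀ k, c * Real.exp (-K * t k) ≤ ‖deriv (canonicalProduct D t t') (t k)‖ := by
  obtain ⟨c, hc, K, hK, h⟩ := ht.eventually_le_norm_canonicalProduct ht'
  refine ⟨c, hc, K, hK, fun k => ?_⟩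
  exact le_norm_deriv_of_eventually (m := fun y => c * Real.exp (-K * y))
    (ht.differentiable_canonicalProduct ht' _) (ht.canonicalProduct_eq_zero ht' k) (by fun_prop)
    ((h k).filter_mono nhdsWithin_le_nhds)

/-- With `δ` the distance from `z²` to the nearest square, the lower bound is positive unless `z` is
a node. -/
theorem eq_apply_of_canonicalProduct_eq_zero (ht : IsSquareRegular D t) (ht' : IsSquareRegular D t')
    {z : ℂ} (hz : 0 < z.re) (hz2 : 0 ≤ (z ^ 2).re) (h0 : canonicalProduct D t t' z = 0) :
    ∃ n, z = t n := by
  obtain ⟨c, hc, K, hK, h⟩ := ht.le_norm_canonicalProduct ht'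
  obtain ⟨k, hk⟩ := ht.exists_nearest z
  have h1 := h z hz.le hz2 _ hk
  rw [h0, norm_zero] at h1
  refine ⟨k, ?_⟩
  by_contra hne
  have h2 : 0 < ‖(t k : ℂ) ^ 2 - z ^ 2‖ := by
    rw [norm_pos_iff, sq_sub_sq]
    refine mul_ne_zero (fun h3 => ?_) (sub_ne_zero.2 (Ne.symm hne))
    have := congrArg Complex.re h3
    simp only [Complex.add_re, Complex.ofReal_re, Complex.zero_re] at this
    linarith [ht.pos k]
  have : 0 < c * ‖(t k : ℂ) ^ 2 - z ^ 2‖ * Real.exp (Real.pi * D * |(z ^ 2).im| - K * ‖z‖) := by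
    positivity
  linarith

/-- Growth of the quotient of a function of order two by the canonical product. -/
theorem norm_simpleQuotient_le (ht : IsSquareRegular D t) {F : ℂ → ℂ}
    {C B : ℝ} (hC : 0 ≤ C) (hB : 0 ≤ B) (hFB : ∀ z, ‖F z‖ ≤ C * Real.exp (B * ‖z‖ ^ 2))
    (hdiff : ∀ z : ℂ, 0 < z.re → |z.im| ≤ z.re →
      DifferentiableAt ℂ (simpleQuotient F (canonicalProduct D t t)) z) :
    ∃ C₀ B₀, ∀ z : ℂ, 0 < z.re → |z.im| ≤ z.re →
      ‖simpleQuotient F (canonicalProduct D t t) z‖ ≤ C₀ * Real.exp (B₀ * ‖z‖ ^ 2) := by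
  obtain ⟨c, hc, K, hK, hlow⟩ := ht.le_norm_canonicalProduct ht
  obtain ⟨c₀, hc₀, h₀⟩ := ht.exists_le_apply
  obtain ⟨d, hd, hsep⟩ := ht.exists_separated
  have hD := ht.density_pos
  have hpi := Real.pi_pos
  -- The first two bounds keep the disks of radius `ρ / t k` inside the sector and of radius at most
  -- `1/2`. The third makes a point within `3ρ` of `t k ^ 2`, measured by squares, stay `ρ` away
  -- from every other square.
  obtain ⟨ρ, hρ, hρ1, hρ2, hρ3⟩ : ∃ ρ > 0, ρ ≤ c₀ ^ 2 / 4 ∧ ρ ≤ c₀ / 2 ∧ ρ ≤ d / 4 :=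
    ⟨min (c₀ ^ 2 / 4) (min (c₀ / 2) (d / 4)), by positivity, min_le_left _ _,
      (min_le_right _ _).trans (min_le_left _ _), (min_le_right _ _).trans (min_le_right _ _)⟩
  have hgood : ∀ z : ℂ, 0 < z.re → |z.im| ≤ z.re → (∀ n, ρ ≤ ‖(t n : ℂ) ^ 2 - z ^ 2‖) →
      ‖simpleQuotient F (canonicalProduct D t t) z‖ ≤
        C / (c * ρ) * Real.exp (B * ‖z‖ ^ 2 + K * ‖z‖) := by
    intro z hz1 hz2 hz3
    have hz4 : 0 ≤ (z ^ 2).re := by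
      rw [sq, Complex.mul_re]
      nlinarith [abs_nonneg z.im, sq_abs z.im]
    have h1 := hlow z hz1.le hz4 ρ hz3
    have h2 : c * ρ * Real.exp (-(K * ‖z‖)) ≤ ‖canonicalProduct D t t z‖ := by
      refine le_trans ?_ h1
      gcongr
      have : 0 ≤ Real.pi * D * |(z ^ 2).im| := by positivity
      linarith
    have h3 : 0 < ‖canonicalProduct D t t z‖ := lt_of_lt_of_le (by positivity) h2
    rw [simpleQuotient, if_neg (norm_pos_iff.1 h3), norm_div, div_le_iff₀ h3]
    calc ‖F z‖ ≤ C * Real.exp (B * ‖z‖ ^ 2) := hFB z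
      _ = C / (c * ρ) * Real.exp (B * ‖z‖ ^ 2 + K * ‖z‖) * (c * ρ * Real.exp (-(K * ‖z‖))) := by
        rw [Real.exp_add, Real.exp_neg]; field_simp
      _ ≤ _ := by gcongr
  refine ⟨C / (c * ρ) * Real.exp (2 * B + 2 * K), 2 * B + K, fun z hz1 hz2 => ?_⟩
  have hfin : Real.exp (B * (‖z‖ + 1) ^ 2 + K * (‖z‖ + 1)) ≤
      Real.exp (2 * B + 2 * K) * Real.exp ((2 * B + K) * ‖z‖ ^ 2) := by
    rw [← Real.exp_add]
    refine Real.exp_le_exp.2 ?_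
    nlinarith [mul_nonneg hB (sq_nonneg (‖z‖ - 1)), mul_nonneg hK.le (sq_nonneg (‖z‖ - 1 / 2))]
  by_cases hz3 : ∀ n, ρ ≤ ‖(t n : ℂ) ^ 2 - z ^ 2‖
  · refine (hgood z hz1 hz2 hz3).trans ?_
    rw [mul_assoc]
    refine mul_le_mul_of_nonneg_left (le_trans (Real.exp_le_exp.2 ?_) hfin) (by positivity)
    have := norm_nonneg z
    gcongr <;> linarith
  · push Not at hz3
    obtain ⟨k, hk⟩ := hz3
    have htk := ht.pos k
    have hck := h₀ k
    -- On the circle `|w - t k| = r` the quantity `|t k ^ 2 - w ^ 2| = r |t k + w|` lies between `ρ`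
    -- and `3ρ`. The circle therefore consists of good points, and the maximum principle bounds the
    -- quotient inside.
    set r := ρ / t k with hr
    have hr0 : 0 < r := by positivity
    have hrt : r * t k = ρ := by rw [hr]; field_simp
    have hr1 : r ≤ 1 / 2 := by
      rw [hr, div_le_iff₀ htk]; linarith
    have hr2 : r ≤ t k / 4 := by
      rw [hr, div_le_iff₀ htk]; nlinarith
    have hzr : ‖z - t k‖ ≤ r := by
      have e1 : ‖(t k : ℂ) ^ 2 - z ^ 2‖ = ‖z - t k‖ * ‖(t k : ℂ) + z‖ := by
        rw [sq_sub_sq, norm_mul, mul_comm, norm_sub_rev]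
      have e2 : t k ≤ ‖(t k : ℂ) + z‖ := by
        refine le_trans ?_ (Complex.re_le_norm _)
        rw [Complex.add_re, Complex.ofReal_re]; linarith
      rw [hr, le_div_iff₀ htk]
      have := mul_le_mul_of_nonneg_left e2 (norm_nonneg (z - t k))
      linarith
    have hball : ∀ w : ℂ, ‖w - t k‖ ≤ r → 0 < w.re ∧ |w.im| ≤ w.re := by
      intro w hw
      have e1 := (Complex.abs_re_le_norm (w - t k)).trans hw
      have e2 := (Complex.abs_im_le_norm (w - t k)).trans hw
      rw [Complex.sub_re, Complex.ofReal_re] at e1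
      rw [Complex.sub_im, Complex.ofReal_im, sub_zero] at e2
      have := (abs_le.1 e1).1
      constructor <;> linarith
    have hzc : z ∈ closure (Metric.ball (t k : ℂ) r) := by
      rw [closure_ball _ hr0.ne', Metric.mem_closedBall, dist_eq_norm]; exact hzr
    refine (Complex.norm_le_of_forall_mem_frontier_norm_le (U := Metric.ball (t k : ℂ) r)
      (C := C / (c * ρ) * Real.exp (B * (‖z‖ + 1) ^ 2 + K * (‖z‖ + 1)))
      Metric.isBounded_ball (DifferentiableOn.diffContOnCl fun w hw => ?_) ?_ hzc).trans ?_
    · rw [closure_ball _ hr0.ne', Metric.mem_closedBall, dist_eq_norm] at hw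
      obtain ⟨hw1, hw2⟩ := hball w hw
      exact (hdiff w hw1 hw2).differentiableWithinAt
    · intro w hw
      rw [frontier_ball _ hr0.ne', mem_sphere_iff_norm] at hw
      obtain ⟨hw1, hw2⟩ := hball w hw.le
      have e1 : ‖(t k : ℂ) ^ 2 - w ^ 2‖ = r * ‖(t k : ℂ) + w‖ := by
        rw [sq_sub_sq, norm_mul, mul_comm, norm_sub_rev, hw]
      have e2 : t k ≤ ‖(t k : ℂ) + w‖ := by
        refine le_trans ?_ (Complex.re_le_norm _)
        rw [Complex.add_re, Complex.ofReal_re]; linarith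
      have e3 : ‖(t k : ℂ) + w‖ ≤ 3 * t k := by
        have : (t k : ℂ) + w = ((2 * t k : ℝ) : ℂ) + (w - t k) := by push_cast; ring
        rw [this]
        refine (norm_add_le _ _).trans ?_
        rw [Complex.norm_real, Real.norm_eq_abs, abs_of_pos (by linarith), hw]
        linarith
      refine (hgood w hw1 hw2 fun n => ?_).trans ?_
      · by_cases hnk : n = k
        · rw [hnk, e1]; nlinarith
        · have f1 : (1 : ℝ) ≤ |(n : ℝ) - k| := by
            have : (1 : ℤ) ≤ |(n : ℤ) - k| := Int.one_le_abs (sub_ne_zero.2 (by exact_mod_cast hnk))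
            exact_mod_cast this
          have f2 := hsep k n
          have f3 : |t n ^ 2 - t k ^ 2| = ‖((t n : ℂ) ^ 2 - w ^ 2) - ((t k : ℂ) ^ 2 - w ^ 2)‖ := by
            rw [sub_sub_sub_cancel_right, ← Real.norm_eq_abs, ← Complex.norm_real]; push_cast; rfl
          have f4 := norm_sub_le ((t n : ℂ) ^ 2 - w ^ 2) ((t k : ℂ) ^ 2 - w ^ 2)
          have f5 : ‖(t k : ℂ) ^ 2 - w ^ 2‖ ≤ 3 * ρ := by rw [e1]; nlinarith
          nlinarith
      · have hwz : ‖w‖ ≤ ‖z‖ + 1 := by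
          have : w = z + ((w - t k) - (z - t k)) := by ring
          rw [this]
          refine (norm_add_le _ _).trans ?_
          have := norm_sub_le (w - t k) (z - t k)
          linarith
        gcongr
    · rw [mul_assoc]
      exact mul_le_mul_of_nonneg_left hfin (by positivity)

set_option maxHeartbeats 1000000 in
/-- Zeros of density `D` on the positive ray improve the decay of `F` there. -/
theorem exists_norm_le_of_zeros (ht : IsSquareRegular D t) {F : ℂ → ℂ} (hF : Differentiable ℂ F)
    {a b C : ℝ} (hb : 0 < b)
    (hup : ∀ z, ‖F z‖ ≤ C * Real.exp (Real.pi / b * z.im ^ 2))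
    (hre : ∀ x : ℝ, 0 < x → ‖F x‖ ≤ C * Real.exp (-(a * Real.pi) * x ^ 2))
    (hzero : ∀ n, F (t n) = 0) {τ u a' : ℝ} (hτ : 0 < τ) (hu : 0 < u) (huτ : u ≤ τ) (hu2 : u ≤ 1 / 2)
    (hlt : ((1 / b - a) * τ + a / τ) / 2 < D)
    (ha' : a' < a + (D - ((1 / b - a) * τ + a / τ) / 2) * (2 * u)) :
    ∃ C', ∀ x : ℝ, 0 < x → ‖F x‖ ≤ C' * Real.exp (-(a' * Real.pi) * x ^ 2) := by
  have hpi := Real.pi_pos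
  have hC : 0 ≤ C := by
    have := (norm_nonneg _).trans (hup 0)
    simpa using this
  have husq : u ^ 2 ≤ 1 / 4 := by nlinarith
  set c₁ := ((1 / b - a) * τ + a / τ) / 2 with hc₁
  set P := canonicalProduct D t t with hP
  have hPd : Differentiable ℂ P := ht.differentiable_canonicalProduct ht
  obtain ⟨c, hc, K, hK, hlow⟩ := ht.le_norm_canonicalProduct ht
  obtain ⟨c₂, hc₂, K₂, hK₂, hder⟩ := ht.le_norm_deriv_canonicalProduct ht
  obtain ⟨C₃, hC₃, K₃, hK₃, hPup⟩ := ht.norm_canonicalProduct_le ht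
  obtain ⟨c₀, hc₀, h₀⟩ := ht.exists_le_apply
  have hre2 : ∀ z : ℂ, (z ^ 2).re = z.re ^ 2 - z.im ^ 2 := fun z => by
    rw [sq, Complex.mul_re]; ring
  have him2 : ∀ z : ℂ, (z ^ 2).im = 2 * z.re * z.im := fun z => by
    rw [sq, Complex.mul_im]; ring
  set g := simpleQuotient F P with hg
  have hdiff : ∀ z : ℂ, 0 < z.re → |z.im| ≤ z.re → DifferentiableAt ℂ g z := by
    intro z hz1 hz2
    refine differentiableAt_simpleQuotient hF hPd fun h0 => ?_
    obtain ⟨n, rfl⟩ := ht.eq_apply_of_canonicalProduct_eq_zero ht hz1 (by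
      rw [hre2]; nlinarith [abs_nonneg z.im, sq_abs z.im]) h0
    refine ⟨hzero n, norm_pos_iff.1 (lt_of_lt_of_le (by positivity) (hder n))⟩
  obtain ⟨C₀, B₀, hgrow⟩ := ht.norm_simpleQuotient_le hC (B := Real.pi / b) (by positivity)
    (fun z => (hup z).trans (by
      rw [← sq_abs z.im]
      gcongr
      exact Complex.abs_im_le_norm z)) hdiff
  -- On the rays `|y| = ux` one has `|Im z²| = 2ux² ≥ 2u Re z²`, so the quotient gains `(D - c₁)2u`
  -- in rate. The surplus `η` over the target is split: half absorbs `exp(K|z|)` on the rays, the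
  -- other half the growth of the product on the real axis.
  set η := (a + (D - c₁) * (2 * u) - a') * Real.pi with hη
  have hη0 : 0 < η := mul_pos (by linarith) hpi
  set ρ := c₀ ^ 2 * u with hρ
  have hρ0 : 0 < ρ := by positivity
  -- the bound on the two boundary rays
  have hray : ∀ z : ℂ, 0 < z.re → |z.im| = u * z.re →
      ‖g z‖ ≤ C / (c * ρ) * Real.exp (K ^ 2 / η) *
        Real.exp ((-(a' * Real.pi) - η / 2) * (z ^ 2).re + 0 * (z ^ 2).im) := by
    intro z hz1 hz2
    have hz3 : z.im ^ 2 = u ^ 2 * z.re ^ 2 := by rw [← sq_abs, hz2]; ring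
    have hr : (z ^ 2).re = (1 - u ^ 2) * z.re ^ 2 := by rw [hre2, hz3]; ring
    have hi : |(z ^ 2).im| = 2 * u * z.re ^ 2 := by
      rw [him2, abs_mul, abs_of_pos (by linarith), hz2]; ring
    have hn : ‖z‖ ^ 2 = (1 + u ^ 2) * z.re ^ 2 := by
      rw [Complex.sq_norm, Complex.normSq_apply]; linarith
    have hR0 : 0 < (z ^ 2).re := by
      rw [hr]; exact mul_pos (by linarith) (by positivity)
    have hz0 : 0 < ‖z‖ := lt_of_lt_of_le hz1 (Complex.re_le_norm z)
    have hdist : ∀ n, ρ ≤ ‖(t n : ℂ) ^ 2 - z ^ 2‖ := by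
      intro n
      -- The left side is the imaginary part of `(t n ^ 2 - z ^ 2)` times the conjugate of `z²`, up
      -- to sign. It bounds from below the distance from the nodes' squares to the ray through `z²`.
      have e1 : t n ^ 2 * |(z ^ 2).im| ≤ ‖(t n : ℂ) ^ 2 - z ^ 2‖ * ‖z‖ ^ 2 := by
        have := Complex.abs_im_le_norm (((t n : ℂ) ^ 2 - z ^ 2) * (starRingEnd ℂ) (z ^ 2))
        rw [norm_mul, RCLike.norm_conj, norm_pow z] at this
        refine le_trans (le_of_eq ?_) this
        rw [← abs_of_pos (pow_pos (ht.pos n) 2), ← abs_mul, ← abs_neg]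
        congr 1
        rw [Complex.mul_im, Complex.conj_re, Complex.conj_im, Complex.sub_re, Complex.sub_im,
          ← Complex.ofReal_pow, Complex.ofReal_re, Complex.ofReal_im]
        ring
      rw [hi, hn] at e1
      have e2 : c₀ ^ 2 ≤ t n ^ 2 := by have := h₀ n; gcongr
      have hx2 : 0 < z.re ^ 2 := by positivity
      have e3 : t n ^ 2 * (2 * u) ≤ ‖(t n : ℂ) ^ 2 - z ^ 2‖ * (1 + u ^ 2) := by
        refine le_of_mul_le_mul_right ?_ hx2
        linarith
      have e4 : ‖(t n : ℂ) ^ 2 - z ^ 2‖ * (1 + u ^ 2) ≤ ‖(t n : ℂ) ^ 2 - z ^ 2‖ * 2 := by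
        gcongr; linarith
      rw [hρ]
      linarith [mul_le_mul_of_nonneg_right e2 hu.le]
    have h1 := hlow z hz1.le hR0.le ρ hdist
    have h2 := norm_le_in_sector hF hb hup hre hτ hz1 (by rw [hz2]; gcongr)
    have h3 : 0 < ‖P z‖ := lt_of_lt_of_le (by positivity) h1
    rw [hg, simpleQuotient, if_neg (norm_pos_iff.1 h3), norm_div, div_le_iff₀ h3]
    refine h2.trans ?_
    calc _ ≤ C * Real.exp (K ^ 2 / η + ((-(a' * Real.pi) - η / 2) * (z ^ 2).re + 0 * (z ^ 2).im) +
          (Real.pi * D * |(z ^ 2).im| - K * ‖z‖)) := by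
          refine mul_le_mul_of_nonneg_left (Real.exp_le_exp.2 ?_) hC
          rw [← hc₁, zero_mul, add_zero]
          have e1 : K * ‖z‖ ≤ η / 4 * ‖z‖ ^ 2 + K ^ 2 / η := by
            have : η / 4 * ‖z‖ ^ 2 + K ^ 2 / η - K * ‖z‖ = (η * ‖z‖ - 2 * K) ^ 2 / (4 * η) := by
              field_simp; ring
            have h2 : 0 ≤ (η * ‖z‖ - 2 * K) ^ 2 / (4 * η) := by positivity
            linarith
          have e2 : ‖z‖ ^ 2 ≤ 2 * (z ^ 2).re := by
            rw [hn, hr]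
            have := mul_nonneg (show 0 ≤ 1 - 3 * u ^ 2 by linarith) (sq_nonneg z.re)
            linarith
          have e3 : (z ^ 2).re ≤ z.re ^ 2 := by rw [hre2]; linarith [sq_nonneg z.im]
          have e4 : (D - c₁) * Real.pi * (2 * u) * (z ^ 2).re ≤ (D - c₁) * Real.pi * |(z ^ 2).im| := by
            rw [hi]
            have : 0 ≤ (D - c₁) * Real.pi * (2 * u) :=
              mul_nonneg (mul_nonneg (by linarith) hpi.le) (by linarith)
            have := mul_le_mul_of_nonneg_left e3 this
            linarith
          have e5 : η * (z ^ 2).re = a * Real.pi * (z ^ 2).re +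
              (D - c₁) * Real.pi * (2 * u) * (z ^ 2).re - a' * Real.pi * (z ^ 2).re := by
            rw [hη]; ring
          have e6 : η / 4 * ‖z‖ ^ 2 ≤ η / 4 * (2 * (z ^ 2).re) := by gcongr
          linarith
      _ = C / (c * ρ) * Real.exp (K ^ 2 / η) *
        Real.exp ((-(a' * Real.pi) - η / 2) * (z ^ 2).re + 0 * (z ^ 2).im) *
          (c * ρ * Real.exp (Real.pi * D * |(z ^ 2).im| - K * ‖z‖)) := by
          rw [Real.exp_add, Real.exp_add]; field_simp
      _ ≤ _ := by gcongr
  have harc : Real.arctan u - Real.arctan (-u) < Real.pi / 2 := by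
    have : Real.arctan u < Real.arctan 1 := Real.arctan_strictMono (by linarith)
    rw [Real.arctan_one] at this
    rw [Real.arctan_neg]; linarith
  have habs : ∀ z : ℂ, 0 < z.re → -u * z.re ≤ z.im → z.im ≤ u * z.re → |z.im| ≤ z.re := by
    intro z h1 h2 h3
    have h4 : u * z.re ≤ 1 * z.re := by gcongr; linarith
    rw [abs_le]; constructor <;> linarith
  have hin : ∀ x : ℝ, 0 < x → ‖g x‖ ≤ C / (c * ρ) * Real.exp (K ^ 2 / η) *
      Real.exp ((-(a' * Real.pi) - η / 2) * x ^ 2) := by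
    intro x hx
    have := PhragmenLindelof.sector_of_order_two (h := g) (m₁ := -u) (m₂ := u)
      (p := -(a' * Real.pi) - η / 2) (q := 0) (by linarith) harc
      (fun z h1 h2 h3 => hdiff z h1 (habs z h1 h2 h3))
      (fun z h1 h2 h3 => hgrow z h1 (habs z h1 h2 h3))
      (fun z h1 h2 => hray z h1 (by rw [h2, abs_mul, abs_neg, abs_of_pos hu, abs_of_pos h1]))
      (fun z h1 h2 => hray z h1 (by rw [h2, abs_mul, abs_of_pos hu, abs_of_pos h1]))
      (z := x) (by simpa using hx) (by simp; positivity) (by simp; positivity)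
    simpa [← Complex.ofReal_pow] using this
  refine ⟨C / (c * ρ) * Real.exp (K ^ 2 / η) * C₃ * Real.exp (K₃ ^ 2 / (2 * η)), fun x hx => ?_⟩
  by_cases h0 : P x = 0
  · have : F x = 0 := by
      obtain ⟨n, hn⟩ := ht.eq_apply_of_canonicalProduct_eq_zero ht (z := x) (by simpa using hx)
        (by rw [← Complex.ofReal_pow, Complex.ofReal_re]; positivity) h0
      rw [hn, hzero]
    rw [this, norm_zero]; positivity
  · have h1 := hin x hx
    rw [hg, simpleQuotient, if_neg h0, norm_div, div_le_iff₀ (norm_pos_iff.2 h0)] at h1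
    have h2 := hPup x
    rw [← Complex.ofReal_pow, Complex.ofReal_im, abs_zero, mul_zero, zero_add, Complex.norm_real,
      Real.norm_eq_abs, abs_of_pos hx] at h2
    refine h1.trans ?_
    calc _ ≤ C / (c * ρ) * Real.exp (K ^ 2 / η) *
        Real.exp ((-(a' * Real.pi) - η / 2) * x ^ 2) * (C₃ * Real.exp (K₃ * x)) := by gcongr
      _ = C / (c * ρ) * Real.exp (K ^ 2 / η) * C₃ *
        Real.exp ((-(a' * Real.pi) - η / 2) * x ^ 2 + K₃ * x) := by rw [Real.exp_add]; ring
      _ ≤ C / (c * ρ) * Real.exp (K ^ 2 / η) * C₃ *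
        Real.exp (K₃ ^ 2 / (2 * η) + -(a' * Real.pi) * x ^ 2) := by
          refine mul_le_mul_of_nonneg_left (Real.exp_le_exp.2 ?_) (by positivity)
          have : K₃ ^ 2 / (2 * η) + -(a' * Real.pi) * x ^ 2 - ((-(a' * Real.pi) - η / 2) * x ^ 2 + K₃ * x) =
            (η * x - K₃) ^ 2 / (2 * η) := by field_simp; ring
          have h2 : 0 ≤ (η * x - K₃) ^ 2 / (2 * η) := by positivity
          linarith
      _ = _ := by rw [Real.exp_add]; ring

end IsSquareRegular

/-! ### Uniqueness through critical decay rates. -/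

theorem SchwartzMap.exists_entire_extension_of_hasGaussianDecay (f : 𝓢(ℝ, ℂ)) {a b : ℝ}
    (hb : 0 < b) (hfa : HasGaussianDecay f a) (hfb : HasGaussianDecay (𝓕 (f : ℝ → ℂ)) b) :
    ∃ F : ℂ → ℂ, Differentiable ℂ F ∧ (∀ x : ℝ, F x = f x) ∧
      ∃ C, (∀ z, ‖F z‖ ≤ C * Real.exp (Real.pi / b * z.im ^ 2)) ∧
        ∀ x : ℝ, ‖F x‖ ≤ C * Real.exp (-(a * Real.pi) * x ^ 2) := by
  obtain ⟨F, hF, hFf, C, hC⟩ := f.exists_entire_extension hb hfb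
  obtain ⟨C', hC'⟩ := hfa
  refine ⟨F, hF, hFf, max C C', fun z => (hC z).trans ?_, fun x => ?_⟩
  · gcongr; exact le_max_left _ _
  · rw [hFf]
    refine (hC' x).trans ?_
    gcongr; exact le_max_right _ _

theorem SchwartzMap.eq_zero_of_hasGaussianDecay (f : 𝓢(ℝ, ℂ)) {a b : ℝ} (hb : 0 < b)
    (hab : 1 < a * b) (hfa : HasGaussianDecay f a) (hfb : HasGaussianDecay (𝓕 (f : ℝ → ℂ)) b) :
    f = 0 := by
  obtain ⟨F, hF, hFf, C, hup, hre⟩ := f.exists_entire_extension_of_hasGaussianDecay hb hfa hfb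
  have := eq_zero_of_one_lt_mul hF hb hab hup fun x _ => hre x
  ext x
  rw [← hFf, this]
  rfl

theorem SchwartzMap.hasGaussianDecay_of_zeros (f : 𝓢(ℝ, ℂ)) {a b : ℝ} (hb : 0 < b)
    (hfa : HasGaussianDecay f a) (hfb : HasGaussianDecay (𝓕 (f : ℝ → ℂ)) b)
    {D : ℝ} {t t' : ℕ → ℝ} (ht : IsSquareRegular D t) (ht' : IsSquareRegular D t')
    (h0 : ∀ n, f (t n) = 0) (h0' : ∀ n, f (-t' n) = 0)
    {τ u a' : ℝ} (hτ : 0 < τ) (hu : 0 < u) (huτ : u ≤ τ) (hu2 : u ≤ 1 / 2)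
    (hlt : ((1 / b - a) * τ + a / τ) / 2 < D)
    (ha' : a' < a + (D - ((1 / b - a) * τ + a / τ) / 2) * (2 * u)) : HasGaussianDecay f a' := by
  obtain ⟨F, hF, hFf, C, hup, hre⟩ := f.exists_entire_extension_of_hasGaussianDecay hb hfa hfb
  obtain ⟨C₁, h₁⟩ := ht.exists_norm_le_of_zeros hF hb hup (fun x _ => hre x)
    (fun n => by rw [hFf, h0]) hτ hu huτ hu2 hlt ha'
  obtain ⟨C₂, h₂⟩ := ht'.exists_norm_le_of_zeros (F := fun z => F (-z))
    (hF.comp differentiable_neg) hb (C := C)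
    (fun z => by have := hup (-z); rwa [Complex.neg_im, neg_sq] at this)
    (fun x _ => by have := hre (-x); rwa [Complex.ofReal_neg, neg_sq] at this)
    (fun n => by rw [← Complex.ofReal_neg, hFf, h0']) hτ hu huτ hu2 hlt ha'
  refine ⟨max (max C₁ C₂) ‖f 0‖, fun x => ?_⟩
  rcases lt_trichotomy x 0 with hx | rfl | hx
  · have := h₂ (-x) (by linarith)
    rw [Complex.ofReal_neg, neg_neg, neg_sq, hFf] at this
    refine this.trans ?_
    gcongr
    exact (le_max_right _ _).trans (le_max_left _ _)
  · simp
  · have := h₁ x hx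
    rw [hFf] at this
    refine this.trans ?_
    gcongr
    exact (le_max_left _ _).trans (le_max_left _ _)

/-- Only rates below `A` and `B` are available, so the improvement lemma is applied at `A - ε`, `B -
ε`. Its gain does not shrink with `ε`, hence exceeds the loss and crosses `A`. -/
theorem SchwartzMap.exists_hasGaussianDecay_of_zeros (f : 𝓢(ℝ, ℂ)) {A B : ℝ} (hA : 0 < A)
    (hB : 0 < B) (hfA : ∀ a < A, HasGaussianDecay f a)
    (hfB : ∀ b < B, HasGaussianDecay (𝓕 (f : ℝ → ℂ)) b)
    {D : ℝ} {t t' : ℕ → ℝ} (hD : A * (1 / B - A) < D ^ 2)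
    (ht : IsSquareRegular D t) (ht' : IsSquareRegular D t')
    (h0 : ∀ n, f (t n) = 0) (h0' : ∀ n, f (-t' n) = 0) : ∃ a, A < a ∧ HasGaussianDecay f a := by
  have hD0 := ht.density_pos
  -- This slope makes the excess of the density equal to `(D² - A(1/B - A)) / (2D)`. Unlike the
  -- optimal slope `√(A / (1/B - A))`, it also makes sense when `AB = 1`.
  set τ := A / D with hτ
  have hτ0 : 0 < τ := by positivity
  set u := min τ (1 / 2) with hu
  have hu0 : 0 < u := lt_min hτ0 (by norm_num)
  set φ : ℝ → ℝ := fun ε => D - ((1 / (B - ε) - (A - ε)) * τ + (A - ε) / τ) / 2 with hφ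
  have hφ0 : 0 < φ 0 := by
    have : φ 0 = (D ^ 2 - A * (1 / B - A)) / (2 * D) := by
      simp only [hφ, hτ, sub_zero]; field_simp; ring
    rw [this]
    exact div_pos (by linarith) (by positivity)
  have hcont : ContinuousAt φ 0 := by
    refine continuousAt_const.sub (ContinuousAt.div_const (ContinuousAt.add (ContinuousAt.mul
      (ContinuousAt.sub (ContinuousAt.div continuousAt_const (by fun_prop) ?_) (by fun_prop))
      continuousAt_const) (by fun_prop)) _)
    simpa using hB.ne'
  have hcont2 : ContinuousAt (fun ε => (A - ε) + φ ε * (2 * u)) 0 := by fun_prop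
  have e1 : ∀ᶠ ε in nhdsWithin (0 : ℝ) (Set.Ioi 0), 0 < φ ε :=
    (hcont.eventually (lt_mem_nhds hφ0)).filter_mono nhdsWithin_le_nhds
  have e2 : ∀ᶠ ε in nhdsWithin (0 : ℝ) (Set.Ioi 0), A + φ 0 * u < (A - ε) + φ ε * (2 * u) := by
    refine (hcont2.eventually (lt_mem_nhds ?_)).filter_mono nhdsWithin_le_nhds
    have := mul_pos hφ0 hu0
    linarith
  have e3 : ∀ᶠ ε in nhdsWithin (0 : ℝ) (Set.Ioi 0), ε < B :=
    (gt_mem_nhds hB : ∀ᶠ ε in nhds (0 : ℝ), ε < B).filter_mono nhdsWithin_le_nhds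
  obtain ⟨ε, h1, h2, h3, h4⟩ := (e1.and (e2.and (e3.and self_mem_nhdsWithin))).exists
  refine ⟨A + φ 0 * u, by linarith [mul_pos hφ0 hu0], ?_⟩
  exact f.hasGaussianDecay_of_zeros (a := A - ε) (b := B - ε) (by linarith)
    (hfA _ (by linarith)) (hfB _ (by linarith)) ht ht' h0 h0' hτ0 hu0 (min_le_left _ _)
    (min_le_right _ _) (by simp only [hφ] at h1; linarith) h2

theorem SchwartzMap.fourier_fourier_apply (f : 𝓢(ℝ, ℂ)) (x : ℝ) :
    𝓕 ((𝓕 f : 𝓢(ℝ, ℂ)) : ℝ → ℂ) x = f (-x) := by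
  have h1 : 𝓕⁻ (𝓕 f) = f := FourierTransform.fourierInv_fourier_eq f
  conv_rhs => rw [← h1, SchwartzMap.fourierInv_coe, Real.fourierInv_eq_fourier_neg, neg_neg]

/-- The supremum of the Gaussian decay rates of a function. -/
theorem HasGaussianDecay.exists_critical {f : ℝ → ℂ} {a m : ℝ} (ha : HasGaussianDecay f a)
    (hm : ∀ a', m < a' → ¬ HasGaussianDecay f a') :
    ∃ A, a ≤ A ∧ (∀ a' < A, HasGaussianDecay f a') ∧ ∀ a', A < a' → ¬ HasGaussianDecay f a' := by
  have hbdd : BddAbove {a' | HasGaussianDecay f a'} :=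
    ⟨m, fun a' h => not_lt.1 fun h' => hm a' h' h⟩
  refine ⟨sSup {a' | HasGaussianDecay f a'}, le_csSup hbdd ha, fun a' h => ?_,
    fun a' h h' => not_lt.2 (le_csSup hbdd h') h⟩
  obtain ⟨a'', h1, h2⟩ := exists_lt_of_lt_csSup ⟨a, ha⟩ h
  exact HasGaussianDecay.mono h1 h2.le

/-- At the critical rates neither `f` nor its transform can be improved, so `D² ≤ A(1/B - A)` and
`D'² ≤ B(1/A - B)`. Multiplying gives `D²D'² ≤ (1 - AB)²`, incompatible with `D²D'² > (1 - ab)²`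
because `ab ≤ AB ≤ 1`. One inequality alone would not suffice. -/
theorem SchwartzMap.eq_zero_of_zeros (f : 𝓢(ℝ, ℂ)) {a b D D' : ℝ} (ha : 0 < a) (hb : 0 < b)
    (hab : a * b < 1) (hfa : HasGaussianDecay f a) (hfb : HasGaussianDecay (𝓕 (f : ℝ → ℂ)) b)
    {t t' s s' : ℕ → ℝ} (ht : IsSquareRegular D t) (ht' : IsSquareRegular D t')
    (hs : IsSquareRegular D' s) (hs' : IsSquareRegular D' s')
    (h0 : ∀ n, f (t n) = 0) (h0' : ∀ n, f (-t' n) = 0)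
    (h1 : ∀ n, 𝓕 (f : ℝ → ℂ) (s n) = 0) (h1' : ∀ n, 𝓕 (f : ℝ → ℂ) (-s' n) = 0)
    (hD : a * (1 / b - a) < D ^ 2) (hD' : b * (1 / a - b) < D' ^ 2) : f = 0 := by
  by_contra hf
  obtain ⟨A, hA, hA1, hA2⟩ := hfa.exists_critical (m := 1 / b) fun a' h h' =>
    hf (f.eq_zero_of_hasGaussianDecay hb (by rwa [div_lt_iff₀ hb] at h) h' hfb)
  obtain ⟨B, hB, hB1, hB2⟩ := hfb.exists_critical (m := 1 / a) fun b' h h' =>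
    hf (f.eq_zero_of_hasGaussianDecay ((by positivity : 0 < 1 / a).trans h)
      (by rwa [div_lt_iff₀ ha, mul_comm] at h) hfa h')
  have hA0 : 0 < A := ha.trans_le hA
  have hB0 : 0 < B := hb.trans_le hB
  have hAB : A * B ≤ 1 := by
    -- Critical rates need not be attained, so Hardy's principle is used at slightly smaller `a' <
    -- A`, `b' < B` that still satisfy `a'b' > 1`.
    by_contra! h
    have e1 : 1 / B < A := by rwa [div_lt_iff₀ hB0]
    obtain ⟨a', h2, h3⟩ := exists_between e1
    have ha' : 0 < a' := (by positivity : 0 < 1 / B).trans h2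
    have e2 : 1 / a' < B := by rw [div_lt_iff₀ hB0] at h2; rw [div_lt_iff₀ ha']; linarith
    obtain ⟨b', h4, h5⟩ := exists_between e2
    exact hf (f.eq_zero_of_hasGaussianDecay ((by positivity : 0 < 1 / a').trans h4)
      (by rwa [div_lt_iff₀ ha', mul_comm] at h4) (hA1 _ h3) (hB1 _ h5))
  have k1 : D ^ 2 ≤ A * (1 / B - A) := by
    by_contra! h
    obtain ⟨a', h2, h3⟩ := f.exists_hasGaussianDecay_of_zeros hA0 hB0 hA1 hB1 h ht ht' h0 h0'
    exact hA2 _ h2 h3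
  have k2 : D' ^ 2 ≤ B * (1 / A - B) := by
    by_contra! h
    obtain ⟨a', h2, h3⟩ := (𝓕 f).exists_hasGaussianDecay_of_zeros hB0 hA0
      (by simpa [SchwartzMap.fourier_coe] using hB1) (fun a' h => by
        obtain ⟨C, hC⟩ := hA1 a' h
        refine ⟨C, fun x => ?_⟩
        rw [f.fourier_fourier_apply]
        have := hC (-x)
        rwa [neg_sq] at this) h hs hs'
      (by simpa [SchwartzMap.fourier_coe] using h1) (by simpa [SchwartzMap.fourier_coe] using h1')
    rw [SchwartzMap.fourier_coe] at h3
    exact hB2 _ h2 h3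
  have k3 : A * (1 / B - A) * (B * (1 / A - B)) = (1 - A * B) ^ 2 := by field_simp
  have k4 : a * (1 / b - a) * (b * (1 / a - b)) = (1 - a * b) ^ 2 := by field_simp
  have k5 : 0 < b * (1 / a - b) := by
    refine mul_pos hb (sub_pos.2 ?_)
    rw [lt_div_iff₀ ha]; linarith
  have k6 : (1 - a * b) ^ 2 < (1 - A * B) ^ 2 := by
    rw [← k3, ← k4]
    calc _ < D ^ 2 * (b * (1 / a - b)) := by gcongr
      _ ≤ D ^ 2 * D' ^ 2 := by gcongr
      _ ≤ _ := mul_le_mul k1 k2 (sq_nonneg _) ((sq_nonneg _).trans k1)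
  have k7 : a * b ≤ A * B := mul_le_mul hA hB hb.le hA0.le
  exact absurd k6 (not_lt.2 (pow_le_pow_left₀ (by linarith) (by linarith) 2))

/-! ### From smooth sequences to square-regular ones. -/

namespace IsSmoothSequence

variable {Γ : Set ℂ} {D : ℝ}

/-- The point of least modulus may be `0` and is dropped, whence the shift by one; it is restored
later as a finite condition. -/
theorem exists_isSquareRegular (h : IsSmoothSequence Γ 2 D) :
    ∃ γ : ℕ → ℂ, Set.range γ = Γ ∧ IsSquareRegular D fun n => ‖γ (n + 1)‖ := by
  obtain ⟨γ, hγ, ⟨θ, hθ⟩, hmono, htend, d, hd, hgap⟩ := h.exists_enum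
  have hD := h.density_pos
  refine ⟨γ, hγ, hD, fun n => (norm_nonneg _).trans_lt (hmono n.lt_succ_self), ?_, ?_⟩
  -- The ball is open and the enumeration starts at `0`, so exactly `n` points precede `γ n`.
  · have hcount : ∀ n, countingFunction Γ ‖γ n‖ = n := by
      intro n
      have : Γ ∩ Metric.ball 0 ‖γ n‖ = γ '' (Set.Iio n) := by
        ext z
        simp only [← hγ, Set.mem_inter_iff, Set.mem_range, mem_ball_zero_iff, Set.mem_image,
          Set.mem_Iio]
        constructor
        · rintro ⟨⟨j, rfl⟩, h⟩
          exact ⟨j, hmono.lt_iff_lt.1 h, rfl⟩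
        · rintro ⟨j, h, rfl⟩
          exact ⟨⟨j, rfl⟩, hmono h⟩
      have hinj : Function.Injective γ := fun i j h => hmono.injective (by simp [h])
      rw [countingFunction, this, Set.ncard_image_of_injective _ hinj, Set.ncard_eq_toFinset_card']
      simp
    have h1 := h.counting.comp_tendsto htend
    obtain ⟨C, hC⟩ := (Asymptotics.isBigO_one_nat_atTop_iff (E'' := ℝ)).1 h1
    refine ⟨C / D, fun n => ?_⟩
    have h2 := hC (n + 1)
    simp only [Function.comp_apply, hcount, Real.rpow_two, Real.norm_eq_abs] at h2
    rw [le_div_iff₀ hD, ← abs_of_pos hD, ← abs_mul, abs_of_pos hD]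
    refine le_trans (le_of_eq ?_) h2
    rw [← abs_neg]
    congr 1
    push_cast
    field_simp
    ring
  · have h1 : 0 < ‖γ 1‖ := (norm_nonneg _).trans_lt (hmono zero_lt_one)
    -- On a ray distances are differences of moduli, `y - x ≥ d / (1 + x)`. Multiplying by `y + x ≥
    -- 2x` and using that `x / (1 + x)` increases gives this constant.
    refine ⟨d * (2 * ‖γ 1‖ / (1 + ‖γ 1‖)), by positivity, fun n => ?_⟩
    have h2 := hgap (n + 1)
    have h3 : ‖γ (n + 1 + 1) - γ (n + 1)‖ = ‖γ (n + 1 + 1)‖ - ‖γ (n + 1)‖ := by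
      have := hmono (n + 1).lt_succ_self
      simp only [Nat.succ_eq_add_one] at this
      rw [hθ (n + 1), hθ (n + 1 + 1), ← sub_mul, norm_mul, Complex.norm_exp_ofReal_mul_I, mul_one,
        ← Complex.ofReal_sub, Complex.norm_real, Real.norm_eq_abs, ← hθ, ← hθ,
        abs_of_pos (by linarith)]
    have h4 : ‖γ 1‖ ≤ ‖γ (n + 1)‖ := hmono.monotone (by omega)
    have h5 : ‖γ (n + 1)‖ < ‖γ (n + 1 + 1)‖ := hmono (n + 1).lt_succ_self
    rw [h3, show (1 : ℝ) - 2 = -1 by norm_num, Real.rpow_neg_one] at h2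
    set x := ‖γ (n + 1)‖
    set y := ‖γ (n + 1 + 1)‖
    have h6 : 2 * ‖γ 1‖ / (1 + ‖γ 1‖) ≤ 2 * x / (1 + x) := by
      rw [div_le_div_iff₀ (by positivity) (by positivity)]; nlinarith
    calc _ ≤ d * (2 * x / (1 + x)) := by gcongr
      _ = d * (1 + x)⁻¹ * (2 * x) := by field_simp
      _ ≤ (y - x) * (y + x) := by
        refine mul_le_mul h2 (by linarith) (by positivity) (by linarith)
      _ = _ := by ring

theorem exists_of_positiveHalf {Λ : Set ℝ} (h : IsSmoothSequence (positiveHalf Λ) 2 D) :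
    ∃ x₀ : ℝ, ∃ t : ℕ → ℝ, IsSquareRegular D t ∧ ∀ x, x ∈ Λ ∧ 0 ≤ x ↔ x = x₀ ∨ ∃ n, x = t n := by
  obtain ⟨γ, hγ, hreg⟩ := h.exists_isSquareRegular
  have key : ∀ n, ∃ x ∈ Λ, 0 ≤ x ∧ γ n = x ∧ ‖γ n‖ = x := by
    intro n
    obtain ⟨x, ⟨h1, h2⟩, h3⟩ : γ n ∈ positiveHalf Λ := hγ ▸ Set.mem_range_self n
    exact ⟨x, h1, h2, h3.symm, by rw [← h3, Complex.norm_real, Real.norm_of_nonneg h2]⟩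
  refine ⟨‖γ 0‖, _, hreg, fun x => ⟨fun ⟨h1, h2⟩ => ?_, fun h => ?_⟩⟩
  · obtain ⟨n, hn⟩ : (x : ℂ) ∈ Set.range γ := hγ ▸ ⟨x, ⟨h1, h2⟩, rfl⟩
    have : x = ‖γ n‖ := by rw [hn, Complex.norm_real, Real.norm_of_nonneg h2]
    cases n with
    | zero => exact Or.inl this
    | succ n => exact Or.inr ⟨n, this⟩
  · rcases h with rfl | ⟨n, rfl⟩
    · obtain ⟨x, h1, h2, -, h4⟩ := key 0
      rw [h4]; exact ⟨h1, h2⟩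
    · obtain ⟨x, h1, h2, -, h4⟩ := key (n + 1)
      rw [h4]; exact ⟨h1, h2⟩

theorem exists_of_negativeHalf {Λ : Set ℝ} (h : IsSmoothSequence (negativeHalf Λ) 2 D) :
    ∃ x₀ : ℝ, ∃ t : ℕ → ℝ, IsSquareRegular D t ∧ ∀ x, x ∈ Λ ∧ x ≤ 0 ↔ x = x₀ ∨ ∃ n, x = -t n := by
  obtain ⟨γ, hγ, hreg⟩ := h.exists_isSquareRegular
  have key : ∀ n, ∃ x ∈ Λ, x ≤ 0 ∧ γ n = x ∧ -‖γ n‖ = x := by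
    intro n
    obtain ⟨x, ⟨h1, h2⟩, h3⟩ : γ n ∈ negativeHalf Λ := hγ ▸ Set.mem_range_self n
    exact ⟨x, h1, h2, h3.symm, by rw [← h3, Complex.norm_real, Real.norm_of_nonpos h2, neg_neg]⟩
  refine ⟨-‖γ 0‖, _, hreg, fun x => ⟨fun ⟨h1, h2⟩ => ?_, fun h => ?_⟩⟩
  · obtain ⟨n, hn⟩ : (x : ℂ) ∈ Set.range γ := hγ ▸ ⟨x, ⟨h1, h2⟩, rfl⟩
    have : x = -‖γ n‖ := by rw [hn, Complex.norm_real, Real.norm_of_nonpos h2, neg_neg]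
    cases n with
    | zero => exact Or.inl this
    | succ n => exact Or.inr ⟨n, this⟩
  · rcases h with rfl | ⟨n, rfl⟩
    · obtain ⟨x, h1, h2, -, h4⟩ := key 0
      rw [h4]; exact ⟨h1, h2⟩
    · obtain ⟨x, h1, h2, -, h4⟩ := key (n + 1)
      rw [h4]; exact ⟨h1, h2⟩

end IsSmoothSequence

/-! ### Schwartz functions from entire functions of Gaussian type. -/

/-- Shifting a horizontal line of integration. -/
theorem integral_eq_integral_add_mul_I {Φ : ℂ → ℂ} (hΦ : Differentiable ℂ Φ) {C ε y : ℝ}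
    (hε : 0 < ε) (h : ∀ z : ℂ, |z.im| ≤ |y| → ‖Φ z‖ ≤ C * Real.exp (-ε * z.re ^ 2)) :
    ∫ x : ℝ, Φ x = ∫ x : ℝ, Φ (x + y * Complex.I) := by
  have hint : ∀ v : ℝ, |v| ≤ |y| →
      MeasureTheory.Integrable fun x : ℝ => Φ (x + v * Complex.I) := by
    intro v hv
    refine ((integrable_exp_neg_mul_sq hε).const_mul C).mono'
      (hΦ.continuous.comp (by fun_prop)).aestronglyMeasurable
      (Filter.Eventually.of_forall fun x => ?_)
    simpa using h (x + v * Complex.I) (by simpa using hv)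
  have hlim : ∀ v : ℝ, |v| ≤ |y| → Filter.Tendsto
      (fun T : ℝ => ∫ x in (-T)..T, Φ (x + v * Complex.I)) Filter.atTop
      (nhds (∫ x : ℝ, Φ (x + v * Complex.I))) := fun v hv =>
    MeasureTheory.intervalIntegral_tendsto_integral (hint v hv) Filter.tendsto_neg_atTop_atBot
      Filter.tendsto_id
  have hC : ∀ T : ℝ, ‖(∫ x in (-T)..T, Φ (x + (0 : ℝ) * Complex.I)) -
      ∫ x in (-T)..T, Φ (x + y * Complex.I)‖ ≤ 2 * (C * |y|) * Real.exp (-ε * T ^ 2) := by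
    intro T
    have h1 := Complex.integral_boundary_rect_eq_zero_of_differentiableOn Φ (-T : ℝ)
      (T + y * Complex.I) hΦ.differentiableOn
    simp only [Complex.ofReal_re, Complex.ofReal_im, Complex.add_re, Complex.add_im,
      Complex.mul_re, Complex.mul_im, Complex.I_re, Complex.I_im, mul_zero, mul_one, sub_zero,
      zero_add, add_zero] at h1
    have h2 : ∀ S : ℝ, S ^ 2 = T ^ 2 → ‖Complex.I • ∫ v in (0 : ℝ)..y, Φ (S + v * Complex.I)‖ ≤
        C * |y| * Real.exp (-ε * T ^ 2) := by
      intro S hS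
      rw [norm_smul, Complex.norm_I, one_mul]
      refine (intervalIntegral.norm_integral_le_of_norm_le_const
        (C := C * Real.exp (-ε * T ^ 2)) fun v hv => ?_).trans (le_of_eq ?_)
      · have h3 : |v| ≤ |y| := by
          have := Set.uIoc_subset_uIcc hv
          rw [Set.mem_uIcc] at this
          rcases this with ⟨h4, h5⟩ | ⟨h4, h5⟩
          · rw [abs_of_nonneg h4]; exact h5.trans (le_abs_self y)
          · rw [abs_of_nonpos h5, abs_of_nonpos (h4.trans h5)]; linarith
        have := h (S + v * Complex.I) (by simpa using h3)
        simpa [hS] using this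
      · rw [sub_zero]; ring
    have h3 := h2 T rfl
    have h4 := h2 (-T) (neg_sq T)
    have h5 : (∫ x in (-T)..T, Φ (x + (0 : ℝ) * Complex.I)) - ∫ x in (-T)..T, Φ (x + y * Complex.I) =
        Complex.I • (∫ v in (0 : ℝ)..y, Φ ((-T : ℝ) + v * Complex.I)) -
          Complex.I • (∫ v in (0 : ℝ)..y, Φ (T + v * Complex.I)) := by
      linear_combination h1
    rw [h5]
    refine (norm_sub_le _ _).trans ?_
    linarith
  have hdec : Filter.Tendsto (fun T : ℝ => 2 * (C * |y|) * Real.exp (-ε * T ^ 2)) Filter.atTop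
      (nhds 0) := by
    rw [← mul_zero (2 * (C * |y|))]
    refine (Real.tendsto_exp_atBot.comp ?_).const_mul _
    exact Filter.Tendsto.const_mul_atTop_of_neg (by linarith)
      (Filter.tendsto_pow_atTop two_ne_zero)
  have h1 := (hlim 0 (by simp)).sub (hlim y le_rfl)
  have h2 := tendsto_nhds_unique h1 (squeeze_zero_norm hC hdec)
  rw [sub_eq_zero] at h2
  simpa using h2

/-- Gaussian decay of the Fourier transform of an entire function. -/
theorem norm_fourier_le_of_entire {F : ℂ → ℂ} (hF : Differentiable ℂ F) {b C ε : ℝ} (hb : 0 < b)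
    (hε : 0 < ε) (h : ∀ z, ‖F z‖ ≤ C * Real.exp (Real.pi / b * z.im ^ 2 - ε * z.re ^ 2)) (ξ : ℝ) :
    ‖𝓕 (fun x : ℝ => F x) ξ‖ ≤
      C * (∫ x : ℝ, Real.exp (-ε * x ^ 2)) * Real.exp (-(b * Real.pi) * ξ ^ 2) := by
  have hpi := Real.pi_pos
  have hC : 0 ≤ C := by
    have := (norm_nonneg _).trans (h 0)
    simpa using this
  set Φ : ℂ → ℂ := fun z => Complex.exp (-2 * Real.pi * ξ * z * Complex.I) * F z with hΦ
  have hnorm : ∀ z, ‖Φ z‖ ≤ C * Real.exp (2 * Real.pi * ξ * z.im + Real.pi / b * z.im ^ 2 +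
      -ε * z.re ^ 2) := by
    intro z
    rw [hΦ, norm_mul, Complex.norm_exp]
    have e1 : (-2 * Real.pi * ξ * z * Complex.I : ℂ).re = 2 * Real.pi * ξ * z.im := by
      rw [Complex.mul_I_re, show (-2 * Real.pi * ξ * z : ℂ) = ((-(2 * Real.pi * ξ) : ℝ) : ℂ) * z by
        push_cast; ring, Complex.im_ofReal_mul]
      ring
    rw [e1]
    calc _ ≤ Real.exp (2 * Real.pi * ξ * z.im) *
          (C * Real.exp (Real.pi / b * z.im ^ 2 - ε * z.re ^ 2)) := by gcongr; exact h z
      _ = C * Real.exp (2 * Real.pi * ξ * z.im + (Real.pi / b * z.im ^ 2 - ε * z.re ^ 2)) := by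
          rw [Real.exp_add]; ring
      _ = _ := by congr 2; ring
  -- The height `-bξ` minimises `2πξy + πy²/b`, with minimum `-bπξ²`.
  have hshift := integral_eq_integral_add_mul_I (Φ := Φ) (by fun_prop) (y := -(b * ξ))
    (C := C * Real.exp (2 * Real.pi * |ξ| * |b * ξ| + Real.pi / b * (b * ξ) ^ 2)) hε (by
      intro z hz
      rw [abs_neg] at hz
      refine (hnorm z).trans ?_
      rw [mul_assoc C, ← Real.exp_add]
      have e1 : ξ * z.im ≤ |ξ| * |b * ξ| := (le_abs_self _).trans (by rw [abs_mul]; gcongr)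
      have e2 : z.im ^ 2 ≤ (b * ξ) ^ 2 := sq_le_sq.2 hz
      refine mul_le_mul_of_nonneg_left (Real.exp_le_exp.2 ?_) hC
      have e3 := mul_le_mul_of_nonneg_left e1 (by positivity : 0 ≤ 2 * Real.pi)
      have e4 := mul_le_mul_of_nonneg_left e2 (by positivity : 0 ≤ Real.pi / b)
      linarith)
  have hfour : 𝓕 (fun x : ℝ => F x) ξ = ∫ x : ℝ, Φ x := by
    rw [Real.fourier_eq']
    refine MeasureTheory.integral_congr_ae (Filter.Eventually.of_forall fun x => ?_)
    simp only [smul_eq_mul, hΦ]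
    congr 2
    rw [show (inner ℝ x ξ : ℝ) = x * ξ by simp [mul_comm]]
    push_cast
    ring
  rw [hfour, hshift]
  refine (MeasureTheory.norm_integral_le_of_norm_le
    (((integrable_exp_neg_mul_sq hε).const_mul C).mul_const (Real.exp (-(b * Real.pi) * ξ ^ 2)))
    (Filter.Eventually.of_forall fun x => ?_)).trans (le_of_eq ?_)
  · refine (hnorm _).trans (le_of_eq ?_)
    rw [mul_assoc C, ← Real.exp_add]
    congr 2
    simp
    field_simp
    ring
  · rw [MeasureTheory.integral_mul_const, MeasureTheory.integral_const_mul]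

theorem iteratedDeriv_comp_ofReal {F : ℂ → ℂ} (hF : Differentiable ℂ F) (n : ℕ) (x : ℝ) :
    iteratedDeriv n (fun x : ℝ => F x) x = iteratedDeriv n F x := by
  induction n generalizing F with
  | zero => simp
  | succ n ih =>
    rw [iteratedDeriv_succ', iteratedDeriv_succ']
    have : deriv (fun x : ℝ => F x) = fun x : ℝ => deriv F x := by
      funext y
      exact (hF y).hasDerivAt.comp_ofReal.deriv
    rw [this]
    exact ih hF.deriv

theorem pow_abs_mul_exp_le {ε : ℝ} (hε : 0 < ε) (k : ℕ) (x : ℝ) :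
    |x| ^ k * Real.exp (-ε * x ^ 2) ≤ k.factorial * Real.exp (1 / (4 * ε)) := by
  have h1 := Real.pow_div_factorial_le_exp |x| (abs_nonneg x) k
  rw [div_le_iff₀ (by positivity)] at h1
  calc _ ≤ Real.exp |x| * k.factorial * Real.exp (-ε * x ^ 2) := by gcongr
    _ = k.factorial * Real.exp (|x| + -ε * x ^ 2) := by rw [Real.exp_add]; ring
    _ ≤ _ := by
      gcongr
      rw [← sq_abs x]
      have : 1 / (4 * ε) - (|x| + -ε * |x| ^ 2) = (2 * ε * |x| - 1) ^ 2 / (4 * ε) := by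
        field_simp; ring
      have h2 : 0 ≤ (2 * ε * |x| - 1) ^ 2 / (4 * ε) := by positivity
      linarith

/-- The Schwartz function obtained by restricting an entire function of Gaussian type. -/
def SchwartzMap.ofEntire (F : ℂ → ℂ) (hF : Differentiable ℂ F)
    (h : ∃ C q ε : ℝ, 0 < q ∧ 0 < ε ∧ ∀ z, ‖F z‖ ≤ C * Real.exp (q * z.im ^ 2 - ε * z.re ^ 2)) :
    𝓢(ℝ, ℂ) where
  toFun x := F x
  smooth' := (hF.contDiff.restrict_scalars ℝ).comp Complex.ofRealCLM.contDiff
  decay' := by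
    obtain ⟨C, q, ε, hq, hε, hb⟩ := h
    have hC : 0 ≤ C := by
      have := (norm_nonneg _).trans (hb 0)
      simpa using this
    intro k n
    refine ⟨n.factorial * (C * Real.exp (q + ε)) * (k.factorial * Real.exp (1 / (4 * (ε / 2)))),
      fun x => ?_⟩
    rw [norm_iteratedFDeriv_eq_norm_iteratedDeriv, iteratedDeriv_comp_ofReal hF, Real.norm_eq_abs]
    -- Cauchy's estimate on unit circles; half of the Gaussian rate survives the displacement and
    -- dominates every power of `|x|`.
    have h1 := Complex.norm_iteratedDeriv_le_of_forall_mem_sphere_norm_le (f := F) (c := x) n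
      one_pos (C := C * Real.exp (q + ε) * Real.exp (-(ε / 2) * x ^ 2))
      hF.diffContOnCl (fun z hz => by
        rw [mem_sphere_iff_norm] at hz
        refine (hb z).trans ?_
        rw [mul_assoc, ← Real.exp_add]
        have e1 := Complex.abs_im_le_norm (z - x)
        have e2 := Complex.abs_re_le_norm (z - x)
        rw [hz] at e1 e2
        simp only [Complex.sub_im, Complex.sub_re, Complex.ofReal_im, Complex.ofReal_re,
          sub_zero] at e1 e2
        have e3 : z.im ^ 2 ≤ 1 := by rwa [sq_le_one_iff_abs_le_one]
        have e4 : (z.re - x) ^ 2 ≤ 1 := by rwa [sq_le_one_iff_abs_le_one]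
        have e5 : x ^ 2 / 2 - 1 ≤ z.re ^ 2 := by nlinarith [sq_nonneg (2 * z.re - x)]
        refine mul_le_mul_of_nonneg_left (Real.exp_le_exp.2 ?_) hC
        have e6 := mul_le_mul_of_nonneg_left e3 hq.le
        have e7 := mul_le_mul_of_nonneg_left e5 hε.le
        linarith)
    rw [one_pow, div_one] at h1
    calc _ ≤ |x| ^ k * (n.factorial * (C * Real.exp (q + ε) * Real.exp (-(ε / 2) * x ^ 2))) := by
          gcongr
      _ = n.factorial * (C * Real.exp (q + ε)) * (|x| ^ k * Real.exp (-(ε / 2) * x ^ 2)) := by ring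
      _ ≤ _ := mul_le_mul_of_nonneg_left (pow_abs_mul_exp_le (by positivity) k x) (by positivity)

@[simp]
theorem SchwartzMap.ofEntire_apply (F : ℂ → ℂ) (hF : Differentiable ℂ F) (h) (x : ℝ) :
    SchwartzMap.ofEntire F hF h x = F x := rfl

/-! ### Interpolation with a generating function. -/

open scoped BoundedContinuousFunction

section Interpolation

variable {ι : Type*} [TopologicalSpace ι]

theorem BoundedContinuousFunction.norm_mul_le_of_norm_le {φ : ι → ℂ} {u : ι → ℝ} {w : ℝ}
    (h : ∀ i, ‖φ i‖ ≤ u i * w) (α : ι →ᵇ ℂ) (i : ι) : ‖α i * φ i‖ ≤ u i * (‖α‖ * w) := by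
  rw [norm_mul]
  calc _ ≤ ‖α‖ * (u i * w) :=
        mul_le_mul (α.norm_coe_le_norm i) (h i) (norm_nonneg _) (norm_nonneg _)
    _ = _ := by ring

/-- Superpositions of entire functions of Gaussian type with bounded coefficients. -/
theorem SchwartzMap.exists_linearMap_tsum {φ : ι → ℂ → ℂ} (hφ : ∀ i, Differentiable ℂ (φ i))
    {u : ι → ℝ} (hu : Summable u) {b ε : ℝ} (hb : 0 < b) (hε : 0 < ε)
    (h : ∀ i z, ‖φ i z‖ ≤ u i * Real.exp (Real.pi / b * z.im ^ 2 - ε * z.re ^ 2)) :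
    ∃ T : (ι →ᵇ ℂ) →ₗ[ℂ] 𝓢(ℝ, ℂ), (∀ α (x : ℝ), T α x = ∑' i, α i * φ i x) ∧
      (∀ α (x w : ℝ), (∀ i, ‖φ i x‖ ≤ u i * w) → ‖T α x‖ ≤ (∑' i, u i) * ‖α‖ * w) ∧
      ∀ α ξ, ‖𝓕 (T α : ℝ → ℂ) ξ‖ ≤ (∑' i, u i) * ‖α‖ * (∫ x : ℝ, Real.exp (-ε * x ^ 2)) *
        Real.exp (-(b * Real.pi) * ξ ^ 2) := by
  have hpi := Real.pi_pos
  have hu0 : ∀ i, 0 ≤ u i := fun i => by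
    have := (norm_nonneg _).trans (h i 0)
    simpa using this
  have hsum : ∀ (α : ι →ᵇ ℂ) z, Summable fun i => α i * φ i z := fun α z =>
    (hu.mul_right _).of_norm_bounded (α.norm_mul_le_of_norm_le fun i => h i z)
  have hle : ∀ (α : ι →ᵇ ℂ) (z : ℂ) (w : ℝ), (∀ i, ‖φ i z‖ ≤ u i * w) →
      ‖∑' i, α i * φ i z‖ ≤ (∑' i, u i) * ‖α‖ * w := fun α z w hw => by
    rw [mul_assoc, ← tsum_mul_right]
    exact tsum_of_norm_bounded (hu.mul_right _).hasSum (α.norm_mul_le_of_norm_le hw)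
  have hdiff : ∀ α : ι →ᵇ ℂ, Differentiable ℂ fun z => ∑' i, α i * φ i z := by
    intro α z
    refine (Complex.differentiableOn_tsum_of_summable_norm (U := Metric.ball 0 (‖z‖ + 1))
      (u := fun i => u i * (‖α‖ * Real.exp (Real.pi / b * (‖z‖ + 1) ^ 2))) (hu.mul_right _)
      (fun i => ((hφ i).const_mul (α i)).differentiableOn) Metric.isOpen_ball
      fun i w hw => ?_).differentiableAt (Metric.isOpen_ball.mem_nhds (by simp))
    refine α.norm_mul_le_of_norm_le (φ := fun i => φ i w) (fun i => (h i w).trans ?_) i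
    rw [mem_ball_zero_iff] at hw
    have h1 : w.im ^ 2 ≤ (‖z‖ + 1) ^ 2 :=
      sq_le_sq.2 ((Complex.abs_im_le_norm w).trans (hw.le.trans (le_abs_self _)))
    have h2 := mul_le_mul_of_nonneg_left h1 (by positivity : 0 ≤ Real.pi / b)
    have h3 := mul_nonneg hε.le (sq_nonneg w.re)
    exact mul_le_mul_of_nonneg_left (Real.exp_le_exp.2 (by linarith)) (hu0 i)
  refine ⟨{ toFun := fun α => SchwartzMap.ofEntire _ (hdiff α)
              ⟨_, Real.pi / b, ε, by positivity, hε, fun z => hle α z _ fun i => h i z⟩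
            map_add' := fun α β => ?_
            map_smul' := fun c α => ?_ }, fun α x => rfl, fun α x w hw => hle α x w hw,
    fun α ξ => norm_fourier_le_of_entire (hdiff α) hb hε (fun z => hle α z _ fun i => h i z) ξ⟩
  · ext x
    simp only [SchwartzMap.ofEntire_apply, add_apply, BoundedContinuousFunction.add_apply,
      add_mul]
    exact (hsum α x).tsum_add (hsum β x)
  · ext x
    simp only [SchwartzMap.ofEntire_apply, smul_apply,
      BoundedContinuousFunction.smul_apply, smul_eq_mul, RingHom.id_apply, mul_assoc]
    exact tsum_mul_left

end Interpolation

/-- The difference of the two sides is a quadratic form in `|x|, |y|` with diagonal `P = aπ - 2ε`,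
`Q = π/b - aπ - ε` and cross coefficient `-2πD`. It is nonnegative once `P > 0` and `(πD)² ≤ PQ`; at
`ε = 0` strict inequality is the density hypothesis, so it persists for small `ε`. -/
theorem exists_quadratic_form_bound {a b D δ : ℝ} (ha : 0 < a) (hD : D ^ 2 < a * (1 / b - a))
    (hδ : 0 < δ) : ∃ ε, 0 < ε ∧ ε < δ ∧ ∀ x y : ℝ,
      -(a * Real.pi) * (x ^ 2 - y ^ 2) + (2 * Real.pi * D * (|x| * |y|) + ε * (x ^ 2 + y ^ 2)) ≤
        Real.pi / b * y ^ 2 - ε * x ^ 2 := by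
  have hpi := Real.pi_pos
  have h1 : ∀ᶠ ε in nhdsWithin (0 : ℝ) (Set.Ioi 0), ε < δ :=
    (gt_mem_nhds hδ : ∀ᶠ ε in nhds (0 : ℝ), ε < δ).filter_mono nhdsWithin_le_nhds
  have h2 : ∀ᶠ ε in nhdsWithin (0 : ℝ) (Set.Ioi 0), 0 < a * Real.pi - 2 * ε := by
    refine ((show ContinuousAt (fun ε : ℝ => a * Real.pi - 2 * ε) 0 by fun_prop).eventually
      (lt_mem_nhds ?_)).filter_mono nhdsWithin_le_nhds
    simp; positivity
  have h3 : ∀ᶠ ε in nhdsWithin (0 : ℝ) (Set.Ioi 0), (Real.pi * D) ^ 2 <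
      (a * Real.pi - 2 * ε) * (Real.pi / b - a * Real.pi - ε) := by
    refine ((show ContinuousAt (fun ε : ℝ => (a * Real.pi - 2 * ε) *
      (Real.pi / b - a * Real.pi - ε)) 0 by fun_prop).eventually (lt_mem_nhds ?_)).filter_mono nhdsWithin_le_nhds
    have := mul_lt_mul_of_pos_left hD (pow_pos hpi 2)
    calc _ = Real.pi ^ 2 * D ^ 2 := by ring
      _ < _ := this
      _ = _ := by ring
  obtain ⟨ε, h4, h5, h6, h7⟩ := (h1.and (h2.and (h3.and self_mem_nhdsWithin))).exists
  refine ⟨ε, h7, h4, fun x y => ?_⟩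
  rw [← sq_abs x, ← sq_abs y]
  set P := a * Real.pi - 2 * ε
  set Q := Real.pi / b - a * Real.pi - ε
  have h8 : 0 ≤ P * (P * |x| ^ 2 + Q * |y| ^ 2 - 2 * (Real.pi * D) * (|x| * |y|)) := by
    have e1 : P * (P * |x| ^ 2 + Q * |y| ^ 2 - 2 * (Real.pi * D) * (|x| * |y|)) =
      (P * |x| - Real.pi * D * |y|) ^ 2 + (P * Q - (Real.pi * D) ^ 2) * |y| ^ 2 := by ring
    rw [e1]
    have : 0 ≤ P * Q - (Real.pi * D) ^ 2 := by linarith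
    positivity
  have h9 := nonneg_of_mul_nonneg_right h8 h5
  simp only [P, Q] at h9
  linarith

/-- `G` is a generating function of type `D` for the real nodes `x`. -/
structure IsGenerating {ι : Type*} (D : ℝ) (x : ι → ℝ) (G : ℂ → ℂ) : Prop where
  density_pos : 0 < D
  injective : Function.Injective x
  differentiable : Differentiable ℂ G
  apply_eq_zero : ∀ i, G (x i) = 0
  norm_le : ∀ ε > 0, ∃ C, ∀ z,
    ‖G z‖ ≤ C * Real.exp (2 * Real.pi * D * (|z.re| * |z.im|) + ε * ‖z‖ ^ 2)
  le_norm_deriv : ∀ ε > 0, ∃ c > 0, ∀ i, c * Real.exp (-ε * x i ^ 2) ≤ ‖deriv G (x i)‖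
  summable : ∀ ε > 0, Summable fun i => Real.exp (-ε * x i ^ 2)

namespace IsGenerating

variable {ι : Type*} {D : ℝ} {x : ι → ℝ} {G : ℂ → ℂ}

theorem differentiable_dslope (hG : IsGenerating D x G) (i : ι) :
    Differentiable ℂ (dslope G (x i)) :=
  differentiableOn_univ.1 ((Complex.differentiableOn_dslope Filter.univ_mem).2
    hG.differentiable.differentiableOn)

/-- Dividing by `z - x i` does not increase `G` at distance at least 1 from the node. Closer in, the
maximum principle on a disk of radius 2 about `z` applies, since its boundary is at distance at
least 1 from the node. Hence the constant is uniform in `i`. -/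
theorem norm_dslope_le (hG : IsGenerating D x G) {ε : ℝ} (hε : 0 < ε) : ∃ C > 0, ∀ i z,
    ‖dslope G (x i) z‖ ≤ C * Real.exp (2 * Real.pi * D * (|z.re| * |z.im|) + ε * ‖z‖ ^ 2) := by
  have hpi := Real.pi_pos
  have hD := hG.density_pos
  obtain ⟨C, hC⟩ := hG.norm_le (ε / 4) (by positivity)
  have hC0 : 0 ≤ C := by
    have := (norm_nonneg _).trans (hC 0)
    simpa using this
  set N := 8 * Real.pi * D with hN
  set M := N + 2 * ε + N ^ 2 / (2 * ε) with hM
  have hnear : ∀ z w : ℂ, ‖w - z‖ ≤ 2 → ‖G w‖ ≤ (C + 1) * Real.exp M *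
      Real.exp (2 * Real.pi * D * (|z.re| * |z.im|) + ε * ‖z‖ ^ 2) := by
    intro z w hw
    refine (hC w).trans ?_
    rw [mul_assoc (C + 1), ← Real.exp_add]
    refine mul_le_mul (by linarith) (Real.exp_le_exp.2 ?_) (Real.exp_pos _).le (by linarith)
    have e1 : |w.re| ≤ |z.re| + 2 := by
      have h1 := (Complex.abs_re_le_norm (w - z)).trans hw
      have h2 := abs_add_le z.re (w - z).re
      rw [Complex.sub_re, add_sub_cancel] at h2
      rw [Complex.sub_re] at h1
      linarith
    have e2 : |w.im| ≤ |z.im| + 2 := by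
      have h1 := (Complex.abs_im_le_norm (w - z)).trans hw
      have h2 := abs_add_le z.im (w - z).im
      rw [Complex.sub_im, add_sub_cancel] at h2
      rw [Complex.sub_im] at h1
      linarith
    have e3 : ‖w‖ ≤ ‖z‖ + 2 := by
      have := norm_add_le z (w - z)
      rw [add_sub_cancel] at this
      linarith
    have e4 : |w.re| * |w.im| ≤ |z.re| * |z.im| + 4 * ‖z‖ + 4 := by
      calc _ ≤ (|z.re| + 2) * (|z.im| + 2) := by gcongr
        _ ≤ _ := by linarith [Complex.abs_re_le_norm z, Complex.abs_im_le_norm z]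
    have e5 : ‖w‖ ^ 2 ≤ 2 * ‖z‖ ^ 2 + 8 := by
      calc _ ≤ (‖z‖ + 2) ^ 2 := by gcongr
        _ ≤ _ := by linarith [sq_nonneg (‖z‖ - 2)]
    have e6 : N * ‖z‖ ≤ ε / 2 * ‖z‖ ^ 2 + N ^ 2 / (2 * ε) := by
      have e7 : ε / 2 * ‖z‖ ^ 2 + N ^ 2 / (2 * ε) - N * ‖z‖ = (ε * ‖z‖ - N) ^ 2 / (2 * ε) := by
        field_simp; ring
      have e8 : 0 ≤ (ε * ‖z‖ - N) ^ 2 / (2 * ε) := by positivity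
      linarith
    have e7 := mul_le_mul_of_nonneg_left e4 (by positivity : 0 ≤ 2 * Real.pi * D)
    have e8 := mul_le_mul_of_nonneg_left e5 (by positivity : 0 ≤ ε / 4)
    rw [hM]
    linarith
  refine ⟨(C + 1) * Real.exp M, by positivity, fun i z => ?_⟩
  have hfar : ∀ w : ℂ, 1 ≤ ‖w - x i‖ → ‖dslope G (x i) w‖ ≤ ‖G w‖ := by
    intro w hw
    have hne : w ≠ x i := by
      rintro rfl
      simp at hw
      linarith
    rw [dslope_of_ne _ hne, slope_def_field, hG.apply_eq_zero, sub_zero, norm_div]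
    exact div_le_self (norm_nonneg _) hw
  rcases le_or_gt 1 ‖z - x i‖ with h | h
  · exact (hfar z h).trans (hnear z z (by simp))
  · refine Complex.norm_le_of_forall_mem_frontier_norm_le (U := Metric.ball z 2)
      Metric.isBounded_ball (hG.differentiable_dslope i).diffContOnCl (fun w hw => ?_)
      (subset_closure (Metric.mem_ball_self two_pos))
    rw [frontier_ball _ two_ne_zero, mem_sphere_iff_norm] at hw
    refine (hfar w ?_).trans (hnear z w hw.le)
    have := norm_sub_le (w - x i) (z - x i)
    rw [sub_sub_sub_cancel_right, hw] at this
    linarith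

/-- Interpolation at the nodes by functions with prescribed Gaussian decay. -/
theorem exists_interpolation [TopologicalSpace ι] (hG : IsGenerating D x G)
    {a a₀ b : ℝ} (ha : 0 < a) (hb : 0 < b) (haa : a < a₀) (hD : D ^ 2 < a * (1 / b - a)) :
    ∃ T : (ι →ᵇ ℂ) →ₗ[ℂ] 𝓢(ℝ, ℂ), ∃ C ≥ 0,
      (∀ α y, ‖T α y‖ ≤ C * ‖α‖ * Real.exp (-(a * Real.pi) * y ^ 2)) ∧
      (∀ α ξ, ‖𝓕 (T α : ℝ → ℂ) ξ‖ ≤ C * ‖α‖ * Real.exp (-(b * Real.pi) * ξ ^ 2)) ∧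
      ∀ α i, T α (x i) = Real.exp (-(a₀ * Real.pi) * x i ^ 2) * α i := by
  classical
  have hpi := Real.pi_pos
  -- The kernels carry `exp(-a₁πz²)`. The room between `a` and `a₁` absorbs the `ε`-growth of `G` on
  -- the real line; the room between `a₁` and `a₀` pays for `1 / G'(x i)` and for summability over
  -- the nodes.
  obtain ⟨a₁, h1, h2, h3⟩ : ∃ a₁, a < a₁ ∧ a₁ < a₀ ∧ D ^ 2 < a₁ * (1 / b - a₁) := by
    have e1 : ∀ᶠ a₁ in nhdsWithin a (Set.Ioi a), a₁ < a₀ :=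
      (gt_mem_nhds haa).filter_mono nhdsWithin_le_nhds
    have e2 : ∀ᶠ a₁ in nhdsWithin a (Set.Ioi a), D ^ 2 < a₁ * (1 / b - a₁) :=
      ((show ContinuousAt (fun a₁ : ℝ => a₁ * (1 / b - a₁)) a by fun_prop).eventually
        (lt_mem_nhds hD)).filter_mono nhdsWithin_le_nhds
    obtain ⟨a₁, h1, h2, h3⟩ := (e1.and (e2.and self_mem_nhdsWithin)).exists
    exact ⟨a₁, h3, h1, h2⟩
  obtain ⟨ε, hε, hε1, hq⟩ := exists_quadratic_form_bound (ha.trans h1) h3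
    (mul_pos (sub_pos.2 h1) hpi)
  obtain ⟨C, hC, hslope⟩ := hG.norm_dslope_le hε
  set δ := (a₀ - a₁) * Real.pi / 2 with hδ
  have hδ0 : 0 < δ := half_pos (mul_pos (sub_pos.2 h2) hpi)
  obtain ⟨c, hc, hder⟩ := hG.le_norm_deriv δ hδ0
  have hder0 : ∀ i, deriv G (x i) ≠ 0 := fun i =>
    norm_pos_iff.1 (lt_of_lt_of_le (by positivity) (hder i))
  set κ : ι → ℂ := fun i => Real.exp (-(2 * δ) * x i ^ 2) / deriv G (x i) with hκ
  have hκle : ∀ i, ‖κ i‖ ≤ 1 / c * Real.exp (-δ * x i ^ 2) := by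
    intro i
    rw [hκ, norm_div, Complex.norm_real, Real.norm_of_nonneg (Real.exp_pos _).le,
      div_le_iff₀ (norm_pos_iff.2 (hder0 i))]
    calc _ = 1 / c * Real.exp (-δ * x i ^ 2) * (c * Real.exp (-δ * x i ^ 2)) := by
          rw [show -(2 * δ) * x i ^ 2 = -δ * x i ^ 2 + -δ * x i ^ 2 by ring, Real.exp_add]
          field_simp
      _ ≤ _ := mul_le_mul_of_nonneg_left (hder i) (by positivity)
  set φ : ι → ℂ → ℂ := fun i z => κ i * (Complex.exp (-(a₁ * Real.pi) * z ^ 2) * dslope G (x i) z)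
    with hφ
  set u : ι → ℝ := fun i => 1 / c * Real.exp (-δ * x i ^ 2) * C with hu
  have hφle : ∀ i z, ‖φ i z‖ ≤ u i * Real.exp (-(a₁ * Real.pi) * (z.re ^ 2 - z.im ^ 2) +
      (2 * Real.pi * D * (|z.re| * |z.im|) + ε * (z.re ^ 2 + z.im ^ 2))) := by
    intro i z
    have e1 : (-(a₁ * Real.pi) * z ^ 2 : ℂ).re = -(a₁ * Real.pi) * (z.re ^ 2 - z.im ^ 2) := by
      rw [show (-(a₁ * Real.pi) * z ^ 2 : ℂ) = ((-(a₁ * Real.pi) : ℝ) : ℂ) * z ^ 2 by push_cast; rfl,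
        Complex.re_ofReal_mul, sq z, Complex.mul_re]
      ring
    have e2 : ‖z‖ ^ 2 = z.re ^ 2 + z.im ^ 2 := by rw [Complex.sq_norm, Complex.normSq_apply]; ring
    have e3 := hslope i z
    rw [e2] at e3
    rw [hφ, norm_mul, norm_mul, Complex.norm_exp, e1, Real.exp_add]
    calc _ ≤ 1 / c * Real.exp (-δ * x i ^ 2) * (Real.exp (-(a₁ * Real.pi) * (z.re ^ 2 - z.im ^ 2)) *
          (C * Real.exp (2 * Real.pi * D * (|z.re| * |z.im|) + ε * (z.re ^ 2 + z.im ^ 2)))) := by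
          gcongr; exact hκle i
      _ = _ := by rw [hu]; ring
  have hu0 : ∀ i, 0 ≤ u i := fun i => by positivity
  obtain ⟨T, hT, hTle, hTF⟩ := SchwartzMap.exists_linearMap_tsum (φ := φ) (fun i => by
      have := hG.differentiable_dslope i
      fun_prop) (u := u)
    (((hG.summable δ hδ0).mul_left _).mul_right _) hb hε
    (fun i z => (hφle i z).trans (mul_le_mul_of_nonneg_left (Real.exp_le_exp.2 (hq _ _)) (hu0 i)))
  set I := ∫ y : ℝ, Real.exp (-ε * y ^ 2)
  have hI : 0 ≤ I := MeasureTheory.integral_nonneg fun y => (Real.exp_pos _).le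
  have hS : 0 ≤ ∑' i, u i := tsum_nonneg hu0
  refine ⟨T, (∑' i, u i) * (1 + I), by positivity, fun α y => ?_, fun α ξ => ?_, fun α i => ?_⟩
  · refine (hTle α y (Real.exp (-(a * Real.pi) * y ^ 2)) fun i => ?_).trans ?_
    · refine (hφle i y).trans (mul_le_mul_of_nonneg_left (Real.exp_le_exp.2 ?_) (hu0 i))
      simp only [Complex.ofReal_re, Complex.ofReal_im, abs_zero, mul_zero, zero_add]
      have := mul_le_mul_of_nonneg_right hε1.le (sq_nonneg y)
      linarith
    · gcongr
      exact le_mul_of_one_le_right hS (by linarith)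
  · refine (hTF α ξ).trans ?_
    rw [mul_right_comm _ ‖α‖]
    gcongr
    linarith
  · rw [hT, tsum_eq_single i]
    · simp only [hφ, hκ, dslope_same]
      have := hder0 i
      rw [show -(a₀ * Real.pi) * x i ^ 2 = -(2 * δ) * x i ^ 2 + -(a₁ * Real.pi) * x i ^ 2 by
        rw [hδ]; ring, Real.exp_add]
      push_cast
      field_simp
    · intro j hj
      have hne : (x i : ℂ) ≠ x j := fun h => hj (hG.injective (Complex.ofReal_injective h)).symm
      simp only [hφ]
      rw [dslope_of_ne _ hne, slope_def_field, hG.apply_eq_zero, hG.apply_eq_zero]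
      simp

end IsGenerating

/-! ### Generating functions with spare nodes. -/

namespace IsSquareRegular

variable {D ρ : ℝ} {t t' q q' : ℕ → ℝ}

theorem summable_exp_neg (ht : IsSquareRegular D t) {ε : ℝ} (hε : 0 < ε) :
    Summable fun n => Real.exp (-ε * t n ^ 2) := by
  obtain ⟨c, hc, h⟩ := ht.exists_lower
  refine Summable.of_nonneg_of_le (fun n => (Real.exp_pos _).le) (fun n => ?_)
    (Real.summable_exp_nat_mul_iff.2 (by nlinarith : -ε * c < 0))
  have h1 := mul_le_mul_of_nonneg_left (h n) hε.le
  have h2 := mul_pos hε hc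
  exact Real.exp_le_exp.2 (by linarith)

theorem injective (ht : IsSquareRegular D t) : Function.Injective t := by
  obtain ⟨d, hd, h⟩ := ht.exists_separated
  intro m n hmn
  have h1 := h m n
  rw [hmn, sub_self, abs_zero] at h1
  have h2 : |(n : ℝ) - m| ≤ 0 := le_of_mul_le_mul_left (by simpa using h1) hd
  have h3 := abs_eq_zero.1 (le_antisymm h2 (abs_nonneg _))
  exact_mod_cast (sub_eq_zero.1 h3).symm

/-- A regular sequence of any density whose squares stay away from those of a given one. -/
theorem exists_far (ht : IsSquareRegular D t) (hρ : 0 < ρ) :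
    ∃ q, IsSquareRegular ρ q ∧ ∃ δ > 0, ∀ m n, δ ≤ |q m ^ 2 - t n ^ 2| := by
  obtain ⟨d₀, hd₀, hsep₀⟩ := ht.exists_separated
  set d := min d₀ (1 / ρ) with hd
  have hd0 : 0 < d := lt_min hd₀ (by positivity)
  have hsep : ∀ m n, m ≠ n → d ≤ |t n ^ 2 - t m ^ 2| := by
    intro m n hmn
    refine ((min_le_left _ _).trans ?_).trans (hsep₀ m n)
    have : (1 : ℤ) ≤ |(n : ℤ) - m| := Int.one_le_abs (sub_ne_zero.2 (by exact_mod_cast hmn.symm))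
    exact le_mul_of_one_le_right hd₀.le (by exact_mod_cast this)
  -- If `p` is within `d / 4` of some square, then `p + d / 2` lies between `d / 4` and `3d / 4`
  -- beyond it, hence more than `d / 4` from all the others, which are `d`-separated from it.
  have key : ∀ p : ℝ, ∃ κ, p ≤ κ ∧ κ ≤ p + d / 2 ∧ ∀ n, d / 4 ≤ |κ - t n ^ 2| := by
    intro p
    by_cases h : ∀ n, d / 4 ≤ |p - t n ^ 2|
    · exact ⟨p, le_rfl, by linarith, h⟩
    push Not at h
    obtain ⟨m, hm⟩ := h
    refine ⟨p + d / 2, by linarith, le_rfl, fun n => ?_⟩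
    by_contra! hn
    rw [abs_lt] at hm hn
    by_cases hmn : m = n
    · subst hmn; linarith
    · have := hsep m n hmn
      rcases le_abs.1 this with h | h <;> linarith
  choose κ h1 h2 h3 using fun k : ℕ => key ((k + 1) / ρ)
  have hκ : ∀ k, 0 < κ k := fun k => lt_of_lt_of_le (by positivity) (h1 k)
  have hq : ∀ k, √(κ k) ^ 2 = κ k := fun k => Real.sq_sqrt (hκ k).le
  refine ⟨fun k => √(κ k), ⟨hρ, fun k => Real.sqrt_pos.2 (hκ k), ⟨d / 2, fun k => ?_⟩,
    ⟨d / 2, by positivity, fun k => ?_⟩⟩, d / 4, by positivity, fun m n => ?_⟩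
  · rw [hq, abs_le]
    constructor <;> linarith [h1 k, h2 k]
  · rw [hq, hq]
    have e1 := h1 (k + 1)
    have e2 := h2 k
    have e3 : d ≤ 1 / ρ := min_le_right _ _
    have e4 : (((k + 1 : ℕ) : ℝ) + 1) / ρ = (k + 1) / ρ + 1 / ρ := by push_cast; field_simp
    linarith
  · rw [hq]; exact h3 m n

/-- At a zero of the first factor only one term of the product rule survives, and the uniform
distance `δ` bounds the second factor from below. Losses `exp(-K t k)` are absorbed by `exp(-ε t k ^
2)`. -/
theorem le_norm_deriv_mul_canonicalProduct (ht : IsSquareRegular D t) (ht' : IsSquareRegular D t')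
    (hq : IsSquareRegular ρ q) (hq' : IsSquareRegular ρ q') {δ : ℝ} (hδ : 0 < δ)
    (h : ∀ m n, δ ≤ |q m ^ 2 - t n ^ 2|) {ε : ℝ} (hε : 0 < ε) : ∃ c > 0, ∀ k,
      c * Real.exp (-ε * t k ^ 2) ≤
        ‖deriv (fun z => canonicalProduct D t t' z * canonicalProduct ρ q q' z) (t k)‖ := by
  obtain ⟨c₁, hc₁, K₁, hK₁, h₁⟩ := ht.le_norm_deriv_canonicalProduct ht'
  obtain ⟨c₂, hc₂, K₂, hK₂, h₂⟩ := hq.le_norm_canonicalProduct hq'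
  refine ⟨c₁ * (c₂ * δ) * Real.exp (-((K₁ + K₂) ^ 2 / (4 * ε))), by positivity, fun k => ?_⟩
  have e1 : deriv (fun z => canonicalProduct D t t' z * canonicalProduct ρ q q' z) (t k) =
      deriv (canonicalProduct D t t') (t k) * canonicalProduct ρ q q' (t k) := by
    have := ((ht.differentiable_canonicalProduct ht' (t k)).hasDerivAt.mul
      (hq.differentiable_canonicalProduct hq' (t k)).hasDerivAt).deriv
    rw [ht.canonicalProduct_eq_zero ht', zero_mul, add_zero] at this
    exact this
  have e2 := h₂ (t k) (by simpa using (ht.pos k).le)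
    (by rw [← Complex.ofReal_pow, Complex.ofReal_re]; positivity) δ fun n => by
      rw [← Complex.ofReal_pow, ← Complex.ofReal_pow, ← Complex.ofReal_sub, Complex.norm_real]
      exact h n k
  rw [← Complex.ofReal_pow, Complex.ofReal_im, abs_zero, mul_zero, zero_sub, Complex.norm_real,
    Real.norm_of_nonneg (ht.pos k).le] at e2
  rw [e1, norm_mul]
  refine le_trans ?_ (mul_le_mul (h₁ k) e2 (by positivity) (norm_nonneg _))
  calc _ = c₁ * (c₂ * δ) * Real.exp (-((K₁ + K₂) ^ 2 / (4 * ε)) + -ε * t k ^ 2) := by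
        rw [Real.exp_add]; ring
    _ ≤ c₁ * (c₂ * δ) * Real.exp (-K₁ * t k + -(K₂ * t k)) := by
        refine mul_le_mul_of_nonneg_left (Real.exp_le_exp.2 ?_) (by positivity)
        have e3 : (K₁ + K₂) ^ 2 / (4 * ε) + ε * t k ^ 2 - (K₁ + K₂) * t k =
            (2 * ε * t k - (K₁ + K₂)) ^ 2 / (4 * ε) := by field_simp; ring
        have e4 : 0 ≤ (2 * ε * t k - (K₁ + K₂)) ^ 2 / (4 * ε) := by positivity
        linarith
    _ = _ := by rw [Real.exp_add]; ring

/-- The leftover density `D' - D` is filled by a second canonical product whose zeros avoid the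
given ones. Its positive zeros `q` become free nodes; its negative ones only keep the growth
balanced. -/
theorem exists_isGenerating (ht : IsSquareRegular D t) (ht' : IsSquareRegular D t') {D' : ℝ}
    (hD : D < D') : ∃ (q : ℕ → ℝ) (G : ℂ → ℂ),
      IsGenerating D' (Sum.elim (Sum.elim t fun n => -t' n) q) G := by
  have hpi := Real.pi_pos
  have hρ : 0 < D' - D := sub_pos.2 hD
  obtain ⟨q, hq, δ, hδ, hqt⟩ := ht.exists_far hρ
  obtain ⟨q', hq', δ', hδ', hqt'⟩ := ht'.exists_far hρ
  set G : ℂ → ℂ := fun z => canonicalProduct D t t' z * canonicalProduct (D' - D) q q' z with hG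
  have hGneg : ∀ z, G z = canonicalProduct D t' t (-z) * canonicalProduct (D' - D) q' q (-z) :=
    fun z => by rw [canonicalProduct_neg, canonicalProduct_neg]
  refine ⟨q, G, ⟨ht.density_pos.trans hD, ?_, ?_, ?_, ?_, ?_, ?_⟩⟩
  · refine Function.Injective.sumElim (Function.Injective.sumElim ht.injective
      (neg_injective.comp ht'.injective) fun m n h => ?_) hq.injective fun m n h => ?_
    · have := ht.pos m; have := ht'.pos n; linarith
    · rcases m with m | m
      · have h1 := hqt n m
        simp only [Sum.elim_inl] at h
        rw [h, sub_self, abs_zero] at h1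
        linarith
      · have := hq.pos n; have := ht'.pos m
        simp only [Sum.elim_inr] at h
        linarith
  · exact (ht.differentiable_canonicalProduct ht').mul (hq.differentiable_canonicalProduct hq')
  · rintro ((n | n) | n)
    · simp [hG, ht.canonicalProduct_eq_zero ht']
    · simp [hGneg, ht'.canonicalProduct_eq_zero ht]
    · simp [hG, hq.canonicalProduct_eq_zero hq']
  · intro ε hε
    obtain ⟨C₁, hC₁, K₁, hK₁, h₁⟩ := ht.norm_canonicalProduct_le ht'
    obtain ⟨C₂, hC₂, K₂, hK₂, h₂⟩ := hq.norm_canonicalProduct_le hq'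
    refine ⟨C₁ * C₂ * Real.exp ((K₁ + K₂) ^ 2 / (4 * ε)), fun z => ?_⟩
    rw [hG, norm_mul]
    refine (mul_le_mul (h₁ z) (h₂ z) (norm_nonneg _) (by positivity)).trans ?_
    calc _ = C₁ * C₂ * Real.exp ((Real.pi * D * |(z ^ 2).im| + K₁ * ‖z‖) +
          (Real.pi * (D' - D) * |(z ^ 2).im| + K₂ * ‖z‖)) := by
          rw [Real.exp_add (_ + _) (_ + _)]; ring
      _ ≤ C₁ * C₂ * Real.exp ((K₁ + K₂) ^ 2 / (4 * ε) +
          (2 * Real.pi * D' * (|z.re| * |z.im|) + ε * ‖z‖ ^ 2)) := by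
        refine mul_le_mul_of_nonneg_left (Real.exp_le_exp.2 ?_) (by positivity)
        have e1 : |(z ^ 2).im| = 2 * (|z.re| * |z.im|) := by
          rw [sq, Complex.mul_im, ← abs_mul, show z.re * z.im + z.im * z.re =
            2 * (z.re * z.im) by ring, abs_mul 2, abs_two]
        have e3 : (K₁ + K₂) ^ 2 / (4 * ε) + ε * ‖z‖ ^ 2 - (K₁ + K₂) * ‖z‖ =
            (2 * ε * ‖z‖ - (K₁ + K₂)) ^ 2 / (4 * ε) := by field_simp; ring
        have e4 : 0 ≤ (2 * ε * ‖z‖ - (K₁ + K₂)) ^ 2 / (4 * ε) := by positivity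
        rw [e1]
        linarith
      _ = _ := by rw [Real.exp_add]; ring
  · intro ε hε
    obtain ⟨c₁, hc₁, h₁⟩ := ht.le_norm_deriv_mul_canonicalProduct ht' hq hq' hδ hqt hε
    obtain ⟨c₂, hc₂, h₂⟩ := ht'.le_norm_deriv_mul_canonicalProduct ht hq' hq hδ' hqt' hε
    obtain ⟨c₃, hc₃, h₃⟩ := hq.le_norm_deriv_mul_canonicalProduct hq' ht ht' hδ
      (fun m n => by rw [abs_sub_comm]; exact hqt n m) hε
    refine ⟨min (min c₁ c₂) c₃, lt_min (lt_min hc₁ hc₂) hc₃, ?_⟩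
    rintro ((n | n) | n)
    · refine le_trans ?_ (h₁ n)
      exact mul_le_mul_of_nonneg_right ((min_le_left _ _).trans (min_le_left _ _))
        (Real.exp_pos _).le
    · have e1 : deriv G (-t' n : ℂ) = -deriv (fun w => canonicalProduct D t' t w *
          canonicalProduct (D' - D) q' q w) (t' n) := by
        rw [funext hGneg, deriv_comp_neg (f := fun w => canonicalProduct D t' t w *
          canonicalProduct (D' - D) q' q w), neg_neg]
      simp only [Sum.elim_inl, Sum.elim_inr, Complex.ofReal_neg, neg_sq]
      rw [e1, norm_neg]
      refine le_trans ?_ (h₂ n)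
      exact mul_le_mul_of_nonneg_right ((min_le_left _ _).trans (min_le_right _ _))
        (Real.exp_pos _).le
    · have e1 : G = fun z => canonicalProduct (D' - D) q q' z * canonicalProduct D t t' z :=
        funext fun z => mul_comm _ _
      rw [e1]
      refine le_trans ?_ (h₃ n)
      exact mul_le_mul_of_nonneg_right (min_le_right _ _) (Real.exp_pos _).le
  · intro ε hε
    refine Summable.sum _ (Summable.sum _ ?_ ?_) ?_
    · exact ht.summable_exp_neg hε
    · simpa [Function.comp_def] using ht'.summable_exp_neg hε
    · exact hq.summable_exp_neg hε

end IsSquareRegular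

/-! ### Prescribing zeros of a function and of its transform together. -/

theorem HasGaussianDecay.add {f g : ℝ → ℂ} {a : ℝ} (hf : HasGaussianDecay f a)
    (hg : HasGaussianDecay g a) : HasGaussianDecay (fun x => f x + g x) a := by
  obtain ⟨C, hC⟩ := hf
  obtain ⟨C', hC'⟩ := hg
  refine ⟨C + C', fun x => (norm_add_le _ _).trans ?_⟩
  rw [add_mul]
  exact add_le_add (hC x) (hC' x)

theorem HasGaussianDecay.const_mul {f : ℝ → ℂ} {a : ℝ} (hf : HasGaussianDecay f a) (c : ℂ) :
    HasGaussianDecay (fun x => c * f x) a := by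
  obtain ⟨C, hC⟩ := hf
  refine ⟨‖c‖ * C, fun x => ?_⟩
  rw [norm_mul, mul_assoc]
  exact mul_le_mul_of_nonneg_left (hC x) (norm_nonneg _)

/-- The functions of a Hardy class vanishing on `Λ`, with Fourier transform vanishing on `M`. -/
def hardyVanishing (a b : ℝ) (Λ M : Set ℝ) : Submodule ℂ 𝓢(ℝ, ℂ) where
  carrier := {f | f ∈ hardyClass a b ∧ (∀ x ∈ Λ, f x = 0) ∧ ∀ ξ ∈ M, 𝓕 (f : ℝ → ℂ) ξ = 0}
  zero_mem' := by
    have h : 𝓕 ((0 : 𝓢(ℝ, ℂ)) : ℝ → ℂ) = 0 := by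
      rw [← SchwartzMap.fourier_coe, FourierTransform.fourier_zero]; rfl
    refine ⟨mem_hardyClass_iff.2 ⟨⟨0, by simp⟩, ⟨0, fun ξ => by rw [h]; simp⟩⟩, by simp,
      fun ξ _ => by rw [h]; rfl⟩
  add_mem' := by
    rintro f g ⟨hf, hf1, hf2⟩ ⟨hg, hg1, hg2⟩
    have h : 𝓕 ((f + g : 𝓢(ℝ, ℂ)) : ℝ → ℂ) = fun ξ => 𝓕 (f : ℝ → ℂ) ξ + 𝓕 (g : ℝ → ℂ) ξ := by
      simp only [← SchwartzMap.fourier_coe, FourierTransform.fourier_add]; rfl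
    rw [mem_hardyClass_iff] at hf hg
    refine ⟨mem_hardyClass_iff.2 ⟨hf.1.add hg.1, h ▸ hf.2.add hg.2⟩, fun x hx => ?_, fun ξ hξ => ?_⟩
    · rw [add_apply, hf1 x hx, hg1 x hx, add_zero]
    · rw [h]; simp only [hf2 ξ hξ, hg2 ξ hξ, add_zero]
  smul_mem' := by
    rintro c f ⟨hf, hf1, hf2⟩
    have h : 𝓕 ((c • f : 𝓢(ℝ, ℂ)) : ℝ → ℂ) = fun ξ => c * 𝓕 (f : ℝ → ℂ) ξ := by
      simp only [← SchwartzMap.fourier_coe, FourierTransform.fourier_smul]; rfl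
    rw [mem_hardyClass_iff] at hf
    refine ⟨mem_hardyClass_iff.2 ⟨hf.1.const_mul c, h ▸ hf.2.const_mul c⟩, fun x hx => ?_,
      fun ξ hξ => ?_⟩
    · rw [smul_apply, hf1 x hx, smul_zero]
    · rw [h]; simp only [hf2 ξ hξ, mul_zero]

/-- Finitely many additional conditions do not destroy infinite-dimensionality. -/
theorem not_finiteDimensional_hardyVanishing {a b : ℝ} {Λ M Λ' M' A B : Set ℝ} (hA : A.Finite)
    (hB : B.Finite) (hΛ : Λ' ⊆ Λ ∪ A) (hM : M' ⊆ M ∪ B)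
    (h : ¬ FiniteDimensional ℂ (hardyVanishing a b Λ M)) :
    ¬ FiniteDimensional ℂ (hardyVanishing a b Λ' M') := by
  intro hfin
  have := hA.to_subtype
  have := hB.to_subtype
  let φ : 𝓢(ℝ, ℂ) →ₗ[ℂ] (A → ℂ) × (B → ℂ) :=
    { toFun := fun f => (fun x => f x, fun ξ => (𝓕 f : 𝓢(ℝ, ℂ)) ξ)
      map_add' := fun f g => by rw [FourierTransform.fourier_add]; rfl
      map_smul' := fun c f => by rw [FourierTransform.fourier_smul]; rfl }
  refine h ((Submodule.fg_iff_finiteDimensional _).1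
    (Submodule.fg_of_fg_map_of_fg_inf_ker φ (IsNoetherian.noetherian _) ?_))
  have hle : hardyVanishing a b Λ M ⊓ LinearMap.ker φ ≤ hardyVanishing a b Λ' M' := by
    rintro f ⟨⟨h1, h2, h3⟩, h4⟩
    change φ f = 0 at h4
    have h5 : ∀ x : A, f x = 0 := fun x => congrFun (congrArg Prod.fst h4) x
    have h6 : ∀ ξ : B, (𝓕 f : 𝓢(ℝ, ℂ)) ξ = 0 := fun x => congrFun (congrArg Prod.snd h4) x
    refine ⟨h1, fun x hx => ?_, fun ξ hξ => ?_⟩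
    · rcases hΛ hx with h | h
      exacts [h2 x h, h5 ⟨x, h⟩]
    · rcases hM hξ with h | h
      · exact h3 ξ h
      · rw [← SchwartzMap.fourier_coe]; exact h6 ⟨ξ, h⟩
  exact (Submodule.fg_iff_finiteDimensional _).2 (Submodule.finiteDimensional_of_le hle)

theorem BoundedContinuousFunction.exists_continuousLinearMap {ι E : Type*} [TopologicalSpace ι]
    [DiscreteTopology ι] [NormedAddCommGroup E] [NormedSpace ℂ E] (φ : ι → E →ₗ[ℂ] ℂ) {C : ℝ}
    (hC : 0 ≤ C) (h : ∀ i e, ‖φ i e‖ ≤ C * ‖e‖) :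
    ∃ L : E →L[ℂ] (ι →ᵇ ℂ), (∀ e i, L e i = φ i e) ∧ ‖L‖ ≤ C := by
  refine ⟨LinearMap.mkContinuous
    { toFun := fun e => BoundedContinuousFunction.ofNormedAddCommGroupDiscrete
        (fun i => φ i e) (C * ‖e‖) fun i => h i e
      map_add' := fun e e' => by ext i; simp
      map_smul' := fun c e => by ext i; simp } C fun e => ?_, fun e i => rfl,
    LinearMap.mkContinuous_norm_le _ hC _⟩
  exact (BoundedContinuousFunction.norm_le (by positivity)).2 fun i => h i e

namespace IsGenerating

variable {ι κ : Type*} [TopologicalSpace ι] [DiscreteTopology ι] [TopologicalSpace κ]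
  [DiscreteTopology κ] {D D' : ℝ} {x : ι → ℝ} {y : κ → ℝ} {G H : ℂ → ℂ}

/-- Interpolation in a Hardy class with, in addition, almost all prescribed zeros of the Fourier
transform. -/
theorem exists_mem_hardyClass (hG : IsGenerating D x G) (hH : IsGenerating D' y H) {a b : ℝ}
    (ha : 0 < a) (hb : 0 < b) (hD : D ^ 2 < a * (1 / b - a)) (hD' : D' ^ 2 < b * (1 / a - b)) :
    ∃ J : Set κ, J.Finite ∧ ∃ a₀, ∀ α : ι →ᵇ ℂ, ∃ f ∈ hardyClass a b,
      (∀ i, f (x i) = Real.exp (-(a₀ * Real.pi) * x i ^ 2) * α i) ∧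
      ∀ j ∉ J, 𝓕 (f : ℝ → ℂ) (y j) = 0 := by
  classical
  have hpi := Real.pi_pos
  have exists_gt : ∀ {a b D : ℝ}, 0 < b → D ^ 2 < a * (1 / b - a) →
      ∃ b', b < b' ∧ D ^ 2 < a * (1 / b' - a) := by
    intro a b D hb h
    have hc : ContinuousAt (fun b' : ℝ => a * (1 / b' - a)) b :=
      continuousAt_const.mul ((continuousAt_const.div continuousAt_id hb.ne').sub continuousAt_const)
    obtain ⟨b', h1, h2⟩ := (((hc.eventually (lt_mem_nhds h)).filter_mono
      nhdsWithin_le_nhds).and (self_mem_nhdsWithin : ∀ᶠ b' in nhdsWithin b (Set.Ioi b), _)).exists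
    exact ⟨b', h2, h1⟩
  -- The rates satisfy `b < b₀ < b₂` and `a < a₀`. Transforms of `T α` decay at rate `b₂`, strictly
  -- faster than the weight `b₀` at the frequency nodes. Transforms of `S β` decay at rate `a₀`,
  -- exactly the weight at the space nodes, so `Ψ` below is merely bounded.
  obtain ⟨b₂, hb₂, hDb⟩ := exists_gt hb hD
  obtain ⟨a₀, ha₀, hDa⟩ := exists_gt ha hD'
  obtain ⟨b₀, hb₀, hb₀₂⟩ := exists_between hb₂
  obtain ⟨T, C₁, hC₁, hT, hTF, hTi⟩ := hG.exists_interpolation ha (hb.trans hb₂) ha₀ hDb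
  obtain ⟨S, C₂, hC₂, hS, hSF, hSi⟩ := hH.exists_interpolation hb (ha.trans ha₀) hb₀ hDa
  set η := 1 / (2 * (C₂ + 1)) with hη
  have hη0 : 0 < η := by positivity
  -- Because `b₀ < b₂`, only finitely many frequency nodes obstruct `‖Φ‖ ≤ η`; discarding them makes
  -- `‖Ψ‖ ‖Φ‖ ≤ C₂ η < 1`.
  set J : Set κ := {j | ¬ C₁ * Real.exp (-((b₂ - b₀) * Real.pi) * y j ^ 2) ≤ η} with hJ
  have hJfin : J.Finite := by
    have h1 := ((hH.summable ((b₂ - b₀) * Real.pi)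
      (mul_pos (sub_pos.2 hb₀₂) hpi)).mul_left C₁).tendsto_cofinite_zero
    exact h1.eventually (ge_mem_nhds hη0)
  obtain ⟨Φ, hΦ, hΦn⟩ := BoundedContinuousFunction.exists_continuousLinearMap
    (fun j => if j ∈ J then (0 : (ι →ᵇ ℂ) →ₗ[ℂ] ℂ) else
      { toFun := fun α => -(Real.exp (b₀ * Real.pi * y j ^ 2) : ℂ) * (𝓕 (T α) : 𝓢(ℝ, ℂ)) (y j)
        map_add' := fun α β => by
          rw [map_add, FourierTransform.fourier_add, add_apply, mul_add]
        map_smul' := fun c α => by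
          rw [map_smul, FourierTransform.fourier_smul, smul_apply, smul_eq_mul,
            smul_eq_mul, RingHom.id_apply]; ring }) hη0.le (fun j α => by
      split_ifs with hj
      · simp; positivity
      · simp only [LinearMap.coe_mk, AddHom.coe_mk]
        rw [norm_mul, norm_neg, Complex.norm_real, Real.norm_of_nonneg (Real.exp_pos _).le,
          SchwartzMap.fourier_coe]
        calc _ ≤ Real.exp (b₀ * Real.pi * y j ^ 2) *
              (C₁ * ‖α‖ * Real.exp (-(b₂ * Real.pi) * y j ^ 2)) := by gcongr; exact hTF α _
          _ = C₁ * Real.exp (-((b₂ - b₀) * Real.pi) * y j ^ 2) * ‖α‖ := by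
              rw [show -((b₂ - b₀) * Real.pi) * y j ^ 2 =
                b₀ * Real.pi * y j ^ 2 + -(b₂ * Real.pi) * y j ^ 2 by ring, Real.exp_add]
              ring
          _ ≤ η * ‖α‖ := by gcongr; simpa [hJ] using hj)
  have hinv : ∀ (g : 𝓢(ℝ, ℂ)) (v : ℝ), (𝓕⁻ g : 𝓢(ℝ, ℂ)) v = 𝓕 (g : ℝ → ℂ) (-v) := fun g v => by
    rw [SchwartzMap.fourierInv_coe, Real.fourierInv_eq_fourier_neg]
  obtain ⟨Ψ, hΨ, hΨn⟩ := BoundedContinuousFunction.exists_continuousLinearMap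
    (fun i =>
      ({ toFun := fun β => (Real.exp (a₀ * Real.pi * x i ^ 2) : ℂ) * (𝓕⁻ (S β) : 𝓢(ℝ, ℂ)) (x i)
         map_add' := fun α β => by
           rw [map_add, FourierTransform.fourierInv_add, add_apply, mul_add]
         map_smul' := fun c α => by
           rw [map_smul, FourierTransform.fourierInv_smul, smul_apply,
             smul_eq_mul, smul_eq_mul, RingHom.id_apply]; ring } : (κ →ᵇ ℂ) →ₗ[ℂ] ℂ)) hC₂
    (fun i β => by
      simp only [LinearMap.coe_mk, AddHom.coe_mk]
      rw [norm_mul, Complex.norm_real, Real.norm_of_nonneg (Real.exp_pos _).le, hinv]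
      calc _ ≤ Real.exp (a₀ * Real.pi * x i ^ 2) *
            (C₂ * ‖β‖ * Real.exp (-(a₀ * Real.pi) * (-x i) ^ 2)) := by gcongr; exact hSF β _
        _ = C₂ * ‖β‖ * Real.exp (a₀ * Real.pi * x i ^ 2 + -(a₀ * Real.pi) * x i ^ 2) := by
            rw [neg_sq, Real.exp_add]; ring
        _ ≤ C₂ * ‖β‖ := by simp)
  have hK : ‖-(Ψ.comp Φ)‖ < 1 := by
    rw [norm_neg]
    calc _ ≤ ‖Ψ‖ * ‖Φ‖ := Ψ.opNorm_comp_le Φ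
      _ ≤ C₂ * η := by gcongr
      _ < 1 := by rw [hη, mul_one_div, div_lt_one (by positivity)]; linarith
  refine ⟨J, hJfin, a₀, fun α₀ => ?_⟩
  -- The correction on the frequency side perturbs the space values by `Ψ (Φ α)`; a Neumann series
  -- inverts `1 + Ψ Φ`.
  obtain ⟨α, hα⟩ : ∃ α : ι →ᵇ ℂ, α + Ψ (Φ α) = α₀ := by
    refine ⟨((Units.oneSub _ hK)⁻¹ : ((ι →ᵇ ℂ) →L[ℂ] (ι →ᵇ ℂ))ˣ).val α₀, ?_⟩
    have := congrArg (fun L : (ι →ᵇ ℂ) →L[ℂ] (ι →ᵇ ℂ) => L α₀) (Units.oneSub _ hK).mul_inv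
    simpa using this
  have hF : ∀ ξ, 𝓕 ((T α + 𝓕⁻ (S (Φ α)) : 𝓢(ℝ, ℂ)) : ℝ → ℂ) ξ =
      𝓕 (T α : ℝ → ℂ) ξ + S (Φ α) ξ := by
    intro ξ
    rw [← SchwartzMap.fourier_coe, FourierTransform.fourier_add,
      FourierTransform.fourier_fourierInv_eq, add_apply, SchwartzMap.fourier_coe]
  refine ⟨T α + 𝓕⁻ (S (Φ α)), mem_hardyClass_iff.2 ⟨?_, ?_⟩, fun i => ?_, fun j hj => ?_⟩
  · refine HasGaussianDecay.add ⟨_, hT α⟩ (HasGaussianDecay.mono (a := a₀)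
      ⟨C₂ * ‖Φ α‖, fun v => ?_⟩ ha₀.le)
    rw [hinv, ← neg_sq v]
    exact hSF (Φ α) (-v)
  · rw [show 𝓕 ((T α + 𝓕⁻ (S (Φ α)) : 𝓢(ℝ, ℂ)) : ℝ → ℂ) = _ from funext hF]
    exact HasGaussianDecay.add (HasGaussianDecay.mono (a := b₂) ⟨_, hTF α⟩ hb₂.le) ⟨_, hS _⟩
  · have h1 := congrArg (fun g : ι →ᵇ ℂ => g i) hα
    simp only [BoundedContinuousFunction.add_apply, hΨ, LinearMap.coe_mk, AddHom.coe_mk] at h1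
    rw [add_apply, hTi, ← h1, mul_add, ← mul_assoc, ← Complex.ofReal_mul, ← Real.exp_add]
    simp
  · rw [hF, hSi, hΦ, if_neg hj]
    simp only [LinearMap.coe_mk, AddHom.coe_mk]
    rw [← mul_assoc, mul_neg, ← Complex.ofReal_mul, ← Real.exp_add]
    simp [SchwartzMap.fourier_coe]

end IsGenerating

/-- Infinitely many free interpolation nodes give an infinite-dimensional space. -/
theorem not_finiteDimensional_of_isGenerating {ι κ : Type*} [TopologicalSpace ι]
    [DiscreteTopology ι] [TopologicalSpace κ] [DiscreteTopology κ] {D D' : ℝ} {x : ι → ℝ}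
    {q : ℕ → ℝ} {y : κ → ℝ} {G H : ℂ → ℂ} (hG : IsGenerating D (Sum.elim x q) G)
    (hH : IsGenerating D' y H) {a b : ℝ} (ha : 0 < a) (hb : 0 < b)
    (hD : D ^ 2 < a * (1 / b - a)) (hD' : D' ^ 2 < b * (1 / a - b)) :
    ∃ B : Set ℝ, B.Finite ∧
      ¬ FiniteDimensional ℂ (hardyVanishing a b (Set.range x) (Set.range y \ B)) := by
  classical
  obtain ⟨J, hJ, a₀, h⟩ := hG.exists_mem_hardyClass hH ha hb hD hD'
  refine ⟨y '' J, hJ.image y, fun hfin => ?_⟩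
  choose f hf hfx hfy using h
  -- The data at the `k`-th free node cancel the interpolation weight, so evaluation at the free
  -- nodes sends the constructed functions to the standard unit vectors, which proves their
  -- independence.
  set w : ℕ → ℂ := fun k => Real.exp (a₀ * Real.pi * q k ^ 2)
  set α : ℕ → (ι ⊕ ℕ) →ᵇ ℂ := fun k => BoundedContinuousFunction.ofNormedAddCommGroupDiscrete
    (Pi.single (Sum.inr k) (w k)) ‖w k‖ fun i => by
      rw [Pi.single_apply]; split_ifs <;> simp
  have hα : ∀ k i, α k i = (Pi.single (Sum.inr k) (w k) : ι ⊕ ℕ → ℂ) i := fun k i => rfl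
  let g : ℕ → hardyVanishing a b (Set.range x) (Set.range y \ (y '' J)) := fun k =>
    ⟨f (α k), hf _, by
      rintro _ ⟨i, rfl⟩
      have := hfx (α k) (Sum.inl i)
      rwa [hα, Pi.single_eq_of_ne (by simp), mul_zero] at this, by
      rintro _ ⟨⟨j, rfl⟩, hj⟩
      exact hfy _ j fun h => hj ⟨j, h, rfl⟩⟩
  let ev : hardyVanishing a b (Set.range x) (Set.range y \ (y '' J)) →ₗ[ℂ] (ℕ → ℂ) :=
    { toFun := fun f k => f.1 (q k)
      map_add' := fun f g => rfl
      map_smul' := fun c f => rfl }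
  have hev : ev ∘ g = fun k => Pi.single k (1 : ℂ) := by
    funext k l
    have := hfx (α k) (Sum.inr l)
    simp only [Sum.elim_inr, hα] at this
    change f (α k) (q l) = _
    rw [this, Pi.single_apply, Pi.single_apply]
    by_cases hlk : l = k
    · subst hlk
      simp only [if_true, w]
      rw [← Complex.ofReal_mul, ← Real.exp_add]
      simp
    · simp [hlk]
  exact Module.Finite.not_linearIndependent_of_infinite g
    (LinearIndependent.of_comp ev (hev ▸ Pi.linearIndependent_single_one ℕ ℂ))

/-! ### The theorem. -/

theorem mainTheorem5 (a b : ℝ) (ha : 0 < a) (hb : 0 < b) (hab : a * b < 1)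
    (Λ M : Set ℝ) (DΛ DM : ℝ)
    (hΛneg : IsSmoothSequence (negativeHalf Λ) 2 DΛ) (hΛpos : IsSmoothSequence (positiveHalf Λ) 2 DΛ)
    (hMneg : IsSmoothSequence (negativeHalf M) 2 DM) (hMpos : IsSmoothSequence (positiveHalf M) 2 DM) :
    (DΛ > Real.sqrt (a * (1 / b - a)) → DM > Real.sqrt (b * (1 / a - b)) →
      ∀ f ∈ hardyClass a b,
        (∀ x ∈ Λ, f x = 0) → (∀ ξ ∈ M, 𝓕 (f : ℝ → ℂ) ξ = 0) → f = 0) ∧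
    (DΛ < Real.sqrt (a * (1 / b - a)) → DM < Real.sqrt (b * (1 / a - b)) →
      ∃ V : Submodule ℂ 𝓢(ℝ, ℂ), ¬ FiniteDimensional ℂ V ∧
        ∀ f ∈ V, f ∈ hardyClass a b ∧
          (∀ x ∈ Λ, f x = 0) ∧ (∀ ξ ∈ M, 𝓕 (f : ℝ → ℂ) ξ = 0)) := by
  obtain ⟨x₁, t, ht, hΛt⟩ := hΛpos.exists_of_positiveHalf
  obtain ⟨x₂, t', ht', hΛt'⟩ := hΛneg.exists_of_negativeHalf
  obtain ⟨y₁, s, hs, hMs⟩ := hMpos.exists_of_positiveHalf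
  obtain ⟨y₂, s', hs', hMs'⟩ := hMneg.exists_of_negativeHalf
  have hDΛ := ht.density_pos
  have hDM := hs.density_pos
  refine ⟨fun h₁ h₂ f hf hfΛ hfM => ?_, fun h₁ h₂ => ?_⟩
  · rw [gt_iff_lt, Real.sqrt_lt' hDΛ] at h₁
    rw [gt_iff_lt, Real.sqrt_lt' hDM] at h₂
    obtain ⟨hfa, hfb⟩ := mem_hardyClass_iff.1 hf
    exact f.eq_zero_of_zeros ha hb hab hfa hfb ht ht' hs hs'
      (fun n => hfΛ _ ((hΛt _).2 (Or.inr ⟨n, rfl⟩)).1)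
      (fun n => hfΛ _ ((hΛt' _).2 (Or.inr ⟨n, rfl⟩)).1)
      (fun n => hfM _ ((hMs _).2 (Or.inr ⟨n, rfl⟩)).1)
      (fun n => hfM _ ((hMs' _).2 (Or.inr ⟨n, rfl⟩)).1) h₁ h₂
  -- Densities strictly between the given ones and the thresholds leave room for the free nodes. The
  -- dropped points of least modulus and the discarded frequencies return as finitely many extra
  -- conditions.
  · obtain ⟨D, hD, hD₁⟩ := exists_between h₁
    obtain ⟨D', hD', hD₁'⟩ := exists_between h₂
    obtain ⟨q, G, hG⟩ := ht.exists_isGenerating ht' hD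
    obtain ⟨r, H, hH⟩ := hs.exists_isGenerating hs' hD'
    obtain ⟨B, hB, hV⟩ := not_finiteDimensional_of_isGenerating hG hH ha hb
      ((Real.lt_sqrt (hDΛ.trans hD).le).1 hD₁) ((Real.lt_sqrt (hDM.trans hD').le).1 hD₁')
    refine ⟨hardyVanishing a b Λ M, not_finiteDimensional_hardyVanishing
      (A := {x₁, x₂}) (B := {y₁, y₂} ∪ B) (by simp) (by simp [hB]) (fun x hx => ?_)
      (fun ξ hξ => ?_) hV, fun f hf => hf⟩
    · rcases le_total 0 x with h | h
      · rcases (hΛt x).1 ⟨hx, h⟩ with rfl | ⟨n, rfl⟩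
        · simp
        · exact Or.inl ⟨Sum.inl n, rfl⟩
      · rcases (hΛt' x).1 ⟨hx, h⟩ with rfl | ⟨n, rfl⟩
        · simp
        · exact Or.inl ⟨Sum.inr n, rfl⟩
    · by_cases hξB : ξ ∈ B
      · exact Or.inr (Or.inr hξB)
      rcases le_total 0 ξ with h | h
      · rcases (hMs ξ).1 ⟨hξ, h⟩ with rfl | ⟨n, rfl⟩
        · simp
        · exact Or.inl ⟨⟨Sum.inl (Sum.inl n), rfl⟩, hξB⟩
      · rcases (hMs' ξ).1 ⟨hξ, h⟩ with rfl | ⟨n, rfl⟩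
        · simp
        · exact Or.inl ⟨⟨Sum.inl (Sum.inr n), rfl⟩, hξB⟩
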